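/- Let $\mathfrak X^*$ be the free monoid over a countably infinite alphabet $\mathfrak X$ that contains the pairwise distinct letters $x,y,z,t$ and $x,y_i,z_i,t_i$ ($i\in\mathbb N=\{1,2,\dots\}$). For a set $\Sigma$ of identities let $\operatorname{var}\Sigma$ be the variety of all monoids that satisfy $\Sigma$; for a monoid variety $\mathbf V$ let $\mathrm{FIC}(\mathbf V)=\{(\mathbf u,\mathbf v)\in\mathfrak X^*\times\mathfrak X^*\mid \mathbf V\text{ satisfies }\mathbf u\approx\mathbf v\}$ be the corresponding fully invariant congruence, and let $\mathfrak L(\mathbf V)$ be the lattice of all subvarieties of $\mathbf V$. For a congruence $\alpha$ on $\mathfrak X^*$ and a word $\mathbf u$, let $[\mathbf u]^\alpha$ be the $\alpha$-class of $\mathbf u$. For a set $\mathtt W$ of $\alpha$-classes, let $M_\alpha(\mathtt W)$ be the Rees quotient of $\mathfrak X^*/\alpha$ over the ideal of all $\alpha$-classes $\mathtt v$ such that no element of $\mathtt W$ has the form $\mathtt p\mathtt v\mathtt s$ with $\mathtt p,\mathtt s\in\mathfrak X^*/\alpha$, and let $\mathbf M_\alpha(\mathtt W)$ be the monoid variety generated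 by $M_\alpha(\mathtt W)$. Put $$\Sigma_1:=\{xyx^2\approx x^2yx,\ x^2y^2\approx y^2x^2,\ xzxyty\approx xzyxty\},$$ $$\alpha_1:=\mathrm{FIC}(\operatorname{var}\Sigma_1),\qquad \alpha_1^{\circ}:=\mathrm{FIC}(\operatorname{var}(\Sigma_1\cup\{x^2\approx x^3\})).$$ For $k\in\mathbb N$ let $S_{2k}^\sharp$ be the set of all permutations $\pi$ of $\{1,\dots,2k\}$ (written $i\mapsto i\pi$) with $k+1\le 1\pi,\dots,k\pi\le 2k$ and $1\le (k+1)\pi,\dots,(2k)\pi\le k$, and for $\pi\in S_{2k}^\sharp$ put $$\mathbf a_{k,k}[\pi]:=\Bigl(\prod_{i=1}^k z_it_i\Bigr)\,x\,\Bigl(\prod_{i=1}^{2k-1} z_{i\pi}y_i^2\Bigr)z_{(2k)\pi}\,x\,\Bigl(\prod_{i=k+1}^{2k} t_iz_i\Bigr).$$ **Proposition.** For every $k\in\mathbb N$, every $\pi\in S_{2k}^\sharp$ and each $\alpha\in\{\alpha_1,\alpha_1^\circ\}$, the lattice $\mathfrak L\bigl(\mathbf M_{\alpha}(\{[\mathbf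 a_{k,k}[\pi]]^{\alpha}\})\bigr)$ is not distributive. -/

import Mathlib

/-- The alphabet: a countably infinite set of letters `x`, `y i`, `z i`, `t i`. -/
inductive Letter : Type
  | x : Letter
  | y : ℕ → Letter
  | z : ℕ → Letter
  | t : ℕ → Letter
  deriving DecidableEq

instance Letter.instCountable : Countable Letter := by
  refine Function.Injective.countable (β := ℕ × ℕ) (f := fun l => match l with
    | Letter.x => (0, 0)
    | Letter.y i => (1, i)
    | Letter.z i => (2, i)
    | Letter.t i => (3, i)) ?_
  intro a b h
  cases a <;> cases b <;> simp_all

instance Letter.instInfinite : Infinite Letter :=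
  Infinite.of_injective Letter.y (fun _ _ h => Letter.y.inj h)

/-- Words are elements of the free monoid over the alphabet. -/
abbrev Word : Type := FreeMonoid Letter

/-- An identity `u ≈ v` is a pair of words. -/
abbrev MonoidIdentity : Type := Word × Word

/-- The monoid `M` satisfies the identity `u ≈ v`: `φ(u) = φ(v)` for every substitution `φ`. -/
def MonoidSatisfies (M : Type) [Monoid M] (e : MonoidIdentity) : Prop :=
  ∀ φ : Letter → M, FreeMonoid.lift φ e.1 = FreeMonoid.lift φ e.2

/-- The class of all monoids satisfying every identity in `S`. -/
def equationalClass (S : Set MonoidIdentity) : Set MonCat.{0} :=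
  {M | ∀ e ∈ S, MonoidSatisfies M e}

/-- A monoid variety is a class of monoids given by a set of identities. -/
@[ext]
structure MonoidVariety : Type 1 where
  carrier : Set MonCat.{0}
  equational : ∃ S : Set MonoidIdentity, carrier = equationalClass S

namespace MonoidVariety

/-- `var S`, the variety given by the set `S` of identities. -/
def ofIdentities (S : Set MonoidIdentity) : MonoidVariety := ⟨equationalClass S, S, rfl⟩

/-- The variety `V` satisfies the identity `e`. -/
def Satisfies (V : MonoidVariety) (e : MonoidIdentity) : Prop :=
  ∀ M ∈ V.carrier, MonoidSatisfies M e

/-- Varieties are ordered by inclusion. -/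
instance instPartialOrder : PartialOrder MonoidVariety :=
  PartialOrder.lift carrier (fun _ _ h => MonoidVariety.ext h)

theorem mem_of_satisfies (V : MonoidVariety) (M : MonCat.{0})
    (h : ∀ e, V.Satisfies e → MonoidSatisfies M e) : M ∈ V.carrier := by
  obtain ⟨S, hS⟩ := V.equational
  rw [hS]
  intro e he
  refine h e (fun N hN => ?_)
  rw [hS] at hN
  exact hN e he

/-- The variety generated by a class `C` of monoids: all monoids satisfying every identity
that holds throughout `C`. -/
def generatedBy (C : Set MonCat.{0}) : MonoidVariety :=
  ofIdentities {e | ∀ M ∈ C, MonoidSatisfies M e}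

theorem subset_generatedBy (C : Set MonCat.{0}) : C ⊆ (generatedBy C).carrier :=
  fun M hM _ he => he M hM

/-- `generatedBy C` is the least variety containing `C`. -/
theorem generatedBy_le_iff (C : Set MonCat.{0}) (V : MonoidVariety) :
    generatedBy C ≤ V ↔ C ⊆ V.carrier := by
  constructor
  · intro h
    exact (subset_generatedBy C).trans h
  · intro h M hM
    exact V.mem_of_satisfies M (fun e he => hM e (fun N hN => he N (h hN)))

/-- The lattice of monoid varieties: the meet is the intersection, the join is the variety
generated by the union. -/
instance instLattice : Lattice MonoidVariety where
  inf V W := ⟨V.carrier ∩ W.carrier, by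
    obtain ⟨S, hS⟩ := V.equational
    obtain ⟨T, hT⟩ := W.equational
    refine ⟨S ∪ T, ?_⟩
    rw [hS, hT]
    ext M
    constructor
    · rintro ⟨h1, h2⟩ e (he | he)
      · exact h1 e he
      · exact h2 e he
    · intro h
      exact ⟨fun e he => h e (Or.inl he), fun e he => h e (Or.inr he)⟩⟩
  sup V W := generatedBy (V.carrier ∪ W.carrier)
  inf_le_left _ _ := fun _ h => h.1
  inf_le_right _ _ := fun _ h => h.2
  le_inf _ _ _ h1 h2 := fun _ h => ⟨h1 h, h2 h⟩
  le_sup_left _ _ := Set.subset_union_left.trans (subset_generatedBy _)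
  le_sup_right _ _ := Set.subset_union_right.trans (subset_generatedBy _)
  sup_le _ _ _ h1 h2 := (generatedBy_le_iff _ _).2 (Set.union_subset h1 h2)

/-- The variety `V` has a distributive subvariety lattice; the subvariety lattice is the
principal ideal `Set.Iic V` of the lattice of all monoid varieties. -/
def IsDistributive (V : MonoidVariety) : Prop :=
  ∀ X Y Z : Set.Iic V, X ⊓ (Y ⊔ Z) = (X ⊓ Y) ⊔ (X ⊓ Z)

/-- The fully invariant congruence on the free monoid corresponding to `V`. -/
def fic (V : MonoidVariety) : Con Word where
  r u v := V.Satisfies (u, v)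
  iseqv :=
    { refl := fun _ _ _ _ => rfl
      symm := fun h M hM φ => (h M hM φ).symm
      trans := fun h1 h2 M hM φ => (h1 M hM φ).trans (h2 M hM φ) }
  mul' := by
    intro a b c d h1 h2 M hM φ
    have e1 := h1 M hM φ
    have e2 := h2 M hM φ
    simp only [map_mul] at e1 e2 ⊢
    rw [e1, e2]

end MonoidVariety

/-- The Rees congruence of a two-sided ideal `I` of a monoid `S`: it collapses `I` to a point. -/
def reesCon {S : Type} [Monoid S] (I : Set S) (hI : ∀ a ∈ I, ∀ s, s * a ∈ I ∧ a * s ∈ I) :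
    Con S where
  r a b := a = b ∨ (a ∈ I ∧ b ∈ I)
  iseqv :=
    { refl := fun _ => Or.inl rfl
      symm := by
        rintro a b (h | ⟨h1, h2⟩)
        · exact Or.inl h.symm
        · exact Or.inr ⟨h2, h1⟩
      trans := by
        rintro a b c (rfl | ⟨h1, h2⟩) (rfl | ⟨h3, h4⟩)
        · exact Or.inl rfl
        · exact Or.inr ⟨h3, h4⟩
        · exact Or.inr ⟨h1, h2⟩
        · exact Or.inr ⟨h1, h4⟩ }
  mul' := by
    rintro a b c d (rfl | ⟨h1, h2⟩) (rfl | ⟨h3, h4⟩)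
    · exact Or.inl rfl
    · exact Or.inr ⟨(hI _ h3 _).1, (hI _ h4 _).1⟩
    · exact Or.inr ⟨(hI _ h1 _).2, (hI _ h2 _).2⟩
    · exact Or.inr ⟨(hI _ h1 _).2, (hI _ h2 _).2⟩

/-- The closure of a set of `α`-classes under taking factors. -/
def factorClosure (α : Con Word) (W : Set α.Quotient) : Set α.Quotient :=
  {v | ∃ u ∈ W, ∃ p s : α.Quotient, u = p * v * s}

theorem factorClosure_compl_ideal (α : Con Word) (W : Set α.Quotient) :
    ∀ a ∈ (factorClosure α W)ᶜ, ∀ s,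
      s * a ∈ (factorClosure α W)ᶜ ∧ a * s ∈ (factorClosure α W)ᶜ := by
  intro a ha s
  constructor
  · rintro ⟨u, hu, p, q, h⟩
    exact ha ⟨u, hu, p * s, q, by rw [h]; simp only [mul_assoc]⟩
  · rintro ⟨u, hu, p, q, h⟩
    exact ha ⟨u, hu, p, s * q, by rw [h]; simp only [mul_assoc]⟩

/-- `M_α(W)`: the Rees quotient of the monoid of `α`-classes over the ideal of all classes
that are not factors of a class in `W`. -/
abbrev SapirMonoid (α : Con Word) (W : Set α.Quotient) : Type :=
  (reesCon (factorClosure α W)ᶜ (factorClosure_compl_ideal α W)).Quotient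

/-- The variety generated by the monoid `M_α(W)`. -/
def sapirVariety (α : Con Word) (W : Set α.Quotient) : MonoidVariety :=
  MonoidVariety.generatedBy {MonCat.of (SapirMonoid α W)}

/-- The letter `x` as a word. -/
def wx : Word := FreeMonoid.of Letter.x
/-- The letter `y i` as a word. -/
def wy (i : ℕ) : Word := FreeMonoid.of (Letter.y i)
/-- The letter `z i` as a word. -/
def wz (i : ℕ) : Word := FreeMonoid.of (Letter.z i)
/-- The letter `t i` as a word. -/
def wt (i : ℕ) : Word := FreeMonoid.of (Letter.t i)

/-- The identities `xyx² ≈ x²yx`, `x²y² ≈ y²x²` and `xzxyty ≈ xzyxty`. -/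
def alphaOneIdentities : Set MonoidIdentity :=
  {(wx * wy 0 * wx ^ 2, wx ^ 2 * wy 0 * wx),
   (wx ^ 2 * wy 0 ^ 2, wy 0 ^ 2 * wx ^ 2),
   (wx * wz 0 * wx * wy 0 * wt 0 * wy 0, wx * wz 0 * wy 0 * wx * wt 0 * wy 0)}

/-- The congruence `α₁`. -/
def alphaOne : Con Word := (MonoidVariety.ofIdentities alphaOneIdentities).fic

/-- The aperiodic version of `α₁`, in which the identity `x² ≈ x³` is added. -/
def alphaOneAperiodic : Con Word :=
  (MonoidVariety.ofIdentities (insert (wx ^ 2, wx ^ 3) alphaOneIdentities)).fic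

/-- The word
`a_{n,m}[ρ] = (∏_{i=1}^n z_i t_i) x (∏_{i=1}^{n+m-1} z_{iρ} y_i²) z_{(n+m)ρ} x
(∏_{i=n+1}^{n+m} t_i z_i)`.
The permuted set `{1, …, n+m}` is represented by `Fin (n + m)`, so that `i : Fin (n + m)` stands
for the number `i + 1`; the letters keep the indices `1, …, n+m`. -/
def aWord (n m : ℕ) (ρ : Equiv.Perm (Fin (n + m))) : Word :=
  ((List.range n).map fun i => wz (i + 1) * wt (i + 1)).prod * wx *
    ((List.finRange (n + m)).map fun i =>
      wz ((ρ i : ℕ) + 1) * (if (i : ℕ) + 1 < n + m then wy ((i : ℕ) + 1) ^ 2 else 1)).prod * wx *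
    ((List.range m).map fun i => wt (n + i + 1) * wz (n + i + 1)).prod

/-- The set of all permutations of `{1, …, 2k}` that map `{1, …, k}` into `{k+1, …, 2k}` and
`{k+1, …, 2k}` into `{1, …, k}`. -/
def sharpPerm (k : ℕ) : Set (Equiv.Perm (Fin (k + k))) :=
  {π | (∀ i : Fin (k + k), (i : ℕ) < k → k ≤ (π i : ℕ)) ∧
       (∀ i : Fin (k + k), k ≤ (i : ℕ) → (π i : ℕ) < k)}

/-- The variety generated by `M_α([a_{k,k}[π]]^α)`. -/
def aVariety (α : Con Word) (k : ℕ) (π : Equiv.Perm (Fin (k + k))) : MonoidVariety :=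
  sapirVariety α {((aWord k k π : Word) : α.Quotient)}

/-! Both halves use one criterion, `not_isDistributive_of_saturated`. If `C1` and `C2` are unions of
classes of the fully invariant congruence of `V`, then their syntactic monoids, and that of `C1 ∩
C2`, lie in `V`. Let `C1` be stable under `e1`, `C2` under `e2` and `C1 ∩ C2` under `e0`. The
syntactic monoid of `C1 ∩ C2` then lies in `X0 ∧ (X1 ∨ X2)`, where `Xi` is cut out of `V` by `ei`.
If `u ≈ v` follows from `e0, e1` and also from `e0, e2`, while `u` but not `v` is in `C1 ∩ C2`, then
that monoid is not in `(X0 ∧ X1) ∨ (X0 ∧ X2)`.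

For `α₁` the defining identities are balanced. The words `xxy`, `xyx`, `yxx` can be substituted into
`a_{k,k}[π]`, and its class fixes enough orders and multiplicities to make them isoterms for `V`.
Identities between these three words then copy the nondistributive lattice of equivalences on a
three-element set.

For `α₁°` multiplicities of squared letters are lost. What remains is a pattern (`Pat`): the orders
of first and of last occurrences, except among the letters `y i` with `i ≠ 0`, and the
multiplicities of the other letters. The class of `a_{k,k}[π]` determines its pattern
(`Guard.pat_of_aperiodic`). Conversely, after squaring the `y i`, every word with this pattern and
content can be sorted into `a_{k,k}[π]` (`Guard.aperiodicClass_eq_of_pat`). So identities of `V`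
preserve the pattern, also with the outer letter renamed, and with it some shorter patterns
(`Guard.preserves_patSquare`).

The witnesses are four words `gen X X'`, where `X` is `ξ` or `ξξ` and `X'` is `ξ'` or `ξ'ξ'`; write
`w11, w12, w21, w22`. Take `e1 : w11 ≈ w12`, `e2 : w11 ≈ w21`, `e0 : w12 ≈ w22`, and `u ≈ v` the
same as `e2`. Substituting `ξξ` for `ξ` in `e1` gives `w21 ≈ w22`, so `e0` and `e1` imply `e2`. The
sets are a pattern `Left`, in which `ξ` is rigid, and its mirror image `Right`, in which `ξ'` is
rigid.

Stability is the hard point: when a block repeated in an image is doubled, it must contain no rigid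
letter. A letter around a linear letter is excluded at once. The outer letter is excluded by the
pigeonhole lemma `not_mem_block_of_separated`: between its two occurrences lie first occurrences of
more letters than there are letters available to produce them, while their last occurrences are
separated by linear letters. For `e0`, `Right` must be used before `Left`, as it makes `ξ'` one more
separated letter. -/

/-! ### Orders of first and of last occurrences, and substitution. -/

section OccurrenceOrder

variable {α β : Type}

/-- The letter `c` occurs in `u`, and no `d` stands before the first `c`. -/
def FirstLT : List α → α → α → Prop
  | [], _, _ => False
  | e :: u, c, d => e = c ∨ (e ≠ d ∧ FirstLT u c d)

/-- The letter `d` occurs in `u`, and no `c` stands after the last `d`. -/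
def LastLT (u : List α) (c d : α) : Prop := FirstLT u.reverse d c

theorem firstLT_append (u v : List α) (c d : α) :
    FirstLT (u ++ v) c d ↔ FirstLT u c d ∨ (d ∉ u ∧ FirstLT v c d) := by
  induction u with
  | nil => simp [FirstLT]
  | cons e u ih =>
    simp only [List.cons_append, FirstLT, ih, List.mem_cons, not_or]
    constructor
    · rintro (h | ⟨h1, h2 | h2⟩)
      · exact Or.inl (Or.inl h)
      · exact Or.inl (Or.inr ⟨h1, h2⟩)
      · exact Or.inr ⟨⟨fun h => h1 h.symm, h2.1⟩, h2.2⟩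
    · rintro ((h | h) | h)
      · exact Or.inl h
      · exact Or.inr ⟨h.1, Or.inl h.2⟩
      · exact Or.inr ⟨fun h' => h.1.1 h'.symm, Or.inr ⟨h.1.2, h.2⟩⟩

theorem lastLT_append (u v : List α) (c d : α) :
    LastLT (u ++ v) c d ↔ LastLT v c d ∨ (c ∉ v ∧ LastLT u c d) := by
  simp [LastLT, firstLT_append]

@[simp] theorem firstLT_nil (c d : α) : FirstLT [] c d ↔ False := Iff.rfl

@[simp] theorem lastLT_nil (c d : α) : LastLT [] c d ↔ False := Iff.rfl

theorem firstLT_cons (e : α) (u : List α) (c d : α) :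
    FirstLT (e :: u) c d ↔ e = c ∨ (e ≠ d ∧ FirstLT u c d) := Iff.rfl

theorem firstLT_singleton (e c d : α) : FirstLT [e] c d ↔ e = c := by simp [FirstLT]

theorem lastLT_singleton (e c d : α) : LastLT [e] c d ↔ e = d := by simp [LastLT, FirstLT]

theorem lastLT_cons (e : α) (u : List α) (c d : α) :
    LastLT (e :: u) c d ↔ LastLT u c d ∨ (c ∉ u ∧ e = d) := by
  rw [← List.singleton_append, lastLT_append, lastLT_singleton]

theorem firstLT_reverse (u : List α) (c d : α) : FirstLT u.reverse c d ↔ LastLT u d c := Iff.rfl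

theorem lastLT_reverse (u : List α) (c d : α) : LastLT u.reverse c d ↔ FirstLT u d c := by
  simp [LastLT]

theorem FirstLT.mem {u : List α} {c d : α} (h : FirstLT u c d) : c ∈ u := by
  induction u with
  | nil => exact h.elim
  | cons e u ih =>
    rcases h with h | h
    · simp [h]
    · exact List.mem_cons_of_mem _ (ih h.2)

theorem LastLT.mem {u : List α} {c d : α} (h : LastLT u c d) : d ∈ u := by
  simpa using FirstLT.mem h

theorem firstLT_of_mem {u : List α} {c d : α} (hc : c ∈ u) (hd : d ∉ u) : FirstLT u c d := by
  induction u with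
  | nil => simp at hc
  | cons e u ih =>
    simp only [List.mem_cons, not_or] at hc hd
    rcases hc with h | h
    · exact Or.inl h.symm
    · exact Or.inr ⟨fun h' => hd.1 h'.symm, ih h hd.2⟩

theorem lastLT_of_mem {u : List α} {c d : α} (hc : c ∉ u) (hd : d ∈ u) : LastLT u c d :=
  firstLT_of_mem (by simpa using hd) (by simpa using hc)

theorem FirstLT.asymm {u : List α} {c d : α} (hcd : c ≠ d) (h : FirstLT u c d) :
    ¬ FirstLT u d c := by
  induction u with
  | nil => exact h.elim
  | cons e u ih =>
    rcases h with h | h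
    · subst h
      rintro (h | h)
      · exact hcd h
      · exact h.1 rfl
    · rintro (h' | h')
      · exact h.1 h'
      · exact ih h.2 h'.2

theorem LastLT.asymm {u : List α} {c d : α} (hcd : c ≠ d) (h : LastLT u c d) :
    ¬ LastLT u d c := FirstLT.asymm hcd.symm h

theorem FirstLT.total {u : List α} {c d : α} (hc : c ∈ u) : FirstLT u c d ∨ FirstLT u d c := by
  induction u with
  | nil => simp at hc
  | cons e u ih =>
    by_cases h1 : e = c
    · exact Or.inl (Or.inl h1)
    · by_cases h2 : e = d
      · exact Or.inr (Or.inl h2)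
      · rcases ih (by simpa [Ne.symm h1] using hc) with h | h
        · exact Or.inl (Or.inr ⟨h2, h⟩)
        · exact Or.inr (Or.inr ⟨h1, h⟩)

theorem LastLT.total {u : List α} {c d : α} (hc : c ∈ u) : LastLT u c d ∨ LastLT u d c :=
  (FirstLT.total (u := u.reverse) (d := d) (by simpa using hc)).symm

theorem FirstLT.trans {u : List α} {c d e : α} (h1 : FirstLT u c d) (h2 : FirstLT u d e) :
    FirstLT u c e := by
  induction u with
  | nil => exact h1.elim
  | cons f u ih =>
    rcases h1 with h1 | h1
    · exact Or.inl h1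
    · rcases h2 with h2 | h2
      · exact absurd h2 h1.1
      · exact Or.inr ⟨h2.1, ih h1.2 h2.2⟩

theorem LastLT.trans {u : List α} {c d e : α} (h1 : LastLT u c d) (h2 : LastLT u d e) :
    LastLT u c e := FirstLT.trans h2 h1

/-- This and the next three lemmas localise letters in a factorised word: once one letter is
excluded from an outer factor, the order excludes its companion or passes to the remaining factor.
-/
theorem FirstLT.not_mem_left {p q : List α} {c d : α} (h : FirstLT (p ++ q) c d) (hc : c ∉ p) :
    d ∉ p := by
  rcases (firstLT_append _ _ _ _).1 h with h | h
  · exact absurd h.mem hc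
  · exact h.1

theorem FirstLT.right {p q : List α} {c d : α} (h : FirstLT (p ++ q) c d) (hc : c ∉ p) :
    FirstLT q c d := by
  rcases (firstLT_append _ _ _ _).1 h with h | h
  · exact absurd h.mem hc
  · exact h.2

theorem LastLT.not_mem_right {p q : List α} {c d : α} (h : LastLT (p ++ q) c d) (hd : d ∉ q) :
    c ∉ q := by
  rcases (lastLT_append _ _ _ _).1 h with h | h
  · exact absurd h.mem hd
  · exact h.1

theorem LastLT.left {p q : List α} {c d : α} (h : LastLT (p ++ q) c d) (hd : d ∉ q) :
    LastLT p c d := by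
  rcases (lastLT_append _ _ _ _).1 h with h | h
  · exact absurd h.mem hd
  · exact h.2

theorem firstLT_split {p q : List α} {c d : α} (hc : c ∈ p) (hd : d ∉ p) :
    FirstLT (p ++ q) c d := (firstLT_append _ _ _ _).2 (Or.inl (firstLT_of_mem hc hd))

theorem lastLT_split {p q : List α} {c d : α} (hc : c ∉ q) (hd : d ∈ q) :
    LastLT (p ++ q) c d := (lastLT_append _ _ _ _).2 (Or.inl (lastLT_of_mem hc hd))

/-- Substitution of words for letters. -/
def wsub (θ : α → List β) (u : List α) : List β := u.flatMap θ

@[simp] theorem wsub_nil (θ : α → List β) : wsub θ [] = [] := rfl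

@[simp] theorem wsub_cons (θ : α → List β) (c : α) (u : List α) :
    wsub θ (c :: u) = θ c ++ wsub θ u := rfl

@[simp] theorem wsub_append (θ : α → List β) (u v : List α) :
    wsub θ (u ++ v) = wsub θ u ++ wsub θ v := by simp [wsub]

theorem wsub_reverse (θ : α → List β) (u : List α) :
    (wsub θ u).reverse = wsub (fun c => (θ c).reverse) u.reverse := by
  induction u with
  | nil => rfl
  | cons c u ih => simp [ih]

theorem wsub_wsub {γ : Type} (θ : β → List γ) (τ : α → List β) (u : List α) :
    wsub θ (wsub τ u) = wsub (fun c => wsub θ (τ c)) u := by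
  induction u with
  | nil => rfl
  | cons c u ih => simp [ih]

theorem mem_wsub {θ : α → List β} {u : List α} {c : β} : c ∈ wsub θ u ↔ ∃ v ∈ u, c ∈ θ v := by
  simp [wsub]

theorem wsub_id (u : List α) : wsub (fun c => [c]) u = u := by
  induction u with
  | nil => rfl
  | cons c u ih => simp [ih]

theorem wsub_congr {θ τ : α → List β} {u : List α} (h : ∀ c ∈ u, θ c = τ c) :
    wsub θ u = wsub τ u := by
  induction u with
  | nil => rfl
  | cons c u ih =>
    simp only [wsub_cons]
    rw [h c (by simp), ih (fun d hd => h d (by simp [hd]))]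

/-- The letters `c'` and `d'` are markers, present exactly in the images of `c` and `d`. Their order
in the image therefore reads off the order in `u`. -/
theorem firstLT_wsub {φ : α → List β} {c d : α} {c' d' : β} (hcd : c ≠ d)
    (hc : ∀ e, c' ∈ φ e ↔ e = c) (hd : ∀ e, d' ∈ φ e ↔ e = d) (u : List α) :
    FirstLT (wsub φ u) c' d' ↔ FirstLT u c d := by
  induction u with
  | nil => simp
  | cons e u ih =>
    rw [wsub_cons, firstLT_append, ih, firstLT_cons]
    by_cases h1 : e = c
    · subst h1
      have : FirstLT (φ e) c' d' := firstLT_of_mem ((hc e).2 rfl) (fun h => hcd ((hd e).1 h))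
      simp [this]
    · have : ¬ FirstLT (φ e) c' d' := fun h => h1 ((hc e).1 h.mem)
      simp [this, h1, hd]

theorem lastLT_wsub {φ : α → List β} {c d : α} {c' d' : β} (hcd : c ≠ d)
    (hc : ∀ e, c' ∈ φ e ↔ e = c) (hd : ∀ e, d' ∈ φ e ↔ e = d) (u : List α) :
    LastLT (wsub φ u) c' d' ↔ LastLT u c d := by
  unfold LastLT
  rw [wsub_reverse]
  exact firstLT_wsub hcd.symm (by simpa using hd) (by simpa using hc) _

theorem firstLT_wsub_congr {θ τ : α → List β} {c d : β}
    (hF : ∀ e, FirstLT (θ e) c d ↔ FirstLT (τ e) c d) (hd : ∀ e, d ∈ θ e ↔ d ∈ τ e)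
    (u : List α) : FirstLT (wsub θ u) c d ↔ FirstLT (wsub τ u) c d := by
  induction u with
  | nil => rfl
  | cons e u ih => rw [wsub_cons, wsub_cons, firstLT_append, firstLT_append, ih, hF, hd]

theorem lastLT_wsub_congr {θ τ : α → List β} {c d : β}
    (hL : ∀ e, LastLT (θ e) c d ↔ LastLT (τ e) c d) (hc : ∀ e, c ∈ θ e ↔ c ∈ τ e)
    (u : List α) : LastLT (wsub θ u) c d ↔ LastLT (wsub τ u) c d := by
  unfold LastLT
  rw [wsub_reverse, wsub_reverse]
  exact firstLT_wsub_congr hL (by simpa using hc) _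

/-! ### Doubling a block, and patterns of words. -/

variable [DecidableEq α]

/-- The substitution that doubles the image of the letter `v`. -/
def doubleAt (θ : α → List β) (v : α) : α → List β :=
  fun c => if c = v then θ c ++ θ c else θ c

theorem mem_doubleAt (θ : α → List β) (v e : α) (c : β) :
    c ∈ doubleAt θ v e ↔ c ∈ θ e := by
  unfold doubleAt; split_ifs <;> simp

theorem firstLT_doubleAt (θ : α → List β) (v e : α) (c d : β) :
    FirstLT (doubleAt θ v e) c d ↔ FirstLT (θ e) c d := by
  unfold doubleAt
  split_ifs
  · rw [firstLT_append]; tauto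
  · rfl

theorem lastLT_doubleAt (θ : α → List β) (v e : α) (c d : β) :
    LastLT (doubleAt θ v e) c d ↔ LastLT (θ e) c d := by
  unfold doubleAt
  split_ifs
  · rw [lastLT_append]; tauto
  · rfl

variable [DecidableEq β]

theorem count_wsub {φ : α → List β} {c : α} {c' : β} {n : ℕ} (hc : (φ c).count c' = n)
    (hne : ∀ e, e ≠ c → c' ∉ φ e) (u : List α) : (wsub φ u).count c' = n * u.count c := by
  induction u with
  | nil => simp
  | cons e u ih =>
    rw [wsub_cons, List.count_append, ih]
    by_cases h : e = c
    · subst h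
      rw [hc, List.count_cons_self]
      ring
    · rw [List.count_eq_zero_of_not_mem (hne e h), List.count_cons_of_ne h]
      ring

theorem count_le_count_wsub {φ : α → List β} {v : α} {c : β} (h : c ∈ φ v) (u : List α) :
    u.count v ≤ (wsub φ u).count c := by
  induction u with
  | nil => simp
  | cons e u ih =>
    rw [wsub_cons, List.count_append]
    by_cases he : e = v
    · subst he
      rw [List.count_cons_self]
      have := List.count_pos_iff.2 h
      omega
    · rw [List.count_cons_of_ne he]
      omega

/-- The word `u` has the same pattern as `b`: the first and the last occurrences of the letters
of `b` come in the same order, except that two letters of `D` are not compared, and the letters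
outside `D` occur equally often. -/
structure Pat (b : List α) (D : α → Prop) (u : List α) : Prop where
  first : ∀ c ∈ b, ∀ d ∈ b, c ≠ d → ¬ (D c ∧ D d) → FirstLT b c d → FirstLT u c d
  last : ∀ c ∈ b, ∀ d ∈ b, c ≠ d → ¬ (D c ∧ D d) → LastLT b c d → LastLT u c d
  cnt : ∀ c ∈ b, ¬ D c → u.count c = b.count c
  mem : ∀ c ∈ b, c ∈ u

theorem Pat.refl (b : List α) (D : α → Prop) : Pat b D b :=
  ⟨fun _ _ _ _ _ _ h => h, fun _ _ _ _ _ _ h => h, fun _ _ _ => rfl, fun _ h => h⟩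

theorem Pat.reverse {b : List α} {D : α → Prop} {u : List α} (h : Pat b D u) :
    Pat b.reverse D u.reverse := by
  refine ⟨?_, ?_, ?_, ?_⟩
  · intro c hc d hd hcd hD hF
    exact h.last d (by simpa using hd) c (by simpa using hc) hcd.symm (fun h => hD h.symm) hF
  · intro c hc d hd hcd hD hF
    rw [lastLT_reverse] at hF ⊢
    exact h.first d (by simpa using hd) c (by simpa using hc) hcd.symm (fun h => hD h.symm) hF
  · intro c hc hD
    simpa using h.cnt c (by simpa using hc) hD
  · intro c hc
    simpa using h.mem c (by simpa using hc)

theorem pat_reverse {b : List α} {D : α → Prop} {u : List α} :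
    Pat b.reverse D u.reverse ↔ Pat b D u :=
  ⟨fun h => by simpa using h.reverse, Pat.reverse⟩

/-- A change of `u` that affects only the number of letters from `D` and the relative order of
such letters does not change the pattern. -/
theorem Pat.congr {b : List α} {D : α → Prop} {u v : List α} (h : Pat b D u)
    (hF : ∀ c ∈ b, ∀ d ∈ b, c ≠ d → ¬ (D c ∧ D d) → FirstLT u c d → FirstLT v c d)
    (hL : ∀ c ∈ b, ∀ d ∈ b, c ≠ d → ¬ (D c ∧ D d) → LastLT u c d → LastLT v c d)
    (hc : ∀ c ∈ b, ¬ D c → v.count c = u.count c) (hm : ∀ c ∈ b, c ∈ u → c ∈ v) :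
    Pat b D v :=
  ⟨fun c hc d hd hcd hD hb => hF c hc d hd hcd hD (h.first c hc d hd hcd hD hb),
    fun c hc d hd hcd hD hb => hL c hc d hd hcd hD (h.last c hc d hd hcd hD hb),
    fun c hcb hD => (hc c hcb hD).trans (h.cnt c hcb hD),
    fun c hcb => hm c hcb (h.mem c hcb)⟩

theorem count_wsub_doubleAt {θ : α → List β} {v : α} {c : β} (h : c ∉ θ v) (u : List α) :
    (wsub (doubleAt θ v) u).count c = (wsub θ u).count c := by
  induction u with
  | nil => rfl
  | cons e u ih =>
    rw [wsub_cons, wsub_cons, List.count_append, List.count_append, ih]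
    congr 1
    unfold doubleAt
    split_ifs with he
    · subst he
      simp [List.count_eq_zero_of_not_mem h]
    · rfl

/-- The new copy of the block is adjacent to an old one, so every order of first or last occurrences
survives. Only multiplicities of letters of the block change, and those are free for letters of `D`.
-/
theorem pat_doubleAt {b : List β} {D : β → Prop} {θ : α → List β} {v : α}
    (h : ∀ c ∈ b, c ∈ θ v → D c) (l r : List β) (u : List α) :
    Pat b D (l ++ wsub (doubleAt θ v) u ++ r) ↔ Pat b D (l ++ wsub θ u ++ r) := by
  have hm : ∀ c, c ∈ wsub (doubleAt θ v) u ↔ c ∈ wsub θ u := by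
    intro c
    simp only [mem_wsub, mem_doubleAt]
  have hF : ∀ c d, FirstLT (l ++ wsub (doubleAt θ v) u ++ r) c d ↔
      FirstLT (l ++ wsub θ u ++ r) c d := by
    intro c d
    simp only [firstLT_append, List.mem_append, hm]
    rw [firstLT_wsub_congr (fun e => firstLT_doubleAt θ v e c d) (fun e => mem_doubleAt θ v e d)]
  have hL : ∀ c d, LastLT (l ++ wsub (doubleAt θ v) u ++ r) c d ↔
      LastLT (l ++ wsub θ u ++ r) c d := by
    intro c d
    simp only [lastLT_append, hm]
    rw [lastLT_wsub_congr (fun e => lastLT_doubleAt θ v e c d) (fun e => mem_doubleAt θ v e c)]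
  have hc : ∀ c ∈ b, ¬ D c → (l ++ wsub (doubleAt θ v) u ++ r).count c =
      (l ++ wsub θ u ++ r).count c := by
    intro c hc hD
    simp only [List.count_append, count_wsub_doubleAt (fun h' => hD (h c hc h'))]
  constructor
  · intro hp
    exact hp.congr (fun c _ d _ _ _ => (hF c d).1) (fun c _ d _ _ _ => (hL c d).1)
      (fun c hcb hD => (hc c hcb hD).symm) (fun c _ => by simp [hm])
  · intro hp
    exact hp.congr (fun c _ d _ _ _ => (hF c d).2) (fun c _ d _ _ _ => (hL c d).2)
      hc (fun c _ => by simp [hm])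

end OccurrenceOrder

/-! ### Syntactic monoids and the criterion for nondistributivity. -/

section Syntactic

open FreeMonoid

/-- The syntactic congruence of a set of words. -/
def syntacticCon (C : Word → Prop) : Con Word where
  r u v := ∀ l r, C (l * u * r) ↔ C (l * v * r)
  iseqv :=
    { refl := fun _ _ _ => Iff.rfl
      symm := fun h l r => (h l r).symm
      trans := fun h1 h2 l r => (h1 l r).trans (h2 l r) }
  mul' := by
    intro a b c d h1 h2 l r
    have e1 := h1 l (c * r)
    have e2 := h2 (l * b) r
    simp only [mul_assoc] at e1 e2 ⊢
    exact e1.trans e2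

/-- Applying an identity to a word does not change its membership in `C`. -/
def Stable (C : Word → Prop) (e : MonoidIdentity) : Prop :=
  ∀ (θ : Letter → Word) (l r : Word), C (l * lift θ e.1 * r) ↔ C (l * lift θ e.2 * r)

theorem lift_mk (c : Con Word) (θ : Letter → Word) (u : Word) :
    lift (fun a => ((θ a : Word) : c.Quotient)) u = ((lift θ u : Word) : c.Quotient) := by
  have : lift (fun a => ((θ a : Word) : c.Quotient)) = (c.mk').comp (lift θ) := by
    apply FreeMonoid.hom_eq
    intro a
    simp
  rw [this]
  rfl

theorem conQuotient_satisfies (c : Con Word) (e : MonoidIdentity) :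
    MonoidSatisfies c.Quotient e ↔ ∀ θ : Letter → Word, c (lift θ e.1) (lift θ e.2) := by
  constructor
  · intro h θ
    have := h (fun a => ((θ a : Word) : c.Quotient))
    rw [lift_mk, lift_mk] at this
    exact c.eq.1 this
  · intro h φ
    have : ∃ θ : Letter → Word, φ = fun a => ((θ a : Word) : c.Quotient) := by
      have hs : ∀ a, ∃ w : Word, ((w : Word) : c.Quotient) = φ a := fun a =>
        Con.mk'_surjective (φ a)
      choose θ hθ using hs
      exact ⟨θ, funext fun a => (hθ a).symm⟩
    obtain ⟨θ, rfl⟩ := this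
    rw [lift_mk, lift_mk]
    exact c.eq.2 (h θ)

theorem syntactic_satisfies (C : Word → Prop) (e : MonoidIdentity) :
    MonoidSatisfies (syntacticCon C).Quotient e ↔ Stable C e :=
  conQuotient_satisfies _ _

theorem MonoidSatisfies.comp {M : Type} [Monoid M] {u v : Word} (h : MonoidSatisfies M (u, v))
    (θ : Letter → Word) : MonoidSatisfies M (lift θ u, lift θ v) := by
  intro φ
  have key : ∀ w : Word, lift φ (lift θ w) = lift (fun a => lift φ (θ a)) w := by
    intro w
    have : (lift φ).comp (lift θ) = lift (fun a => lift φ (θ a)) := by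
      apply FreeMonoid.hom_eq
      intro a
      simp
    rw [← this]
    rfl
  simp only [key]
  exact h _

theorem MonoidSatisfies.context {M : Type} [Monoid M] {u v : Word} (h : MonoidSatisfies M (u, v))
    (l r : Word) : MonoidSatisfies M (l * u * r, l * v * r) := by
  intro φ
  have := h φ
  simp only [map_mul] at this ⊢
  rw [this]

theorem MonoidSatisfies.symm {M : Type} [Monoid M] {u v : Word} (h : MonoidSatisfies M (u, v)) :
    MonoidSatisfies M (v, u) := fun φ => (h φ).symm

theorem MonoidSatisfies.trans {M : Type} [Monoid M] {u v w : Word}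
    (h1 : MonoidSatisfies M (u, v)) (h2 : MonoidSatisfies M (v, w)) :
    MonoidSatisfies M (u, w) := fun φ => (h1 φ).trans (h2 φ)

/-- The set `C` of words is a union of classes of the congruence of `V`. -/
def Saturated (V : MonoidVariety) (C : Word → Prop) : Prop :=
  ∀ u v, V.Satisfies (u, v) → C u → C v

theorem Saturated.stable {V : MonoidVariety} {C : Word → Prop} (h : Saturated V C)
    {e : MonoidIdentity} (he : V.Satisfies e) : Stable C e := by
  intro θ l r
  have h1 : V.Satisfies (l * lift θ e.1 * r, l * lift θ e.2 * r) :=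
    fun M hM => ((he M hM).comp θ).context l r
  exact ⟨h _ _ h1, h _ _ (fun M hM => (h1 M hM).symm)⟩

/-- The source of all members of `V` used below: substitution instances of an identity of `V`, in
any context, are again identities of `V`, so a saturated set is stable under them. -/
theorem Saturated.mem {V : MonoidVariety} {C : Word → Prop} (h : Saturated V C) :
    MonCat.of (syntacticCon C).Quotient ∈ V.carrier :=
  V.mem_of_satisfies _ fun e he => (syntactic_satisfies C e).2 (h.stable he)

/-- A criterion for a variety to have a nondistributive lattice of subvarieties. -/
theorem not_isDistributive_of_saturated {V : MonoidVariety} {e0 e1 e2 : MonoidIdentity}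
    {C1 C2 : Word → Prop} {u v : Word} (hC1 : Saturated V C1) (hC2 : Saturated V C2)
    (hs1 : Stable C1 e1) (hs2 : Stable C2 e2) (hs0 : Stable (fun w => C1 w ∧ C2 w) e0)
    (hu1 : C1 u) (hu2 : C2 u) (hv : ¬ (C1 v ∧ C2 v))
    (h1 : ∀ M : MonCat.{0}, MonoidSatisfies M e0 → MonoidSatisfies M e1 →
      MonoidSatisfies M (u, v))
    (h2 : ∀ M : MonCat.{0}, MonoidSatisfies M e0 → MonoidSatisfies M e2 →
      MonoidSatisfies M (u, v)) :
    ¬ V.IsDistributive := by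
  intro hd
  let S : MonoidIdentity → MonoidVariety := fun e => MonoidVariety.ofIdentities {e}
  have hS : ∀ e (M : MonCat.{0}), M ∈ (S e).carrier ↔ MonoidSatisfies M e := by
    intro e M
    constructor
    · intro h
      exact h e rfl
    · rintro h e' rfl
      exact h
  let X : MonoidIdentity → Set.Iic V := fun e => ⟨V ⊓ S e, Set.mem_Iic.2 inf_le_left⟩
  have key := hd (X e0) (X e1) (X e2)
  have key' : (V ⊓ S e0) ⊓ ((V ⊓ S e1) ⊔ (V ⊓ S e2)) =
      ((V ⊓ S e0) ⊓ (V ⊓ S e1)) ⊔ ((V ⊓ S e0) ⊓ (V ⊓ S e2)) := congrArg Subtype.val key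
  have hC : Saturated V (fun w => C1 w ∧ C2 w) := fun a b hab h =>
    ⟨hC1 a b hab h.1, hC2 a b hab h.2⟩
  -- The syntactic monoid of the intersection lies on the left-hand side of the distributive law.
  -- For the join: an identity of the join holds in the syntactic monoids of both sets, hence
  -- stabilises each of them and so their intersection.
  have hin : MonCat.of (syntacticCon (fun w => C1 w ∧ C2 w)).Quotient ∈
      ((V ⊓ S e0) ⊓ ((V ⊓ S e1) ⊔ (V ⊓ S e2)) : MonoidVariety).carrier := by
    refine ⟨⟨hC.mem, (hS _ _).2 ((syntactic_satisfies _ _).2 hs0)⟩, ?_⟩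
    refine MonoidVariety.mem_of_satisfies _ _ fun e he => (syntactic_satisfies _ _).2 ?_
    have m1 : MonCat.of (syntacticCon C1).Quotient ∈
        ((V ⊓ S e1) ⊔ (V ⊓ S e2) : MonoidVariety).carrier :=
      (le_sup_left : V ⊓ S e1 ≤ (V ⊓ S e1) ⊔ (V ⊓ S e2))
        ⟨hC1.mem, (hS _ _).2 ((syntactic_satisfies _ _).2 hs1)⟩
    have m2 : MonCat.of (syntacticCon C2).Quotient ∈
        ((V ⊓ S e1) ⊔ (V ⊓ S e2) : MonoidVariety).carrier :=
      (le_sup_right : V ⊓ S e2 ≤ (V ⊓ S e1) ⊔ (V ⊓ S e2))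
        ⟨hC2.mem, (hS _ _).2 ((syntactic_satisfies _ _).2 hs2)⟩
    have t1 := (syntactic_satisfies _ _).1 (he _ m1)
    have t2 := (syntactic_satisfies _ _).1 (he _ m2)
    intro θ l r
    exact and_congr (t1 θ l r) (t2 θ l r)
  rw [key'] at hin
  have hsat : MonoidSatisfies (syntacticCon (fun w => C1 w ∧ C2 w)).Quotient (u, v) := by
    refine hin (u, v) ?_
    rintro M (hM | hM)
    · exact h1 M ((hS _ _).1 hM.1.2) ((hS _ _).1 hM.2.2)
    · exact h2 M ((hS _ _).1 hM.1.2) ((hS _ _).1 hM.2.2)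
  -- On the right-hand side `u ≈ v` holds; the identity substitution in the empty context refutes
  -- it.
  have := ((syntactic_satisfies _ _).1 hsat) of 1 1
  have hid : ∀ w : Word, lift (of : Letter → Word) w = w := by
    intro w
    have : lift (of : Letter → Word) = MonoidHom.id Word := FreeMonoid.hom_eq (by simp)
    rw [this]
    rfl
  simp only [one_mul, mul_one, hid] at this
  exact hv (this.1 ⟨hu1, hu2⟩)

/-- The class of `w` is a factor of itself, so it lies outside the collapsed ideal and forms a
singleton in the Rees quotient. A value equal to it in the quotient is equal to it already modulo
`α`. -/
theorem sapirVariety_satisfies {α : Con Word} {w u v : Word}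
    (h : (sapirVariety α {((w : Word) : α.Quotient)}).Satisfies (u, v)) (θ : Letter → Word)
    (l r : Word) (hu : α (l * lift θ u * r) w) : α (l * lift θ v * r) w := by
  have h1 : MonoidSatisfies (SapirMonoid α {((w : Word) : α.Quotient)}) (u, v) :=
    h _ (MonoidVariety.subset_generatedBy _ rfl)
  set c := reesCon (factorClosure α {((w : Word) : α.Quotient)})ᶜ
    (factorClosure_compl_ideal α {((w : Word) : α.Quotient)}) with hc
  have key : ∀ x : Word, lift (fun a => (((θ a : Word) : α.Quotient) : c.Quotient)) x =
      (((lift θ x : Word) : α.Quotient) : c.Quotient) := by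
    intro x
    have : lift (fun a => (((θ a : Word) : α.Quotient) : c.Quotient)) =
        (c.mk').comp ((α.mk').comp (lift θ)) := by
      apply FreeMonoid.hom_eq
      intro a
      simp
    rw [this]
    rfl
  have h2 := h1.context l r
  have h3 := (h1 (fun a => (((θ a : Word) : α.Quotient) : c.Quotient)))
  rw [key, key] at h3
  have h4 : c (((l * lift θ u * r : Word) : α.Quotient)) ((l * lift θ v * r : Word) : α.Quotient) := by
    have h5 := c.mul (c.mul (c.refl ((l : Word) : α.Quotient)) (c.eq.1 h3))
      (c.refl ((r : Word) : α.Quotient))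
    exact h5
  rcases h4 with h4 | h4
  · exact α.trans (α.symm (α.eq.1 h4)) hu
  · exact absurd ⟨_, rfl, 1, 1, by rw [one_mul, mul_one]; exact (α.eq.2 hu).symm⟩ h4.1

end Syntactic

/-! ### Sorting words by swaps of adjacent letters. -/

section Sorting

variable {α : Type} {Q : Type} [Monoid Q]

/-- The letters `d` and `c` after the prefix `l` and before the suffix `r` may be swapped. -/
def CanSwap (D : α → Prop) (l : List α) (d c : α) (r : List α) : Prop :=
  (D c ∧ D d) ∨ (c ∈ l ∧ d ∈ r) ∨ (d ∈ l ∧ c ∈ r)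

/-- The last two cases of `CanSwap` are the two directions of `xzxyty ≈ xzyxty`: an occurrence that
is not the first of its letter commutes with an adjacent one that is not the last of its letter. -/
theorem prod_swap {D : α → Prop} {f : α → Q}
    (hcomm : ∀ c d, D c → D d → f c * f d = f d * f c)
    (hsw : ∀ X Y Z T : Q, X * Z * X * Y * T * Y = X * Z * Y * X * T * Y)
    {l r : List α} {c d : α} (hs : CanSwap D l d c r) :
    ((l ++ d :: c :: r).map f).prod = ((l ++ c :: d :: r).map f).prod := by
  rcases hs with hs | ⟨hc, hd⟩ | ⟨hd, hc⟩
  · simp only [List.map_append, List.map_cons, List.prod_append, List.prod_cons]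
    rw [← mul_assoc (f d), hcomm d c hs.2 hs.1, mul_assoc]
  · obtain ⟨l1, l2, rfl⟩ := List.append_of_mem hc
    obtain ⟨r1, r2, rfl⟩ := List.append_of_mem hd
    have := hsw (f c) (f d) (l2.map f).prod (r1.map f).prod
    simp only [List.map_append, List.map_cons, List.prod_append, List.prod_cons]
    simp only [mul_assoc] at this ⊢
    have h2 := congrArg (fun z => (l1.map f).prod * (z * (r2.map f).prod)) this
    simp only [mul_assoc] at h2
    exact h2.symm
  · obtain ⟨l1, l2, rfl⟩ := List.append_of_mem hd
    obtain ⟨r1, r2, rfl⟩ := List.append_of_mem hc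
    have := hsw (f d) (f c) (l2.map f).prod (r1.map f).prod
    simp only [List.map_append, List.map_cons, List.prod_append, List.prod_cons]
    simp only [mul_assoc] at this ⊢
    have h2 := congrArg (fun z => (l1.map f).prod * (z * (r2.map f).prod)) this
    simp only [mul_assoc] at h2
    exact h2

variable [DecidableEq α]

/-- The words `s` and `t` have the same content and compatible orders of first and of last
occurrences, letters outside `D` occur at most twice, and no letter of `D` surrounds a letter
that occurs once. -/
structure SameOrder (D : α → Prop) (s t : List α) : Prop where
  perm : ∀ c, t.count c = s.count c
  first : ∀ c d, c ≠ d → ¬ (D c ∧ D d) → FirstLT s c d → FirstLT t c d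
  last : ∀ c d, c ≠ d → ¬ (D c ∧ D d) → LastLT s c d → LastLT t c d
  le_two : ∀ c, ¬ D c → s.count c ≤ 2
  lin : ∀ c d, ¬ D c → D d → s.count c = 1 → d ∈ s → FirstLT s c d ∨ LastLT s d c

/-- A swap alters the order of first occurrences only if neither letter is in `l`, and of last
occurrences only if neither is in `r`. `CanSwap` excludes both unless the two letters are in `D`,
where orders are not compared. -/
theorem SameOrder.swap {D : α → Prop} {s l r : List α} {c d : α}
    (h : SameOrder D s (l ++ d :: c :: r)) (hs : CanSwap D l d c r) :
    SameOrder D s (l ++ c :: d :: r) := by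
  refine ⟨?_, ?_, ?_, h.le_two, h.lin⟩
  · intro e
    rw [← h.perm e]
    simp only [List.count_append, List.count_cons]
    omega
  · intro e f hef hD hF
    have := h.first e f hef hD hF
    simp only [firstLT_append, firstLT_cons] at this ⊢
    rcases this with h1 | ⟨h1, h2⟩
    · exact Or.inl h1
    · by_cases hx : d = e ∧ c = f
      · obtain ⟨rfl, rfl⟩ := hx
        rcases hs with hs | hs | hs
        · exact absurd hs.symm hD
        · exact absurd hs.1 h1
        · exact Or.inl (firstLT_of_mem hs.1 h1)
      · refine Or.inr ⟨h1, ?_⟩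
        tauto
  · intro e f hef hD hF
    have := h.last e f hef hD hF
    simp only [lastLT_append, lastLT_cons, List.mem_cons] at this ⊢
    by_cases hx : d = e ∧ c = f
    · obtain ⟨rfl, rfl⟩ := hx
      rcases hs with hs | hs | hs
      · exact absurd hs.symm hD
      · have hdr := hs.2
        tauto
      · by_cases hd : d ∈ r
        · tauto
        · exact Or.inl (Or.inl (Or.inl (lastLT_of_mem hd hs.2)))
    · have hed : c = f → e ≠ d := fun h1 h2 => hx ⟨h2.symm, h1⟩
      tauto

/-- In the first word `c` comes next, in the second `d` stands in its way. If neither swap through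
`xzxyty ≈ xzyxty` were possible, then two first or two last occurrences would be in conflicting
order, or a letter occurring three times, hence in `D`, would surround a linear letter, against
`lin`. -/
theorem SameOrder.canSwap {D : α → Prop} {l u' v' r : List α} {c d : α}
    (h : SameOrder D (l ++ c :: u') (l ++ v' ++ d :: c :: r)) (hcd : c ≠ d) (hv' : c ∉ v') :
    CanSwap D (l ++ v') d c r := by
  by_cases hD : D c ∧ D d
  · exact Or.inl hD
  have hcc := h.perm c
  have hcd' := h.perm d
  simp only [List.count_append, List.count_cons, beq_self_eq_true, if_true, beq_iff_eq, hcd,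
    hcd.symm, if_false, List.count_eq_zero_of_not_mem hv'] at hcc hcd'
  have hdu : d ∈ u' := List.count_pos_iff.1 (by omega)
  by_cases hcl : c ∈ l
  · by_cases hdr : d ∈ r
    · exact Or.inr (Or.inl ⟨by simp [hcl], hdr⟩)
    have hnl : ¬ LastLT (l ++ c :: u') c d := by
      intro hL
      have := h.last c d hcd hD hL
      simp only [lastLT_append, lastLT_cons, List.mem_cons] at this
      rcases this with ((h1 | h1) | h1) | h1
      · exact hdr h1.mem
      · exact hcd h1.2
      · simp at h1
      · simp at h1
    have hcu : c ∈ u' := by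
      by_contra hcu
      exact hnl (lastLT_append _ _ _ _ |>.2 (Or.inl ((lastLT_cons _ _ _ _).2
        (Or.inl (lastLT_of_mem hcu hdu)))))
    have c1 := List.count_pos_iff.2 hcu
    have c2 := List.count_pos_iff.2 hcl
    have hcr : c ∈ r := List.count_pos_iff.1 (by omega)
    refine Or.inr (Or.inr ⟨?_, hcr⟩)
    by_contra hd
    simp only [List.mem_append, not_or] at hd
    rw [List.count_eq_zero_of_not_mem hd.1, List.count_eq_zero_of_not_mem hd.2,
      List.count_eq_zero_of_not_mem hdr] at hcd'
    -- `c` occurs in `l`, at the marked place and in `u'`: too often for a letter outside `D`.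
    have hDc : D c := by
      by_contra hDc
      have := h.le_two c hDc
      simp only [List.count_append, List.count_cons, beq_self_eq_true, if_true] at this
      omega
    have hDd : ¬ D d := fun hDd => hD ⟨hDc, hDd⟩
    rcases h.lin d c hDd hDc
      (by simp only [List.count_append, List.count_cons, beq_iff_eq, hcd, if_false,
            List.count_eq_zero_of_not_mem hd.1]; omega) (by simp) with h1 | h1
    · exact hd.1 (by
        by_contra
        exact absurd hcl ((FirstLT.not_mem_left h1) hd.1))
    · exact hnl h1
  · have hdl : d ∈ l := by
      by_contra hdl
      have h1 : FirstLT (l ++ c :: u') c d :=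
        (firstLT_append _ _ _ _).2 (Or.inr ⟨hdl, Or.inl rfl⟩)
      have h2 := h.first c d hcd hD h1
      have := h2.not_mem_left (by simp [hcl, hv'])
      have h3 := h2.right (by simp [hcl, hv'])
      rcases h3 with h3 | h3
      · exact hcd h3.symm
      · exact h3.1 rfl
    refine Or.inr (Or.inr ⟨by simp [hdl], ?_⟩)
    by_contra hcr
    rw [List.count_eq_zero_of_not_mem hcl, List.count_eq_zero_of_not_mem hcr] at hcc
    have hcu : c ∉ u' := fun hcu => by
      have := List.count_pos_iff.2 hcu
      omega
    have hL : LastLT (l ++ c :: u') c d :=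
      (lastLT_append _ _ _ _).2 (Or.inl ((lastLT_cons _ _ _ _).2
        (Or.inl (lastLT_of_mem hcu hdu))))
    have h2 := h.last c d hcd hD hL
    have hdr : d ∈ r := by
      by_contra hdr
      simp only [lastLT_append, lastLT_cons, List.mem_cons] at h2
      rcases h2 with ((h1 | h1) | h1) | h1
      · exact hdr h1.mem
      · exact hcd h1.2
      · simp at h1
      · simp at h1
    have d1 := List.count_pos_iff.2 hdr
    have d2 := List.count_pos_iff.2 hdl
    -- Here `d` has the three occurrences: in `l`, at the marked place and in `r`.
    have hDd : D d := by
      by_contra hDd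
      have := h.le_two d hDd
      simp only [List.count_append, List.count_cons, beq_iff_eq, hcd, if_false] at this
      omega
    rcases h.lin c d (fun hDc => hD ⟨hDc, hDd⟩) hDd
      (by simp only [List.count_append, List.count_cons, beq_self_eq_true, if_true,
            List.count_eq_zero_of_not_mem hcl]; omega) (by simp [hdl]) with h1 | h1
    · exact absurd hdl (h1.not_mem_left hcl)
    · exact absurd hL (h1.asymm hcd.symm)


/-- Words with the same order have the same value in every monoid in which the letters of `D`
commute and adjacent letters satisfying `CanSwap` may be swapped. -/
theorem SameOrder.prod_eq {D : α → Prop} {f : α → Q}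
    (hcomm : ∀ c d, D c → D d → f c * f d = f d * f c)
    (hsw : ∀ X Y Z T : Q, X * Z * X * Y * T * Y = X * Z * Y * X * T * Y)
    (u : List α) : ∀ l v : List α, SameOrder D (l ++ u) (l ++ v) →
      ((l ++ u).map f).prod = ((l ++ v).map f).prod := by
  induction u with
  | nil =>
    intro l v h
    have hv : v = [] := by
      rw [List.eq_nil_iff_forall_not_mem]
      intro c hc
      have h1 := h.perm c
      have h2 := List.count_pos_iff.2 hc
      simp only [List.count_append, List.count_nil] at h1
      omega
    rw [hv]
  | cons c u ih =>
    intro l v h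
    -- Bubble `c` leftwards through `v1`; at length zero it joins the common prefix and the outer
    -- induction applies.
    have move : ∀ n : ℕ, ∀ v1 v2 : List α, v1.length = n → c ∉ v1 →
        SameOrder D (l ++ c :: u) (l ++ v1 ++ c :: v2) →
        ((l ++ c :: u).map f).prod = ((l ++ v1 ++ c :: v2).map f).prod := by
      intro n
      induction n with
      | zero =>
        intro v1 v2 hn _ h
        obtain rfl := List.length_eq_zero_iff.1 hn
        have := ih (l ++ [c]) v2 (by simpa using h)
        simpa using this
      | succ n ihn =>
        intro v1 v2 hn hc h
        rcases List.eq_nil_or_concat v1 with rfl | ⟨v', d, rfl⟩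
        · simp at hn
        simp only [List.concat_eq_append, List.mem_append, List.mem_singleton, not_or] at hc
        have h' : SameOrder D (l ++ c :: u) (l ++ v' ++ d :: c :: v2) := by simpa using h
        have hs := h'.canSwap hc.2 hc.1
        have h1 := ihn v' (d :: v2) (by simpa using hn) hc.1 (h'.swap hs)
        rw [h1, ← prod_swap hcomm hsw hs]
        simp
    have hcv : c ∈ v := by
      have h1 := h.perm c
      simp only [List.count_append, List.count_cons_self] at h1
      exact List.count_pos_iff.1 (by omega)
    obtain ⟨v1, v2, rfl, hv1⟩ := List.eq_append_cons_of_mem hcv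
    have := move v1.length v1 v2 rfl hv1 (by simpa using h)
    simpa using this

end Sorting

/-! ### Effect of the defining identities on patterns. -/

section PatternIdentities

variable {β : Type} [DecidableEq β]

theorem pat_iff_of_orders {b : List β} {D : β → Prop} {u v : List β}
    (hF : ∀ c d, FirstLT u c d ↔ FirstLT v c d) (hL : ∀ c d, LastLT u c d ↔ LastLT v c d)
    (hc : ∀ c, v.count c = u.count c) (hm : ∀ c, c ∈ u ↔ c ∈ v) : Pat b D u ↔ Pat b D v :=
  ⟨fun h => h.congr (fun c _ d _ _ _ => (hF c d).1) (fun c _ d _ _ _ => (hL c d).1)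
      (fun c _ _ => hc c) (fun c _ => (hm c).1),
    fun h => h.congr (fun c _ d _ _ _ => (hF c d).2) (fun c _ d _ _ _ => (hL c d).2)
      (fun c _ _ => (hc c).symm) (fun c _ => (hm c).2)⟩

/-- Here and for `xzxyty ≈ xzyxty` the two sides agree in all orders and multiplicities, so nothing
is required of `D`. The identities `x² ≈ x³` and `x²y² ≈ y²x²` do change such data, and there the
blocks may meet `b` only in letters of `D`. -/
theorem pat_xyxx (b : List β) (D : β → Prop) (l r W V : List β) :
    Pat b D (l ++ (W ++ V ++ W ++ W) ++ r) ↔ Pat b D (l ++ (W ++ W ++ V ++ W) ++ r) := by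
  apply pat_iff_of_orders
  · intro c d
    simp only [firstLT_append, List.mem_append]
    tauto
  · intro c d
    simp only [lastLT_append, List.mem_append]
    tauto
  · intro c
    simp only [List.count_append]
    omega
  · intro c
    simp only [List.mem_append]
    tauto

theorem pat_xzxyty (b : List β) (D : β → Prop) (l r W Z V T : List β) :
    Pat b D (l ++ (W ++ Z ++ W ++ V ++ T ++ V) ++ r) ↔
      Pat b D (l ++ (W ++ Z ++ V ++ W ++ T ++ V) ++ r) := by
  apply pat_iff_of_orders
  · intro c d
    by_cases h1 : d ∈ W <;> by_cases h2 : d ∈ V <;> by_cases h3 : FirstLT W c d <;>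
      simp only [firstLT_append, List.mem_append, h1, h2, h3, not_true, not_false_iff, true_and,
        false_and, true_or, false_or, or_false, or_true, and_false, and_true]
  · intro c d
    simp only [lastLT_append, List.mem_append]
    tauto
  · intro c
    simp only [List.count_append]
    omega
  · intro c
    simp only [List.mem_append]
    tauto

theorem pat_xx {b : List β} {D : β → Prop} {W : List β} (hW : ∀ c ∈ b, c ∈ W → D c)
    (l r : List β) :
    Pat b D (l ++ (W ++ W) ++ r) ↔ Pat b D (l ++ (W ++ W ++ W) ++ r) := by
  have hF : ∀ c d, FirstLT (l ++ (W ++ W) ++ r) c d ↔ FirstLT (l ++ (W ++ W ++ W) ++ r) c d := by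
    intro c d
    simp only [firstLT_append, List.mem_append]
    tauto
  have hL : ∀ c d, LastLT (l ++ (W ++ W) ++ r) c d ↔ LastLT (l ++ (W ++ W ++ W) ++ r) c d := by
    intro c d
    simp only [lastLT_append, List.mem_append]
    tauto
  have hc : ∀ c ∈ b, ¬ D c →
      (l ++ (W ++ W) ++ r).count c = (l ++ (W ++ W ++ W) ++ r).count c := by
    intro c hc hD
    simp only [List.count_append,
      List.count_eq_zero_of_not_mem (fun h => hD (hW c hc h) : c ∉ W)]
  exact ⟨fun h => h.congr (fun c _ d _ _ _ => (hF c d).1) (fun c _ d _ _ _ => (hL c d).1)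
      (fun c hcb hD => (hc c hcb hD).symm) (fun c _ => by simp),
    fun h => h.congr (fun c _ d _ _ _ => (hF c d).2) (fun c _ d _ _ _ => (hL c d).2)
      hc (fun c _ => by simp)⟩

theorem pat_xxyy {b : List β} {D : β → Prop} {W V : List β} (hW : ∀ c ∈ b, c ∈ W → D c)
    (hV : ∀ c ∈ b, c ∈ V → D c) (l r : List β)
    (h : Pat b D (l ++ (W ++ W ++ V ++ V) ++ r)) : Pat b D (l ++ (V ++ V ++ W ++ W) ++ r) := by
  apply h.congr
  · intro c hc d hd hcd hD hF
    have hD' : ¬ ((c ∈ W ∨ c ∈ V) ∧ (d ∈ W ∨ d ∈ V)) := fun h' =>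
      hD ⟨h'.1.elim (hW c hc) (hV c hc), h'.2.elim (hW d hd) (hV d hd)⟩
    by_cases hm : c ∈ W ∨ c ∈ V
    · have h1 : d ∉ W := fun h => hD' ⟨hm, Or.inl h⟩
      have h2 : d ∉ V := fun h => hD' ⟨hm, Or.inr h⟩
      simp only [firstLT_append, List.mem_append, h1, h2, not_false_iff, true_and, or_false] at hF ⊢
      tauto
    · rw [not_or] at hm
      have h1 : ¬ FirstLT W c d := fun h => hm.1 h.mem
      have h2 : ¬ FirstLT V c d := fun h => hm.2 h.mem
      simp only [firstLT_append, List.mem_append, h1, h2, false_or, and_false] at hF ⊢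
      tauto
  · intro c hc d hd hcd hD hF
    have hD' : ¬ ((c ∈ W ∨ c ∈ V) ∧ (d ∈ W ∨ d ∈ V)) := fun h' =>
      hD ⟨h'.1.elim (hW c hc) (hV c hc), h'.2.elim (hW d hd) (hV d hd)⟩
    by_cases hm : d ∈ W ∨ d ∈ V
    · have h1 : c ∉ W := fun h => hD' ⟨Or.inl h, hm⟩
      have h2 : c ∉ V := fun h => hD' ⟨Or.inr h, hm⟩
      simp only [lastLT_append, List.mem_append, h1, h2, not_false_iff, true_and, or_false] at hF ⊢
      tauto
    · rw [not_or] at hm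
      have h1 : ¬ LastLT W c d := fun h => hm.1 h.mem
      have h2 : ¬ LastLT V c d := fun h => hm.2 h.mem
      simp only [lastLT_append, List.mem_append, h1, h2, false_or, and_false] at hF ⊢
      tauto
  · intro c _ _
    simp only [List.count_append]
    omega
  · intro c _
    simp only [List.mem_append]
    tauto

/-- A letter that surrounds a letter occurring once does not occur in a repeated block. -/
theorem not_mem_of_surrounds {u P W M Q : List β} {c e : β} (hu : u = P ++ W ++ M ++ W ++ Q)
    (hc : u.count c = 2) (he : u.count e = 1) (hF : FirstLT u c e) (hL : LastLT u e c)
    (hM : ∀ f ∈ M, 2 ≤ u.count f) : c ∉ W := by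
  intro hcW
  have h1 := List.count_pos_iff.2 hcW
  subst hu
  simp only [List.count_append] at hc he
  -- The two copies of `W` use up both occurrences of `c`. The linear letter `e`, squeezed between
  -- them and absent from the repeated `W`, must lie in `M`, where no letter is linear.
  have hcP : c ∉ P := fun h => by
    have := List.count_pos_iff.2 h
    omega
  have hcQ : c ∉ Q := fun h => by
    have := List.count_pos_iff.2 h
    omega
  have heP : e ∉ P := by
    simp only [List.append_assoc] at hF
    exact hF.not_mem_left hcP
  have heQ : e ∉ Q := hL.not_mem_right hcQ
  rw [List.count_eq_zero_of_not_mem heP, List.count_eq_zero_of_not_mem heQ] at he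
  have heM : e ∈ M := List.count_pos_iff.1 (by omega)
  have := hM e heM
  simp only [List.count_append, List.count_eq_zero_of_not_mem heP,
    List.count_eq_zero_of_not_mem heQ] at this
  omega

end PatternIdentities

/-! ### Guard words: letters, multiplicities and orders. -/

section GuardWords

open Letter

/-- The letters `y i` with `i ≠ 0`. -/
def IsY (c : Letter) : Prop := ∃ i, i ≠ 0 ∧ c = y i

/-- The shape of the words `a_{k,k}[π]`: the letters `z j` with `j ∈ J` have their first and
the letters `z i` with `i ∈ I` have their last occurrence between the two occurrences of the
outer letter, and the square of `y h` separates them. -/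
structure Guard where
  I : List ℕ
  J : List ℕ
  CF : List Letter
  CL : List Letter
  h : ℕ
  κ : ℕ
  ζ : ℕ
  h_ne : h ≠ 0
  nodup : (I ++ J).Nodup
  CF_count : ∀ j ∈ J, CF.count (z j) = 1
  CL_count : ∀ i ∈ I, CL.count (z i) = 1
  CF_mem : ∀ c ∈ CF, (∃ j ∈ J, c = z j) ∨ (∃ i, i ≠ 0 ∧ i ≠ h ∧ c = y i ∧ 2 ≤ CF.count c)
  CL_mem : ∀ c ∈ CL, (∃ i ∈ I, c = z i) ∨ (∃ i, i ≠ 0 ∧ i ≠ h ∧ c = y i ∧ 2 ≤ CL.count c)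
  κ_mem : κ ∈ J
  ζ_mem : ζ ∈ I
  CF_last : ∃ C, CF = C ++ [z κ]
  CL_head : ∃ C, CL = z ζ :: C

namespace Guard

/-- The guard read backwards. -/
def rev (G : Guard) : Guard where
  I := G.J.reverse
  J := G.I.reverse
  CF := G.CL.reverse
  CL := G.CF.reverse
  h := G.h
  κ := G.ζ
  ζ := G.κ
  h_ne := G.h_ne
  nodup := by
    have := List.nodup_reverse.2 G.nodup
    simpa using this
  CF_count := by simpa using G.CL_count
  CL_count := by simpa using G.CF_count
  CF_mem := by simpa using G.CL_mem
  CL_mem := by simpa using G.CF_mem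
  κ_mem := by simpa using G.ζ_mem
  ζ_mem := by simpa using G.κ_mem
  CF_last := by
    obtain ⟨C, hC⟩ := G.CL_head
    exact ⟨C.reverse, by simp [hC]⟩
  CL_head := by
    obtain ⟨C, hC⟩ := G.CF_last
    exact ⟨C.reverse, by simp [hC]⟩

/-- The block in front of the first outer letter. -/
def pre (G : Guard) : List Letter := wsub (fun i => [z i, t i]) G.I

/-- The block behind the last outer letter. -/
def suf (G : Guard) : List Letter := wsub (fun i => [t i, z i]) G.J

/-- The block between the outer letters. -/
def core (G : Guard) : List Letter := G.CF ++ [y G.h, y G.h] ++ G.CL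

/-- The word of the guard with outer letter `ξ`. -/
def word (G : Guard) (ξ : Letter) : List Letter := G.pre ++ [ξ] ++ G.core ++ [ξ] ++ G.suf

theorem rev_pre (G : Guard) : G.rev.pre = G.suf.reverse := by
  simp [pre, suf, rev, wsub_reverse]

theorem rev_suf (G : Guard) : G.rev.suf = G.pre.reverse := by
  simp [pre, suf, rev, wsub_reverse]

theorem rev_core (G : Guard) : G.rev.core = G.core.reverse := by
  simp [core, rev]

theorem rev_word (G : Guard) (ξ : Letter) : G.rev.word ξ = (G.word ξ).reverse := by
  simp [word, rev_pre, rev_suf, rev_core]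

/-- The letters that may be used as outer letters. -/
def Outer (ξ : Letter) : Prop := ξ = x ∨ ξ = y 0

theorem Outer.not_isY {ξ : Letter} (h : Outer ξ) : ¬ IsY ξ := by
  rintro ⟨i, hi, h'⟩
  rcases h with rfl | rfl
  · cases h'
  · cases h'
    exact hi rfl

theorem Outer.ne_z {ξ : Letter} (h : Outer ξ) (i : ℕ) : ξ ≠ z i := by
  rcases h with rfl | rfl <;> simp

theorem Outer.ne_t {ξ : Letter} (h : Outer ξ) (i : ℕ) : ξ ≠ t i := by
  rcases h with rfl | rfl <;> simp

theorem Outer.ne_y {ξ : Letter} (h : Outer ξ) {i : ℕ} (hi : i ≠ 0) : ξ ≠ y i := by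
  rcases h with rfl | rfl
  · simp
  · simpa using hi.symm

theorem not_isY_z (i : ℕ) : ¬ IsY (z i) := by rintro ⟨j, _, h⟩; cases h

theorem not_isY_t (i : ℕ) : ¬ IsY (t i) := by rintro ⟨j, _, h⟩; cases h

theorem isY_y {i : ℕ} (hi : i ≠ 0) : IsY (y i) := ⟨i, hi, rfl⟩

variable (G : Guard)

theorem disjoint {i j : ℕ} (hi : i ∈ G.I) (hj : j ∈ G.J) : i ≠ j :=
  fun h => (List.nodup_append.1 G.nodup).2.2 i hi j hj h

theorem nodup_J : G.J.Nodup := (List.nodup_append.1 G.nodup).2.1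

theorem mem_pre {c : Letter} : c ∈ G.pre ↔ ∃ i ∈ G.I, c = z i ∨ c = t i := by
  simp [pre, mem_wsub]

theorem mem_suf {c : Letter} : c ∈ G.suf ↔ ∃ i ∈ G.J, c = t i ∨ c = z i := by
  simp [suf, mem_wsub]

theorem mem_core {c : Letter} (h : c ∈ G.core) :
    (∃ j, (j ∈ G.I ∨ j ∈ G.J) ∧ c = z j) ∨ IsY c := by
  simp only [core, List.mem_append, List.mem_cons, List.not_mem_nil, or_false] at h
  rcases h with (h | h) | h
  · rcases G.CF_mem c h with ⟨j, hj, rfl⟩ | ⟨i, hi, _, rfl, _⟩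
    · exact Or.inl ⟨j, Or.inr hj, rfl⟩
    · exact Or.inr (isY_y hi)
  · rcases h with rfl | rfl <;> exact Or.inr (isY_y G.h_ne)
  · rcases G.CL_mem c h with ⟨j, hj, rfl⟩ | ⟨i, hi, _, rfl, _⟩
    · exact Or.inl ⟨j, Or.inl hj, rfl⟩
    · exact Or.inr (isY_y hi)

theorem z_mem_CF {j : ℕ} : z j ∈ G.CF ↔ j ∈ G.J := by
  constructor
  · intro h
    rcases G.CF_mem _ h with ⟨i, hi, h'⟩ | ⟨i, _, _, h', _⟩
    · cases h'
      exact hi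
    · cases h'
  · intro h
    exact List.count_pos_iff.1 (by rw [G.CF_count j h]; omega)

theorem z_mem_CL {j : ℕ} : z j ∈ G.CL ↔ j ∈ G.I := by
  simpa [rev] using G.rev.z_mem_CF (j := j)

theorem t_not_mem_CF (j : ℕ) : t j ∉ G.CF := by
  intro h
  rcases G.CF_mem _ h with ⟨i, hi, h'⟩ | ⟨i, _, _, h', _⟩ <;> cases h'

theorem t_not_mem_CL (j : ℕ) : t j ∉ G.CL := by
  simpa [rev] using G.rev.t_not_mem_CF j

theorem yh_not_mem_CF : y G.h ∉ G.CF := by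
  intro h
  rcases G.CF_mem _ h with ⟨i, hi, h'⟩ | ⟨i, _, h2, h', _⟩
  · cases h'
  · cases h'
    exact h2 rfl

theorem yh_not_mem_CL : y G.h ∉ G.CL := by
  simpa [rev] using G.rev.yh_not_mem_CF

theorem outer_not_mem_CF {ξ : Letter} (hξ : Outer ξ) : ξ ∉ G.CF := by
  intro h
  rcases G.CF_mem _ h with ⟨i, hi, h'⟩ | ⟨i, h1, h2, h', _⟩
  · exact hξ.ne_z _ h'
  · exact hξ.ne_y h1 h'

theorem outer_not_mem_CL {ξ : Letter} (hξ : Outer ξ) : ξ ∉ G.CL := by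
  simpa [rev] using G.rev.outer_not_mem_CF hξ

theorem outer_not_mem_core {ξ : Letter} (hξ : Outer ξ) : ξ ∉ G.core := by
  simp [core, outer_not_mem_CF G hξ, outer_not_mem_CL G hξ, hξ.ne_y G.h_ne]

theorem outer_not_mem_pre {ξ : Letter} (hξ : Outer ξ) : ξ ∉ G.pre := by
  rw [mem_pre]
  rintro ⟨i, _, h | h⟩
  · exact hξ.ne_z _ h
  · exact hξ.ne_t _ h

theorem outer_not_mem_suf {ξ : Letter} (hξ : Outer ξ) : ξ ∉ G.suf := by
  rw [mem_suf]
  rintro ⟨i, _, h | h⟩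
  · exact hξ.ne_t _ h
  · exact hξ.ne_z _ h

theorem z_mem_pre {j : ℕ} : z j ∈ G.pre ↔ j ∈ G.I := by simp [mem_pre]

theorem t_mem_pre {j : ℕ} : t j ∈ G.pre ↔ j ∈ G.I := by simp [mem_pre]

theorem z_mem_suf {j : ℕ} : z j ∈ G.suf ↔ j ∈ G.J := by simp [mem_suf]

theorem t_mem_suf {j : ℕ} : t j ∈ G.suf ↔ j ∈ G.J := by simp [mem_suf]

theorem y_not_mem_pre (i : ℕ) : y i ∉ G.pre := by simp [mem_pre]

theorem y_not_mem_suf (i : ℕ) : y i ∉ G.suf := by simp [mem_suf]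

theorem mem_word {ξ c : Letter} :
    c ∈ G.word ξ ↔ c = ξ ∨ c ∈ G.pre ∨ c ∈ G.core ∨ c ∈ G.suf := by
  simp only [word, List.mem_append, List.mem_singleton]
  tauto

theorem mem_word_cases {ξ c : Letter} (h : c ∈ G.word ξ) :
    c = ξ ∨ (∃ j, (j ∈ G.I ∨ j ∈ G.J) ∧ (c = z j ∨ c = t j)) ∨ IsY c := by
  rw [mem_word, mem_pre, mem_suf] at h
  rcases h with h | ⟨i, hi, h⟩ | h | ⟨i, hi, h⟩
  · exact Or.inl h
  · exact Or.inr (Or.inl ⟨i, Or.inl hi, h⟩)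
  · rcases G.mem_core h with ⟨j, hj, h⟩ | h
    · exact Or.inr (Or.inl ⟨j, hj, Or.inl h⟩)
    · exact Or.inr (Or.inr h)
  · exact Or.inr (Or.inl ⟨i, Or.inr hi, h.symm⟩)

theorem z_mem_word {ξ : Letter} {j : ℕ} (hj : j ∈ G.I ∨ j ∈ G.J) : z j ∈ G.word ξ := by
  rw [mem_word, z_mem_pre, z_mem_suf]
  tauto

theorem t_mem_word {ξ : Letter} {j : ℕ} (hj : j ∈ G.I ∨ j ∈ G.J) : t j ∈ G.word ξ := by
  rw [mem_word, t_mem_pre, t_mem_suf]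
  tauto

theorem outer_mem_word (ξ : Letter) : ξ ∈ G.word ξ := by
  rw [mem_word]
  exact Or.inl rfl

theorem yh_mem_word (ξ : Letter) : y G.h ∈ G.word ξ := by
  rw [mem_word]
  simp [core]

theorem count_pre (j : ℕ) : G.pre.count (z j) = G.I.count j ∧ G.pre.count (t j) = G.I.count j := by
  constructor
  · rw [pre, count_wsub (c := j) (n := 1) (by simp) (by simp; tauto), one_mul]
  · rw [pre, count_wsub (c := j) (n := 1) (by simp) (by simp; tauto), one_mul]

theorem count_suf (j : ℕ) : G.suf.count (z j) = G.J.count j ∧ G.suf.count (t j) = G.J.count j := by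
  constructor
  · rw [suf, count_wsub (c := j) (n := 1) (by simp) (by simp; tauto), one_mul]
  · rw [suf, count_wsub (c := j) (n := 1) (by simp) (by simp; tauto), one_mul]

theorem count_t_core (j : ℕ) : G.core.count (t j) = 0 := by
  simp [core, List.count_eq_zero_of_not_mem (G.t_not_mem_CF j),
    List.count_eq_zero_of_not_mem (G.t_not_mem_CL j)]

theorem count_z_core {j : ℕ} (hj : j ∈ G.I ∨ j ∈ G.J) : G.core.count (z j) = 1 := by
  rcases hj with hj | hj
  · have : z j ∉ G.CF := fun h => G.disjoint hj (G.z_mem_CF.1 h) rfl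
    simp [core, List.count_eq_zero_of_not_mem this, G.CL_count j hj]
  · have : z j ∉ G.CL := fun h => G.disjoint (G.z_mem_CL.1 h) hj rfl
    simp [core, List.count_eq_zero_of_not_mem this, G.CF_count j hj]

theorem count_IJ {j : ℕ} (hj : j ∈ G.I ∨ j ∈ G.J) : G.I.count j + G.J.count j = 1 := by
  rw [← List.count_append]
  exact List.count_eq_one_of_mem G.nodup (by simpa using hj)

theorem count_z_word {ξ : Letter} (hξ : Outer ξ) {j : ℕ} (hj : j ∈ G.I ∨ j ∈ G.J) :
    (G.word ξ).count (z j) = 2 := by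
  have := G.count_IJ hj
  simp only [word, List.count_append, (G.count_pre j).1, (G.count_suf j).1, G.count_z_core hj,
    List.count_singleton, beq_iff_eq, hξ.ne_z, if_false]
  omega

theorem count_t_word {ξ : Letter} (hξ : Outer ξ) {j : ℕ} (hj : j ∈ G.I ∨ j ∈ G.J) :
    (G.word ξ).count (t j) = 1 := by
  have := G.count_IJ hj
  simp only [word, List.count_append, (G.count_pre j).2, (G.count_suf j).2, G.count_t_core,
    List.count_singleton, beq_iff_eq, hξ.ne_t, if_false]
  omega

theorem count_outer_word {ξ : Letter} (hξ : Outer ξ) : (G.word ξ).count ξ = 2 := by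
  simp only [word, List.count_append, List.count_singleton_self,
    List.count_eq_zero_of_not_mem (G.outer_not_mem_pre hξ),
    List.count_eq_zero_of_not_mem (G.outer_not_mem_suf hξ),
    List.count_eq_zero_of_not_mem (G.outer_not_mem_core hξ)]

section Orders

variable {ξ : Letter} (hξ : Outer ξ)
include hξ

theorem first_outer_z {j : ℕ} (hj : j ∈ G.J) : FirstLT (G.word ξ) ξ (z j) := by
  have h1 : z j ∉ G.pre ++ [ξ] := by
    simp only [List.mem_append, z_mem_pre, List.mem_singleton, not_or]
    exact ⟨fun h => G.disjoint h hj rfl, (hξ.ne_z j).symm⟩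
  have := firstLT_split (p := G.pre ++ [ξ]) (q := G.core ++ [ξ] ++ G.suf) (c := ξ) (by simp) h1
  simpa [word] using this

theorem first_z_yh {j : ℕ} (hj : j ∈ G.J) : FirstLT (G.word ξ) (z j) (y G.h) := by
  have := firstLT_split (p := G.pre ++ [ξ] ++ G.CF)
    (q := [y G.h, y G.h] ++ G.CL ++ [ξ] ++ G.suf) (c := z j) (d := y G.h)
    (by simp [z_mem_CF, hj]) (by
      simp only [List.mem_append, y_not_mem_pre, List.mem_singleton, yh_not_mem_CF, or_false,
        false_or]
      exact (hξ.ne_y G.h_ne).symm)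
  simpa [word, core] using this

theorem last_outer_z {j : ℕ} (hj : j ∈ G.J) : LastLT (G.word ξ) ξ (z j) :=
  lastLT_split (G.outer_not_mem_suf hξ) (G.z_mem_suf.2 hj)

theorem last_y_outer {c : Letter} (hc : IsY c) : LastLT (G.word ξ) c ξ := by
  obtain ⟨i, hi, rfl⟩ := hc
  have := lastLT_split (p := G.pre ++ [ξ] ++ G.core) (q := [ξ] ++ G.suf) (c := y i) (d := ξ)
    (by simp [y_not_mem_suf, (hξ.ne_y hi).symm]) (by simp)
  simpa [word] using this

omit hξ in
theorem last_y_t {c : Letter} (hc : IsY c) {j : ℕ} (hj : j ∈ G.J) :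
    LastLT (G.word ξ) c (t j) := by
  obtain ⟨i, hi, rfl⟩ := hc
  exact lastLT_split (G.y_not_mem_suf i) (G.t_mem_suf.2 hj)

theorem first_z_t {j : ℕ} (hj : j ∈ G.J) : FirstLT (G.word ξ) (z j) (t j) := by
  have := firstLT_split (p := G.pre ++ [ξ] ++ G.core) (q := [ξ] ++ G.suf) (c := z j) (d := t j)
    (by simp [core, z_mem_CF, hj])
    (by
      have h1 : j ∉ G.I := fun h => G.disjoint h hj rfl
      simp [t_mem_pre, core, t_not_mem_CF, t_not_mem_CL, h1, (hξ.ne_t j).symm])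
  simpa [word] using this

omit hξ in
theorem last_t_z {j : ℕ} (hj : j ∈ G.J) : LastLT (G.word ξ) (t j) (z j) := by
  obtain ⟨J1, J2, hJ⟩ := List.append_of_mem hj
  have hn := G.nodup_J
  rw [hJ, List.nodup_append, List.nodup_cons] at hn
  have h1 : t j ∉ z j :: wsub (fun i => [t i, z i]) J2 := by
    simp only [List.mem_cons, mem_wsub, List.not_mem_nil, not_or, not_exists]
    refine ⟨by simp, ?_⟩
    rintro i ⟨hi, h | h | h⟩
    · cases h
      exact hn.2.1.1 hi
    · cases h
    · exact h
  have := lastLT_split (p := G.pre ++ [ξ] ++ G.core ++ [ξ] ++ wsub (fun i => [t i, z i]) J1 ++ [t j])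
    h1 (List.mem_cons_self (a := z j))
  simpa [word, suf, hJ] using this

-- The last occurrences of the `z j` with `j ∈ J` lie in the suffix, each directly preceded by its
-- own linear `t j`. These are the separators in the pigeonhole argument.
omit hξ in
theorem last_separated {i j : ℕ} {J1 J2 : List ℕ} (hJ : G.J = J1 ++ i :: J2) (hj : j ∈ J2) :
    LastLT (G.word ξ) (z i) (t j) := by
  have hn := G.nodup_J
  rw [hJ, List.nodup_append, List.nodup_cons] at hn
  have h1 : z i ∉ wsub (fun i => [t i, z i]) J2 := by
    simp only [mem_wsub, not_exists]
    rintro m ⟨hm, h⟩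
    simp only [List.mem_cons, List.not_mem_nil, or_false] at h
    rcases h with h | h
    · cases h
    · cases h
      exact hn.2.1.1 hm
  have h2 : t j ∈ wsub (fun i => [t i, z i]) J2 := mem_wsub.2 ⟨j, hj, by simp⟩
  have := lastLT_split (p := G.pre ++ [ξ] ++ G.core ++ [ξ] ++
    wsub (fun i => [t i, z i]) J1 ++ [t i, z i]) h1 h2
  simpa [word, suf, hJ] using this

omit hξ in
theorem last_head_t_z {j0 j : ℕ} {J' : List ℕ} (hJ : G.J = j0 :: J') (hj : j ∈ G.J) :
    LastLT (G.word ξ) (t j0) (z j) := by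
  rw [hJ, List.mem_cons] at hj
  rcases hj with rfl | hj
  · exact G.last_t_z (by simp [hJ])
  · have hn := G.nodup_J
    rw [hJ, List.nodup_cons] at hn
    have h1 : t j0 ∉ z j0 :: wsub (fun i => [t i, z i]) J' := by
      simp only [List.mem_cons, mem_wsub, List.not_mem_nil, not_or, not_exists]
      refine ⟨by simp, ?_⟩
      rintro i ⟨hi, h | h | h⟩
      · cases h
        exact hn.1 hi
      · cases h
      · exact h
    have h2 : z j ∈ z j0 :: wsub (fun i => [t i, z i]) J' :=
      List.mem_cons_of_mem _ (mem_wsub.2 ⟨j, hj, by simp⟩)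
    have := lastLT_split (p := G.pre ++ [ξ] ++ G.core ++ [ξ] ++ [t j0]) h1 h2
    simpa [word, suf, hJ] using this

-- Reversal exchanges `I` with `J` and first with last occurrences, so orders are verified directly
-- for one side only.
omit hξ in
theorem rev_orders {c d : Letter} :
    (FirstLT (G.rev.word ξ) c d ↔ LastLT (G.word ξ) d c) ∧
      (LastLT (G.rev.word ξ) c d ↔ FirstLT (G.word ξ) d c) := by
  rw [rev_word]
  exact ⟨firstLT_reverse _ _ _, lastLT_reverse _ _ _⟩

/-- The linear letter `t j` stands between the two occurrences of `z j`; this is what keeps every `z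
j` out of repeated blocks. -/
theorem surround {j : ℕ} (hj : j ∈ G.I ∨ j ∈ G.J) :
    FirstLT (G.word ξ) (z j) (t j) ∧ LastLT (G.word ξ) (t j) (z j) := by
  rcases hj with hj | hj
  · have hj' : j ∈ G.rev.J := by simpa [rev] using hj
    exact ⟨G.rev_orders.2.1 (G.rev.last_t_z hj'), G.rev_orders.1.1 (G.rev.first_z_t hξ hj')⟩
  · exact ⟨G.first_z_t hξ hj, G.last_t_z hj⟩

end Orders

end Guard

end GuardWords

/-! ### Renaming, powers, and the value of a word with a given pattern. -/

section PatternMaps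

variable {α β : Type} [DecidableEq α] [DecidableEq β]

/-- A pattern sees only the letters of `b`, so the other letters may be deleted and those of `b`
renamed injectively. -/
theorem pat_map {b : List α} {D : α → Prop} {D' : β → Prop} {f : α → β}
    (hf : ∀ c ∈ b, ∀ d ∈ b, f c = f d → c = d) (hD : ∀ c ∈ b, D' (f c) ↔ D c) (u : List α) :
    Pat (b.map f) D' (wsub (fun c => if c ∈ b then [f c] else []) u) ↔ Pat b D u := by
  set ρ : α → List β := fun c => if c ∈ b then [f c] else [] with hρ
  have hmem : ∀ c ∈ b, ∀ e, f c ∈ ρ e ↔ e = c := by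
    intro c hc e
    simp only [hρ]
    split_ifs with he
    · rw [List.mem_singleton]
      exact ⟨fun h => hf e he c hc h.symm, fun h => by rw [h]⟩
    · simp only [List.not_mem_nil, false_iff]
      rintro rfl
      exact he hc
  have hb : b.map f = wsub ρ b := by
    have : wsub ρ b = wsub (fun c => [f c]) b := wsub_congr fun c hc => by simp [hρ, hc]
    rw [this]
    simp [wsub, List.map_eq_flatMap]
  have hcount : ∀ c ∈ b, ∀ w, (wsub ρ w).count (f c) = w.count c := by
    intro c hc w
    rw [count_wsub (c := c) (n := 1) (by simp [hρ, hc]) (fun e he h => he ((hmem c hc e).1 h)),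
      one_mul]
  have hmem' : ∀ c ∈ b, ∀ w, f c ∈ wsub ρ w ↔ c ∈ w := by
    intro c hc w
    rw [← List.count_pos_iff, hcount c hc, List.count_pos_iff]
  rw [hb]
  constructor
  · intro h
    refine ⟨?_, ?_, ?_, ?_⟩
    · intro c hc d hd hcd hDD hF
      have := h.first (f c) ((hmem' c hc b).2 hc) (f d) ((hmem' d hd b).2 hd)
        (fun h => hcd (hf c hc d hd h)) (by rwa [hD c hc, hD d hd])
      rw [firstLT_wsub hcd (hmem c hc) (hmem d hd), firstLT_wsub hcd (hmem c hc) (hmem d hd)] at this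
      exact this hF
    · intro c hc d hd hcd hDD hF
      have := h.last (f c) ((hmem' c hc b).2 hc) (f d) ((hmem' d hd b).2 hd)
        (fun h => hcd (hf c hc d hd h)) (by rwa [hD c hc, hD d hd])
      rw [lastLT_wsub hcd (hmem c hc) (hmem d hd), lastLT_wsub hcd (hmem c hc) (hmem d hd)] at this
      exact this hF
    · intro c hc hDc
      have := h.cnt (f c) ((hmem' c hc b).2 hc) (by rwa [hD c hc])
      rwa [hcount c hc, hcount c hc] at this
    · intro c hc
      exact (hmem' c hc u).1 (h.mem (f c) ((hmem' c hc b).2 hc))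
  · intro h
    have hex : ∀ c' ∈ wsub ρ b, ∃ c ∈ b, c' = f c := by
      intro c' hc'
      rw [← hb, List.mem_map] at hc'
      obtain ⟨c, hc, h⟩ := hc'
      exact ⟨c, hc, h.symm⟩
    refine ⟨?_, ?_, ?_, ?_⟩
    · intro c' hc' d' hd' hcd hDD hF
      obtain ⟨c, hc, rfl⟩ := hex c' hc'
      obtain ⟨d, hd, rfl⟩ := hex d' hd'
      have hne : c ≠ d := fun h => hcd (by rw [h])
      rw [firstLT_wsub hne (hmem c hc) (hmem d hd)] at hF ⊢
      exact h.first c hc d hd hne (by rwa [hD c hc, hD d hd] at hDD) hF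
    · intro c' hc' d' hd' hcd hDD hF
      obtain ⟨c, hc, rfl⟩ := hex c' hc'
      obtain ⟨d, hd, rfl⟩ := hex d' hd'
      have hne : c ≠ d := fun h => hcd (by rw [h])
      rw [lastLT_wsub hne (hmem c hc) (hmem d hd)] at hF ⊢
      exact h.last c hc d hd hne (by rwa [hD c hc, hD d hd] at hDD) hF
    · intro c' hc' hDc
      obtain ⟨c, hc, rfl⟩ := hex c' hc'
      rw [hcount c hc, hcount c hc]
      exact h.cnt c hc (by rwa [hD c hc] at hDc)
    · intro c' hc'
      obtain ⟨c, hc, rfl⟩ := hex c' hc'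
      exact (hmem' c hc u).2 (h.mem c hc)

/-- The substitution that replaces `c` by its power with exponent `m c`. -/
def expand (m : α → ℕ) : α → List α := fun c => List.replicate (m c) c

omit [DecidableEq α] in
theorem mem_expand {m : α → ℕ} (hm : ∀ c, m c ≠ 0) (c e : α) : c ∈ expand m e ↔ e = c := by
  simp only [expand, List.mem_replicate]
  exact ⟨fun h => h.2.symm, fun h => ⟨hm e, h.symm⟩⟩

omit [DecidableEq α] in
theorem firstLT_expand {m : α → ℕ} (hm : ∀ c, m c ≠ 0) {c d : α} (hcd : c ≠ d) (u : List α) :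
    FirstLT (wsub (expand m) u) c d ↔ FirstLT u c d :=
  firstLT_wsub hcd (mem_expand hm c) (mem_expand hm d) u

omit [DecidableEq α] in
theorem lastLT_expand {m : α → ℕ} (hm : ∀ c, m c ≠ 0) {c d : α} (hcd : c ≠ d) (u : List α) :
    LastLT (wsub (expand m) u) c d ↔ LastLT u c d :=
  lastLT_wsub hcd (mem_expand hm c) (mem_expand hm d) u

theorem count_expand {m : α → ℕ} (hm : ∀ c, m c ≠ 0) (c : α) (u : List α) :
    (wsub (expand m) u).count c = m c * u.count c :=
  count_wsub (by simp [expand]) (fun e he h => he ((mem_expand hm c e).1 h)) u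

theorem mem_wsub_expand {m : α → ℕ} (hm : ∀ c, m c ≠ 0) (c : α) (u : List α) :
    c ∈ wsub (expand m) u ↔ c ∈ u := by
  rw [← List.count_pos_iff, count_expand hm, ← List.count_pos_iff]
  exact ⟨fun h => Nat.pos_of_mul_pos_left h, fun h => Nat.mul_pos (Nat.pos_of_ne_zero (hm c)) h⟩

theorem pat_expand {b : List α} {D : α → Prop} {m : α → ℕ} (hm : ∀ c, m c ≠ 0)
    (hD : ∀ c, ¬ D c → m c = 1) (u : List α) : Pat b D (wsub (expand m) u) ↔ Pat b D u := by
  constructor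
  · intro h
    exact h.congr (fun c _ d _ hcd _ => (firstLT_expand hm hcd u).1)
      (fun c _ d _ hcd _ => (lastLT_expand hm hcd u).1)
      (fun c _ hDc => by rw [count_expand hm, hD c hDc, one_mul])
      (fun c _ => (mem_wsub_expand hm c u).1)
  · intro h
    exact h.congr (fun c _ d _ hcd _ => (firstLT_expand hm hcd u).2)
      (fun c _ d _ hcd _ => (lastLT_expand hm hcd u).2)
      (fun c _ hDc => by rw [count_expand hm, hD c hDc, one_mul])
      (fun c _ => (mem_wsub_expand hm c u).2)

variable {Q : Type} [Monoid Q]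

omit [DecidableEq α] in
theorem prod_map_expand {m : α → ℕ} {f : α → Q} (hf : ∀ c, f c ^ m c = f c) (u : List α) :
    ((wsub (expand m) u).map f).prod = (u.map f).prod := by
  induction u with
  | nil => rfl
  | cons c u ih =>
    rw [wsub_cons, List.map_append, List.prod_append, ih, List.map_cons, List.prod_cons]
    simp [expand, hf]

/-- Words with the same pattern and the same content have the same value in every monoid
satisfying `xzxyty ≈ xzyxty` in which the letters of `D` go to commuting idempotents. -/
theorem Pat.prod_eq {D : α → Prop} {f : α → Q} {a u : List α} (h : Pat a D u)
    (hcomm : ∀ c d, D c → D d → f c * f d = f d * f c) (hidem : ∀ c, D c → f c * f c = f c)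
    (hsw : ∀ X Y Z T : Q, X * Z * X * Y * T * Y = X * Z * Y * X * T * Y)
    (hu : ∀ c ∈ u, c ∈ a) (h2 : ∀ c, ¬ D c → a.count c ≤ 2)
    (hlin : ∀ c d, ¬ D c → D d → a.count c = 1 → d ∈ a → FirstLT a c d ∨ LastLT a d c) :
    (u.map f).prod = (a.map f).prod := by
  classical
  -- The exponents are taken crosswise: after both expansions a letter of `D` in `a` occurs `a.count
  -- c * u.count c` times in either word. Idempotency leaves the values unchanged, and the sorting
  -- theorem, which needs equal multiplicities, applies.
  let m1 : α → ℕ := fun c => if D c ∧ c ∈ a then a.count c else 1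
  let m2 : α → ℕ := fun c => if D c ∧ c ∈ a then u.count c else 1
  have hm1 : ∀ c, m1 c ≠ 0 := by
    intro c
    simp only [m1]
    split_ifs with hc
    · exact (List.count_pos_iff.2 hc.2).ne'
    · exact one_ne_zero
  have hm2 : ∀ c, m2 c ≠ 0 := by
    intro c
    simp only [m2]
    split_ifs with hc
    · exact (List.count_pos_iff.2 (h.mem c hc.2)).ne'
    · exact one_ne_zero
  have hpow : ∀ c, D c → ∀ n, n ≠ 0 → f c ^ n = f c := by
    intro c hc n hn
    induction n with
    | zero => exact absurd rfl hn
    | succ n ih =>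
      rcases Nat.eq_zero_or_pos n with rfl | hn'
      · simp
      · rw [pow_succ, ih hn'.ne', hidem c hc]
  have hp1 : ∀ c, f c ^ m1 c = f c := by
    intro c
    by_cases hc : D c
    · exact hpow c hc _ (hm1 c)
    · simp [m1, hc]
  have hp2 : ∀ c, f c ^ m2 c = f c := by
    intro c
    by_cases hc : D c
    · exact hpow c hc _ (hm2 c)
    · simp [m2, hc]
  rw [← prod_map_expand hp1 u, ← prod_map_expand hp2 a]
  have hso : SameOrder D (wsub (expand m1) u) (wsub (expand m2) a) := by
    refine ⟨?_, ?_, ?_, ?_, ?_⟩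
    · intro c
      rw [count_expand hm2, count_expand hm1]
      by_cases hca : c ∈ a
      · by_cases hDc : D c
        · simp only [m1, m2, hca, hDc, and_self, if_true]
          ring
        · simp only [m1, m2, hDc, false_and, if_false]
          rw [h.cnt c hca hDc]
      · rw [List.count_eq_zero_of_not_mem hca,
          List.count_eq_zero_of_not_mem (fun h => hca (hu c h)), mul_zero, mul_zero]
    · intro c d hcd hD hF
      rw [firstLT_expand hm1 hcd] at hF
      rw [firstLT_expand hm2 hcd]
      have hca := hu c hF.mem
      by_cases hda : d ∈ a
      -- The pattern transports orders from `a` to `u`; the direction needed here follows from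
      -- totality in `a` and asymmetry in `u`.
      · rcases FirstLT.total (d := d) hca with h' | h'
        · exact h'
        · exact absurd hF ((h.first d hda c hca hcd.symm (fun h => hD h.symm) h').asymm hcd.symm)
      · exact firstLT_of_mem hca hda
    · intro c d hcd hD hF
      rw [lastLT_expand hm1 hcd] at hF
      rw [lastLT_expand hm2 hcd]
      have hda := hu d hF.mem
      by_cases hca : c ∈ a
      · rcases LastLT.total (d := d) hca with h' | h'
        · exact h'
        · exact absurd hF ((h.last d hda c hca hcd.symm (fun h => hD h.symm) h').asymm hcd.symm)
      · exact lastLT_of_mem hca hda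
    · intro c hDc
      rw [count_expand hm1]
      simp only [m1, hDc, false_and, if_false, one_mul]
      by_cases hca : c ∈ a
      · rw [h.cnt c hca hDc]
        exact h2 c hDc
      · rw [List.count_eq_zero_of_not_mem (fun h => hca (hu c h))]
        omega
    · intro c d hDc hDd hc hd
      have hcd : c ≠ d := by
        rintro rfl
        exact hDc hDd
      rw [count_expand hm1] at hc
      simp only [m1, hDc, false_and, if_false, one_mul] at hc
      rw [mem_wsub_expand hm1] at hd
      have hca : c ∈ a := hu c (List.count_pos_iff.1 (by omega))
      have hda := hu d hd
      rw [firstLT_expand hm1 hcd, lastLT_expand hm1 hcd.symm]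
      rw [h.cnt c hca hDc] at hc
      rcases hlin c d hDc hDd hc hda with h' | h'
      · exact Or.inl (h.first c hca d hda hcd (fun h => hDc h.1) h')
      · exact Or.inr (h.last d hda c hca hcd.symm (fun h => hDc h.2) h')
  exact hso.prod_eq hcomm hsw _ [] _

end PatternMaps

/-! ### The class of a guard word modulo `α₁°`. -/

section AperiodicCongruence

open Letter FreeMonoid

namespace Guard

variable (G : Guard) {ξ : Letter}

theorem first_t_y {c : Letter} (hc : IsY c) {j : ℕ} (hj : j ∈ G.I) :
    FirstLT (G.word ξ) (t j) c :=
  G.rev_orders.2.1 (G.rev.last_y_t hc (by simpa [rev] using hj))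

theorem count_word_le_two (hξ : Outer ξ) {c : Letter} (hc : ¬ IsY c) :
    (G.word ξ).count c ≤ 2 := by
  by_cases hm : c ∈ G.word ξ
  · rcases G.mem_word_cases hm with rfl | ⟨j, hj, rfl | rfl⟩ | h
    · exact (G.count_outer_word hξ).le
    · exact (G.count_z_word hξ hj).le
    · rw [G.count_t_word hξ hj]
      omega
    · exact absurd h hc
  · rw [List.count_eq_zero_of_not_mem hm]
    omega

/-- The linear letters outside the `y i` are the `t j`. They stand in the prefix or the suffix,
whereas all `y i` with `i ≠ 0` stand in the core. -/
theorem word_lin (hξ : Outer ξ) (c d : Letter) (hc : ¬ IsY c) (hd : IsY d)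
    (h1 : (G.word ξ).count c = 1) (_ : d ∈ G.word ξ) :
    FirstLT (G.word ξ) c d ∨ LastLT (G.word ξ) d c := by
  have hm : c ∈ G.word ξ := List.count_pos_iff.1 (by omega)
  rcases G.mem_word_cases hm with rfl | ⟨j, hj, rfl | rfl⟩ | h
  · rw [G.count_outer_word hξ] at h1
    omega
  · rw [G.count_z_word hξ hj] at h1
    omega
  · rcases hj with hj | hj
    · exact Or.inl (G.first_t_y hd hj)
    · exact Or.inr (G.last_y_t hd hj)
  · exact absurd h hc

section

variable {u : List Letter} (h : Pat (G.word ξ) IsY u) (hξ : Outer ξ)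
include h hξ

theorem pat_count_z {j : ℕ} (hj : j ∈ G.I ∨ j ∈ G.J) : u.count (z j) = 2 := by
  rw [h.cnt _ (G.z_mem_word hj) (not_isY_z j), G.count_z_word hξ hj]

theorem pat_count_t {j : ℕ} (hj : j ∈ G.I ∨ j ∈ G.J) : u.count (t j) = 1 := by
  rw [h.cnt _ (G.t_mem_word hj) (not_isY_t j), G.count_t_word hξ hj]

theorem pat_count_outer : u.count ξ = 2 := by
  rw [h.cnt _ (G.outer_mem_word ξ) hξ.not_isY, G.count_outer_word hξ]

/-- Twofold letters that surround a linear letter do not occur in a block that is repeated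
with only repeated letters in between. -/
theorem z_not_mem_block {P W M Q : List Letter} (hu : u = P ++ W ++ M ++ W ++ Q)
    (hM : ∀ f ∈ M, 2 ≤ u.count f) {j : ℕ} (hj : j ∈ G.I ∨ j ∈ G.J) : z j ∉ W := by
  have hs := G.surround hξ hj
  exact not_mem_of_surrounds hu (G.pat_count_z h hξ hj) (G.pat_count_t h hξ hj)
    (h.first _ (G.z_mem_word hj) _ (G.t_mem_word hj) (by simp) (fun h => not_isY_z j h.1) hs.1)
    (h.last _ (G.t_mem_word hj) _ (G.z_mem_word hj) (by simp) (fun h => not_isY_z j h.2) hs.2) hM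

theorem t_not_mem_block {P W M Q : List Letter} (hu : u = P ++ W ++ M ++ W ++ Q)
    {j : ℕ} (hj : j ∈ G.I ∨ j ∈ G.J) : t j ∉ W := by
  intro hm
  have h1 := G.pat_count_t h hξ hj
  have h2 := List.count_pos_iff.2 hm
  rw [hu] at h1
  simp only [List.count_append] at h1
  omega

/-- A square contains no `t j` by linearity and no `z j` because `z j` surrounds `t j`. If it
contained the outer letter, then `y h`, which first occurs after `z κ` and last occurs before the
outer letter, would be missing from `P`, `W` and `Q` alike. -/
theorem isY_of_mem_square {P W Q : List Letter} (hu : u = P ++ (W ++ W) ++ Q) :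
    ∀ c ∈ G.word ξ, c ∈ W → IsY c := by
  have hu' : u = P ++ W ++ [] ++ W ++ Q := by simp [hu]
  intro c hc hcW
  rcases G.mem_word_cases hc with rfl | ⟨j, hj, rfl | rfl⟩ | h'
  · exfalso
    have hzW := G.z_not_mem_block h hξ hu' (by simp) (Or.inr G.κ_mem)
    have hz := G.z_mem_word (ξ := c) (Or.inr G.κ_mem)
    have hy := isY_y G.h_ne
    have h1 := h.first _ hc _ hz (hξ.ne_z _) (fun h => hξ.not_isY h.1) (G.first_outer_z hξ G.κ_mem)
    have h2 := h.first _ hz _ (G.yh_mem_word c) (by simp) (fun h => not_isY_z _ h.1)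
      (G.first_z_yh hξ G.κ_mem)
    have h3 := h.last _ (G.yh_mem_word c) _ hc (hξ.ne_y G.h_ne).symm (fun h => hξ.not_isY h.2)
      (G.last_y_outer hξ hy)
    have hcnt := G.pat_count_outer h hξ
    have hyu := h.mem _ (G.yh_mem_word c)
    subst hu
    have hp := List.count_pos_iff.2 hcW
    simp only [List.count_append] at hcnt
    have hcP : c ∉ P := fun h' => by
      have := List.count_pos_iff.2 h'
      omega
    have hcQ : c ∉ Q := fun h' => by
      have := List.count_pos_iff.2 h'
      omega
    have hyQ := h3.not_mem_right hcQ
    rw [List.append_assoc] at h1 h2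
    have hzP := h1.not_mem_left hcP
    have h4 := h2.right hzP
    have hyP := h2.not_mem_left hzP
    rw [List.append_assoc] at h4
    have hyW : y G.h ∈ W := by simpa [hyP, hyQ] using hyu
    exact h4.not_mem_left hzW hyW
  · exact absurd hcW (G.z_not_mem_block h hξ hu' (by simp) hj)
  · exact absurd hcW (G.t_not_mem_block h hξ hu' hj)
  · exact h'

end

theorem word_square_iff (hξ : Outer ξ) (l r W : List Letter) :
    Pat (G.word ξ) IsY (l ++ (W ++ W) ++ r) ↔ Pat (G.word ξ) IsY (l ++ (W ++ W ++ W) ++ r) := by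
  constructor
  · intro h
    exact (pat_xx (G.isY_of_mem_square h hξ rfl) l r).1 h
  · intro h
    exact (pat_xx (G.isY_of_mem_square h hξ (P := l) (Q := W ++ r) (by simp)) l r).2 h

theorem word_commute (hξ : Outer ξ) (l r W V : List Letter)
    (h : Pat (G.word ξ) IsY (l ++ (W ++ W ++ V ++ V) ++ r)) :
    Pat (G.word ξ) IsY (l ++ (V ++ V ++ W ++ W) ++ r) :=
  pat_xxyy (G.isY_of_mem_square h hξ (P := l) (Q := V ++ V ++ r) (by simp))
    (G.isY_of_mem_square h hξ (P := l ++ W ++ W) (Q := r) (by simp)) l r h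

end Guard

theorem toList_lift (θ : Letter → Word) (u : Word) :
    toList (lift θ u) = wsub (fun c => toList (θ c)) (toList u) := by
  induction u using FreeMonoid.inductionOn' with
  | one => rfl
  | of_mul c u ih => simp [ih]

theorem fic_satisfies (S : Set MonoidIdentity) {e : MonoidIdentity} (he : e ∈ S) :
    MonoidSatisfies (MonoidVariety.ofIdentities S).fic.Quotient e := by
  rw [conQuotient_satisfies]
  intro θ M hM
  exact (hM e he).comp θ

/-- The syntactic monoid of `C` lies in the variety defined by `S`, so congruent words have equal
values in it. -/
theorem fic_stable {S : Set MonoidIdentity} {C : Word → Prop} (hC : ∀ e ∈ S, Stable C e)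
    {u v : Word} (h : (MonoidVariety.ofIdentities S).fic u v) : C u ↔ C v := by
  have hM : MonCat.of (syntacticCon C).Quotient ∈ (MonoidVariety.ofIdentities S).carrier :=
    fun e he => (syntactic_satisfies C e).2 (hC e he)
  have := (syntactic_satisfies C (u, v)).1 (h _ hM) of 1 1
  have hid : ∀ w : Word, lift (of : Letter → Word) w = w := by
    intro w
    have : lift (of : Letter → Word) = MonoidHom.id Word := FreeMonoid.hom_eq (by simp)
    rw [this]
    rfl
  simpa only [one_mul, mul_one, hid] using this

/-- Words congruent under `α₁°` have the same pattern with respect to a guard word. -/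
theorem Guard.pat_of_aperiodic (G : Guard) {ξ : Letter} (hξ : Guard.Outer ξ) {u v : Word}
    (h : alphaOneAperiodic u v) (hu : Pat (G.word ξ) IsY (toList u)) :
    Pat (G.word ξ) IsY (toList v) := by
  refine (fic_stable (C := fun w => Pat (G.word ξ) IsY (toList w)) ?_ h).1 hu
  rintro e (rfl | rfl | rfl | rfl) θ l r
  · simpa [pow_succ, wx, toList_mul] using
      G.word_square_iff hξ (toList l) (toList r) (toList (θ x))
  · simpa [pow_succ, wx, wy, toList_mul] using
      pat_xyxx (G.word ξ) IsY (toList l) (toList r) (toList (θ x)) (toList (θ (y 0)))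
  · have h1 := G.word_commute hξ (toList l) (toList r) (toList (θ x)) (toList (θ (y 0)))
    have h2 := G.word_commute hξ (toList l) (toList r) (toList (θ (y 0))) (toList (θ x))
    simpa [pow_succ, wx, wy, toList_mul] using Iff.intro h1 h2
  · simpa [pow_succ, wx, wy, wz, wt, toList_mul] using
      pat_xzxyty (G.word ξ) IsY (toList l) (toList r) (toList (θ x)) (toList (θ (z 0)))
        (toList (θ (y 0))) (toList (θ (t 0)))

/-- The substitution that squares the letters `y i` with `i ≠ 0`. -/
noncomputable def squareY : Letter → List Letter :=
  open Classical in expand fun c => if IsY c then 2 else 1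

/-- The value of a list of letters modulo `α₁°`. -/
def aperiodicClass (u : List Letter) : alphaOneAperiodic.Quotient :=
  ((ofList u : Word) : alphaOneAperiodic.Quotient)

theorem aperiodicClass_append (u v : List Letter) :
    aperiodicClass (u ++ v) = aperiodicClass u * aperiodicClass v := rfl

theorem aperiodicClass_eq {u v : List Letter} :
    aperiodicClass u = aperiodicClass v ↔ alphaOneAperiodic (ofList u) (ofList v) :=
  alphaOneAperiodic.eq

theorem aperiodicClass_wsub {α : Type} (θ : α → List Letter) (u : List α) :
    aperiodicClass (wsub θ u) = (u.map fun c => aperiodicClass (θ c)).prod := by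
  induction u with
  | nil => rfl
  | cons c u ih => rw [wsub_cons, aperiodicClass_append, ih, List.map_cons, List.prod_cons]

/-- A substitution that sends the letters of the basic identities to given elements. -/
def evalLetters {Q : Type} (X Y Z T : Q) : Letter → Q
  | x => X
  | y _ => Y
  | z _ => Z
  | t _ => T

section

variable {M : Type} [Monoid M]

theorem MonoidSatisfies.square (h : MonoidSatisfies M (wx ^ 2, wx ^ 3)) (X : M) :
    X * X = X * X * X := by
  simpa [wx, evalLetters, pow_succ] using h (evalLetters X X X X)

theorem MonoidSatisfies.commute (h : MonoidSatisfies M (wx ^ 2 * wy 0 ^ 2, wy 0 ^ 2 * wx ^ 2))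
    (X Y : M) : X * X * (Y * Y) = Y * Y * (X * X) := by
  simpa [wx, wy, evalLetters, pow_succ] using h (evalLetters X Y X X)

theorem MonoidSatisfies.swap (h : MonoidSatisfies M (wx * wz 0 * wx * wy 0 * wt 0 * wy 0,
    wx * wz 0 * wy 0 * wx * wt 0 * wy 0)) (X Y Z T : M) :
    X * Z * X * Y * T * Y = X * Z * Y * X * T * Y := by
  simpa [wx, wy, wz, wt, evalLetters, pow_succ] using h (evalLetters X Y Z T)

theorem aperiodic_square (X : alphaOneAperiodic.Quotient) : X * X = X * X * X :=
  MonoidSatisfies.square (fic_satisfies _ (Or.inl rfl)) X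

theorem aperiodic_commute (X Y : alphaOneAperiodic.Quotient) :
    X * X * (Y * Y) = Y * Y * (X * X) :=
  MonoidSatisfies.commute (fic_satisfies _ (Or.inr (Or.inr (Or.inl rfl)))) X Y

theorem aperiodic_swap (X Y Z T : alphaOneAperiodic.Quotient) :
    X * Z * X * Y * T * Y = X * Z * Y * X * T * Y :=
  MonoidSatisfies.swap (fic_satisfies _ (Or.inr (Or.inr (Or.inr rfl)))) X Y Z T

end

/-- Modulo `α₁°` the squares of letters are commuting idempotents. Once each `y i` is replaced by
its square, the sorting theorem applies with the `y i` as the letters of `D`. -/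
theorem Guard.aperiodicClass_eq_of_pat (G : Guard) {ξ : Letter} (hξ : Guard.Outer ξ)
    {u : List Letter} (h : Pat (G.word ξ) IsY u) (hu : ∀ c ∈ u, c ∈ G.word ξ) :
    aperiodicClass (wsub squareY u) = aperiodicClass (wsub squareY (G.word ξ)) := by
  rw [aperiodicClass_wsub, aperiodicClass_wsub]
  have hsq : ∀ c, IsY c → aperiodicClass (squareY c) = aperiodicClass [c] * aperiodicClass [c] := by
    intro c hc
    have : squareY c = [c] ++ [c] := by simp [squareY, expand, hc]
    rw [this, aperiodicClass_append]
  refine h.prod_eq ?_ ?_ (fun X Y Z T => aperiodic_swap X Y Z T) hu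
    (fun c hc => G.count_word_le_two hξ hc) (G.word_lin hξ)
  · intro c d hc hd
    rw [hsq c hc, hsq d hd]
    exact aperiodic_commute _ _
  · intro c hc
    rw [hsq c hc]
    have h1 := aperiodic_square (aperiodicClass [c])
    -- `X⁴ = X²`, by two uses of `X² = X³`.
    rw [← mul_assoc, ← h1, ← h1]

end AperiodicCongruence

/-! ### Short patterns inherited from the guard pattern. -/

section Detection

open Letter FreeMonoid

/-- A symmetric relation on words that is closed under contexts and substitutions. -/
structure ClosedRel (R : List Letter → List Letter → Prop) : Prop where
  symm : ∀ u v, R u v → R v u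
  context : ∀ l r u v, R u v → R (l ++ u ++ r) (l ++ v ++ r)
  subst : ∀ θ u v, R u v → R (wsub θ u) (wsub θ v)

/-- The property `P` of words is preserved by the relation `R`. -/
def Preserves (R : List Letter → List Letter → Prop) (P : List Letter → Prop) : Prop :=
  ∀ u v, R u v → P u → P v

theorem ClosedRel.reverse {R : List Letter → List Letter → Prop} (h : ClosedRel R) :
    ClosedRel fun u v => R u.reverse v.reverse where
  symm u v := h.symm _ _
  context l r u v huv := by
    have := h.context r.reverse l.reverse _ _ huv
    simpa using this
  subst θ u v huv := by
    have := h.subst (fun c => (θ c).reverse) _ _ huv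
    simpa [wsub_reverse] using this

theorem Preserves.not {R : List Letter → List Letter → Prop} {P : List Letter → Prop}
    (hR : ClosedRel R) (h : Preserves R P) : Preserves R fun u => ¬ P u :=
  fun u v huv hu hv => hu (h v u (hR.symm u v huv) hv)

theorem Preserves.and {R : List Letter → List Letter → Prop} {P P' : List Letter → Prop}
    (h : Preserves R P) (h' : Preserves R P') : Preserves R fun u => P u ∧ P' u :=
  fun u v huv hu => ⟨h u v huv hu.1, h' u v huv hu.2⟩

/-- The pattern of `g h⁺ e g`. -/
def PatSquare (g h e : Letter) (u : List Letter) : Prop := Pat [g, h, e, g] (· = h) u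

/-- The pattern of `h⁺ e`. -/
def PatPower (h e : Letter) (u : List Letter) : Prop := Pat [h, e] (· = h) u

theorem firstLT_middle {p w q : List Letter} {c d : Letter} (h : FirstLT (p ++ w ++ q) c d)
    (hp : c ∉ p) (hq : c ∉ q) : FirstLT w c d := by
  rw [List.append_assoc] at h
  rcases (firstLT_append _ _ _ _).1 (h.right hp) with h' | h'
  · exact h'
  · exact absurd h'.2.mem hq

theorem lastLT_middle {p w q : List Letter} {c d : Letter} (h : LastLT (p ++ w ++ q) c d)
    (hp : d ∉ p) (hq : d ∉ q) : LastLT w c d := by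
  rcases (lastLT_append _ _ _ _).1 (h.left hq) with h' | h'
  · exact h'
  · exact absurd h'.2.mem hp

theorem count_middle {p w q : List Letter} {c : Letter} (hp : c ∉ p) (hq : c ∉ q) :
    (p ++ w ++ q).count c = w.count c := by
  simp [List.count_eq_zero_of_not_mem hp, List.count_eq_zero_of_not_mem hq]

section

variable {g h e : Letter} (hgh : g ≠ h) (hge : g ≠ e) (hhe : h ≠ e)
include hgh hge hhe

theorem patSquare_iff (u : List Letter) : PatSquare g h e u ↔
    FirstLT u g h ∧ FirstLT u g e ∧ FirstLT u h e ∧ LastLT u h e ∧ LastLT u h g ∧ LastLT u e g ∧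
      u.count g = 2 ∧ u.count e = 1 := by
  constructor
  · intro hp
    refine ⟨hp.first g (by simp) h (by simp) hgh (fun h' => hgh h'.1) ?_,
      hp.first g (by simp) e (by simp) hge (fun h' => hgh h'.1) ?_,
      hp.first h (by simp) e (by simp) hhe (fun h' => hhe h'.2.symm) ?_,
      hp.last h (by simp) e (by simp) hhe (fun h' => hhe h'.2.symm) ?_,
      hp.last h (by simp) g (by simp) hgh.symm (fun h' => hgh h'.2) ?_,
      hp.last e (by simp) g (by simp) hge.symm (fun h' => hgh h'.2) ?_,
      (hp.cnt g (by simp) hgh).trans ?_, (hp.cnt e (by simp) hhe.symm).trans ?_⟩ <;>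
    simp [firstLT_cons, lastLT_cons, hgh, hge, hhe, hgh.symm, hge.symm, hhe.symm]
  · rintro ⟨h1, h2, h3, h4, h5, h6, h7, h8⟩
    refine ⟨?_, ?_, ?_, ?_⟩
    · intro c hc d hd hcd hD
      simp only [List.mem_cons, List.not_mem_nil, or_false] at hc hd
      rcases hc with rfl | rfl | rfl | rfl <;> rcases hd with rfl | rfl | rfl | rfl <;>
        simp_all [firstLT_cons]
    · intro c hc d hd hcd hD
      simp only [List.mem_cons, List.not_mem_nil, or_false] at hc hd
      rcases hc with rfl | rfl | rfl | rfl <;> rcases hd with rfl | rfl | rfl | rfl <;>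
        simp_all [lastLT_cons]
    · intro c hc hD
      simp only [List.mem_cons, List.not_mem_nil, or_false] at hc
      rcases hc with rfl | rfl | rfl | rfl <;>
        simp_all [hge.symm, hhe.symm, hgh.symm]
    · intro c hc
      simp only [List.mem_cons, List.not_mem_nil, or_false] at hc
      rcases hc with rfl | rfl | rfl | rfl
      · exact h1.mem
      · exact h3.mem
      · exact h4.mem
      · exact h1.mem

omit hgh hge in
theorem patPower_iff (u : List Letter) : PatPower h e u ↔
    FirstLT u h e ∧ LastLT u h e ∧ u.count e = 1 := by
  constructor
  · intro hp
    refine ⟨hp.first h (by simp) e (by simp) hhe (fun h' => hhe h'.2.symm) ?_,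
      hp.last h (by simp) e (by simp) hhe (fun h' => hhe h'.2.symm) ?_,
      (hp.cnt e (by simp) hhe.symm).trans ?_⟩ <;>
    simp [firstLT_cons, lastLT_cons, hhe, hhe.symm]
  · rintro ⟨h1, h2, h3⟩
    refine ⟨?_, ?_, ?_, ?_⟩
    · intro c hc d hd hcd hD
      simp only [List.mem_cons, List.not_mem_nil, or_false] at hc hd
      rcases hc with rfl | rfl <;> rcases hd with rfl | rfl <;> simp_all [firstLT_cons]
    · intro c hc d hd hcd hD
      simp only [List.mem_cons, List.not_mem_nil, or_false] at hc hd
      rcases hc with rfl | rfl <;> rcases hd with rfl | rfl <;> simp_all [lastLT_cons]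
    · intro c hc hD
      simp only [List.mem_cons, List.not_mem_nil, or_false] at hc
      rcases hc with rfl | rfl <;> simp_all [hhe.symm]
    · intro c hc
      simp only [List.mem_cons, List.not_mem_nil, or_false] at hc
      rcases hc with rfl | rfl
      · exact h1.mem
      · exact h2.mem

/-- Peeling determines the word: the orders force `g` at both ends and `e` just before the final
`g`. The multiplicities of `g` and `e` are then exhausted, so the rest is a nonempty power of `h`.
-/
theorem PatSquare.eq {u : List Letter} (hp : PatSquare g h e u)
    (hu : ∀ c ∈ u, c = g ∨ c = h ∨ c = e) :
    ∃ m, m ≠ 0 ∧ u = g :: List.replicate m h ++ [e, g] := by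
  obtain ⟨h1, h2, h3, h4, h5, h6, h7, h8⟩ := (patSquare_iff hgh hge hhe u).1 hp
  rcases u with _ | ⟨c, u⟩
  · exact h1.elim
  have hc : c = g := by
    rcases hu c (by simp) with rfl | rfl | rfl
    · rfl
    · simp [firstLT_cons, hgh.symm] at h1
    · simp [firstLT_cons, hge.symm] at h2
  subst hc
  rw [List.count_cons_self] at h7
  obtain rfl | ⟨u, d, rfl⟩ := List.eq_nil_or_concat' u
  · simp at h7
  have hd : d = c := by
    rcases hu d (by simp) with rfl | rfl | rfl
    · rfl
    · rw [← List.cons_append, lastLT_append] at h5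
      simp [lastLT_singleton, hgh.symm] at h5
    · rw [← List.cons_append, lastLT_append] at h6
      simp [lastLT_singleton, hge.symm] at h6
  subst hd
  have hdu : d ∉ u := by
    rw [← List.count_eq_zero]
    simpa using h7
  obtain rfl | ⟨u, f, rfl⟩ := List.eq_nil_or_concat' u
  · simp [hge] at h8
  have hf : f = e := by
    rcases hu f (by simp) with rfl | rfl | rfl
    · simp at hdu
    · simp [lastLT_cons, lastLT_append, hge, hhe, hgh.symm] at h4
    · rfl
  subst hf
  have hfu : f ∉ u := by
    rw [← List.count_eq_zero]
    simpa [List.count_cons, hge] using h8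
  refine ⟨u.length, ?_, ?_⟩
  · intro h0
    rw [List.length_eq_zero_iff] at h0
    subst h0
    have := h3.mem
    simp [hgh.symm, hhe] at this
  · have : u = List.replicate u.length h := by
      rw [List.eq_replicate_iff]
      refine ⟨rfl, fun c hc => ?_⟩
      rcases hu c (by simp [hc]) with rfl | rfl | rfl
      · exact absurd hc (by simpa using fun h => hdu (by simp [h]))
      · rfl
      · exact absurd hc hfu
    rw [← this]
    simp

/-- The substitution that keeps only the letters `g`, `h` and `e`. -/
theorem patSquare_filter (u : List Letter) : PatSquare g h e u ↔
    PatSquare g h e (wsub (fun c => if c = g ∨ c = h ∨ c = e then [c] else []) u) := by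
  rw [patSquare_iff hgh hge hhe, patSquare_iff hgh hge hhe]
  have hm : ∀ c, (c = g ∨ c = h ∨ c = e) →
      ∀ d, c ∈ (fun c => if c = g ∨ c = h ∨ c = e then [c] else []) d ↔ d = c := by
    intro c hc d
    dsimp only
    split_ifs with hd
    · rw [List.mem_singleton, eq_comm]
    · simp only [List.not_mem_nil, false_iff]
      rintro rfl
      exact hd hc
  have hk : ∀ c, (c = g ∨ c = h ∨ c = e) →
      (wsub (fun c => if c = g ∨ c = h ∨ c = e then [c] else []) u).count c = u.count c := by
    intro c hc
    rw [count_wsub (c := c) (n := 1) (by simp [hc]) (fun d hd h => hd ((hm c hc d).1 h)), one_mul]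
  have hg := hm g (Or.inl rfl)
  have hh := hm h (Or.inr (Or.inl rfl))
  have he := hm e (Or.inr (Or.inr rfl))
  rw [firstLT_wsub hgh hg hh, firstLT_wsub hge hg he, firstLT_wsub hhe hh he,
    lastLT_wsub hhe hh he, lastLT_wsub hgh.symm hh hg, lastLT_wsub hge.symm he hg,
    hk g (Or.inl rfl), hk e (Or.inr (Or.inr rfl))]

/-- Deleting `g` and then enclosing the word in two letters `g` reduces the pattern of `h⁺ e` to
that of `g h⁺ e g`; both operations are admissible for a closed relation. -/
theorem patPower_iff_patSquare (u : List Letter) : PatPower h e u ↔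
    PatSquare g h e ([g] ++ wsub (fun c => if c = g then [] else [c]) u ++ [g]) := by
  rw [patPower_iff hhe, patSquare_iff hgh hge hhe]
  have hm : ∀ c, c ≠ g → ∀ d, c ∈ (fun c => if c = g then [] else [c]) d ↔ d = c := by
    intro c hc d
    dsimp only
    split_ifs with hd
    · simp only [List.not_mem_nil, false_iff]
      rintro rfl
      exact hc hd
    · rw [List.mem_singleton, eq_comm]
  set w := wsub (fun c => if c = g then [] else [c]) u with hw
  have hg : g ∉ w := by
    simp only [hw, mem_wsub, not_exists]
    rintro c ⟨_, hc⟩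
    split_ifs at hc with h'
    · simp at hc
    · exact h' (List.mem_singleton.1 hc).symm
  have hk : w.count e = u.count e := by
    rw [hw, count_wsub (c := e) (n := 1) (by simp [hge.symm])
      (fun d hd h => hd ((hm e hge.symm d).1 h)), one_mul]
  rw [← hk, ← firstLT_wsub hhe (hm h hgh.symm) (hm e hge.symm),
    ← lastLT_wsub hhe (hm h hgh.symm) (hm e hge.symm), ← hw]
  constructor
  · rintro ⟨h1, h2, h3⟩
    simp [firstLT_append, firstLT_cons, lastLT_append, lastLT_cons, h1, h2, h3, hgh, hge,
      hgh.symm, hge.symm, List.count_eq_zero_of_not_mem hg]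
  · rintro ⟨h1, h2, h3, h4, h5, h6, h7, h8⟩
    exact ⟨firstLT_middle h3 (by simp [hgh.symm]) (by simp [hgh.symm]),
      lastLT_middle h4 (by simp [hge.symm]) (by simp [hge.symm]),
      by rwa [count_middle (by simp [hge.symm]) (by simp [hge.symm])] at h8⟩

end

namespace Guard

variable (G : Guard)

/-- A decomposition of the guard word at the square of `y h` and its neighbour `z κ`. -/
theorem word_decomposition (ξ : Letter) : ∃ p Rr q, t G.κ ∈ Rr ∧
    G.word ξ = p ++ ([z G.κ] ++ List.replicate 2 (y G.h) ++ Rr ++ [z G.κ]) ++ q := by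
  obtain ⟨C, hC⟩ := G.CF_last
  obtain ⟨J1, J2, hJ⟩ := List.append_of_mem G.κ_mem
  refine ⟨G.pre ++ [ξ] ++ C, G.CL ++ [ξ] ++ wsub (fun i => [t i, z i]) J1 ++ [t G.κ],
    wsub (fun i => [t i, z i]) J2, by simp, ?_⟩
  simp [word, core, suf, hC, hJ, List.replicate]

theorem first_y_t {ξ : Letter} (hξ : Outer ξ) {j : ℕ} (hj : j ∈ G.J) :
    FirstLT (G.word ξ) (y G.h) (t j) := by
  have := firstLT_split (p := G.pre ++ [ξ] ++ G.core) (q := [ξ] ++ G.suf) (c := y G.h) (d := t j)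
    (by simp [core])
    (by
      have h1 : j ∉ G.I := fun h => G.disjoint h hj rfl
      simp [t_mem_pre, core, t_not_mem_CF, t_not_mem_CL, h1, (hξ.ne_t j).symm])
  simpa [word] using this

theorem pat_power_change {b p r : List Letter} {m n : ℕ} (hm : m ≠ 0) (hn : n ≠ 0) {c : Letter}
    {D : Letter → Prop} (hc : D c) (h : Pat b D (p ++ List.replicate m c ++ r)) :
    Pat b D (p ++ List.replicate n c ++ r) := by
  have hF : ∀ n, n ≠ 0 → ∀ d e, FirstLT (List.replicate n c) d e ↔ c = d := by
    intro n hn d e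
    obtain ⟨n, rfl⟩ := Nat.exists_eq_succ_of_ne_zero hn
    clear hn
    induction n with
    | zero => simp [firstLT_singleton]
    | succ n ih => rw [List.replicate_succ, firstLT_cons, ih]; tauto
  have hL : ∀ n, n ≠ 0 → ∀ d e, LastLT (List.replicate n c) d e ↔ c = e := by
    intro n hn d e
    rw [LastLT, List.reverse_replicate, hF n hn]
  apply h.congr
  · intro d _ e _ _ _
    simp only [firstLT_append, hF m hm, hF n hn, List.mem_append, List.mem_replicate]
    tauto
  · intro d _ e _ _ _
    simp only [lastLT_append, hL m hm, hL n hn, List.mem_replicate]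
    tauto
  · intro d _ hd
    have hcd : c ≠ d := fun h => hd (h ▸ hc)
    simp [List.count_replicate, hcd]
  · intro d _
    simp [hm, hn]

variable {R : List Letter → List Letter → Prop} (hR : ClosedRel R) {ξ : Letter} (hξ : Outer ξ)
  (hp : Preserves R (Pat (G.word ξ) IsY))
include hR hξ hp

/-- Between the two occurrences of `z κ` the guard word starts with the square of `y h` and later
contains the linear `t κ`. Hence `g h⁺ e g` can be substituted into it, and the guard pattern of the
result characterises the shorter pattern. -/
theorem preserves_patSquare {g h e : Letter} (hgh : g ≠ h) (hge : g ≠ e) (hhe : h ≠ e) :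
    Preserves R (PatSquare g h e) := by
  obtain ⟨p, Rr, q, htR, hw⟩ := G.word_decomposition ξ
  have hκ := G.κ_mem
  have hz := G.count_z_word hξ (Or.inr hκ)
  have ht := G.count_t_word hξ (Or.inr hκ)
  have hyw : (G.word ξ).count (y G.h) = 2 := by
    simp [word, core, List.count_eq_zero_of_not_mem (G.y_not_mem_pre _),
      List.count_eq_zero_of_not_mem (G.y_not_mem_suf _),
      List.count_eq_zero_of_not_mem G.yh_not_mem_CF,
      List.count_eq_zero_of_not_mem G.yh_not_mem_CL, hξ.ne_y G.h_ne]
  rw [hw] at hyw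
  simp at hyw
  have hy : y G.h ∉ Rr := by rw [← List.count_eq_zero]; omega
  have ht1 := List.count_pos_iff.2 htR
  rw [hw] at hz ht
  simp at hz ht
  have hzp : z G.κ ∉ p := by rw [← List.count_eq_zero]; omega
  have hzq : z G.κ ∉ q := by rw [← List.count_eq_zero]; omega
  have hzR : z G.κ ∉ Rr := by rw [← List.count_eq_zero]; omega
  have htp : t G.κ ∉ p := by rw [← List.count_eq_zero]; omega
  have htq : t G.κ ∉ q := by rw [← List.count_eq_zero]; omega
  have htR1 : Rr.count (t G.κ) = 1 := by omega
  have hyp : y G.h ∉ p := by rw [← List.count_eq_zero]; omega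
  have hyq : y G.h ∉ q := by rw [← List.count_eq_zero]; omega
  -- `e` takes everything from behind the square of `y h` up to the last `z κ`. The letters `z κ`,
  -- `y h`, `t κ` mark the images of `g`, `h`, `e`; all other letters are erased.
  let φ : Letter → List Letter := fun c =>
    if c = g then [z G.κ] else if c = h then [y G.h] else if c = e then Rr else []
  have hφg : ∀ c, z G.κ ∈ φ c ↔ c = g := by
    intro c
    simp only [φ]
    split_ifs with h1 h2 h3
    · simp [h1]
    · simp [h2, hgh.symm]
    · simp [h3, hzR, hge.symm]
    · simp [h1]
  have hφh : ∀ c, y G.h ∈ φ c ↔ c = h := by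
    intro c
    simp only [φ]
    split_ifs with h1 h2 h3
    · simp [h1, hgh]
    · simp [h2]
    · simp [h3, hy, hhe.symm]
    · simp [h2]
  have hφe : ∀ c, t G.κ ∈ φ c ↔ c = e := by
    intro c
    simp only [φ]
    split_ifs with h1 h2 h3
    · simp [h1, hge]
    · simp [h2, hhe]
    · simp [h3, htR]
    · simp [h3]
  have key : ∀ u, PatSquare g h e u ↔ Pat (G.word ξ) IsY (p ++ wsub φ u ++ q) := by
    intro u
    constructor
    · intro hu
      have hu' := (patSquare_filter hgh hge hhe u).1 hu
      obtain ⟨m, hm, hf⟩ := hu'.eq hgh hge hhe (by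
        intro c hc
        obtain ⟨d, _, hd⟩ := mem_wsub.1 hc
        split_ifs at hd with h'
        · rw [List.mem_singleton.1 hd]
          exact h'
        · simp at hd)
      have hφ : wsub φ u = wsub φ (g :: List.replicate m h ++ [e, g]) := by
        rw [← hf, wsub_wsub]
        refine wsub_congr fun c _ => ?_
        split_ifs with h'
        · simp
        · simp only [not_or] at h'
          simp [φ, h']
      have hrep : ∀ n, wsub φ (List.replicate n h) = List.replicate n (y G.h) := by
        intro n
        induction n with
        | zero => rfl
        | succ n ih =>
          rw [List.replicate_succ, wsub_cons, ih]
          simp [φ, hgh.symm, List.replicate_succ]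
      have hφ' : wsub φ u = [z G.κ] ++ List.replicate m (y G.h) ++ Rr ++ [z G.κ] := by
        rw [hφ, List.cons_append, wsub_cons, wsub_append, hrep]
        simp [φ, hge.symm, hhe.symm]
      rw [hφ']
      have h0 : Pat (G.word ξ) IsY
          ((p ++ [z G.κ]) ++ List.replicate 2 (y G.h) ++ (Rr ++ [z G.κ] ++ q)) := by
        have := Pat.refl (G.word ξ) IsY
        nth_rewrite 2 [hw] at this
        simpa using this
      have := pat_power_change (n := m) (by omega) hm (isY_y G.h_ne) h0
      simpa using this
    · intro hu
      rw [patSquare_iff hgh hge hhe]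
      have hzw := G.z_mem_word (ξ := ξ) (Or.inr hκ)
      have htw := G.t_mem_word (ξ := ξ) (Or.inr hκ)
      have hyw := G.yh_mem_word ξ
      have hY := isY_y G.h_ne
      refine ⟨?_, ?_, ?_, ?_, ?_, ?_, ?_, ?_⟩
      · rw [← firstLT_wsub hgh hφg hφh]
        exact firstLT_middle (hu.first _ hzw _ hyw (by simp) (fun h => not_isY_z _ h.1)
          (G.first_z_yh hξ hκ)) hzp hzq
      · rw [← firstLT_wsub hge hφg hφe]
        exact firstLT_middle (hu.first _ hzw _ htw (by simp) (fun h => not_isY_z _ h.1)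
          (G.first_z_t hξ hκ)) hzp hzq
      · rw [← firstLT_wsub hhe hφh hφe]
        exact firstLT_middle (hu.first _ hyw _ htw (by simp) (fun h => not_isY_t _ h.2)
          (G.first_y_t hξ hκ)) hyp hyq
      · rw [← lastLT_wsub hhe hφh hφe]
        exact lastLT_middle (hu.last _ hyw _ htw (by simp) (fun h => not_isY_t _ h.2)
          (G.last_y_t hY hκ)) htp htq
      · rw [← lastLT_wsub hgh.symm hφh hφg]
        exact lastLT_middle (hu.last _ hyw _ hzw (by simp) (fun h => not_isY_z _ h.2)
          ((G.last_y_t hY hκ).trans (G.last_t_z hκ))) hzp hzq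
      · rw [← lastLT_wsub hge.symm hφe hφg]
        exact lastLT_middle (hu.last _ htw _ hzw (by simp) (fun h => not_isY_z _ h.2)
          (G.last_t_z hκ)) hzp hzq
      · have h1 := G.pat_count_z hu hξ (Or.inr hκ)
        rwa [count_middle hzp hzq, count_wsub (c := g) (n := 1) (by simp [φ])
          (fun d hd h => hd ((hφg d).1 h)), one_mul] at h1
      · have h1 := G.pat_count_t hu hξ (Or.inr hκ)
        rwa [count_middle htp htq, count_wsub (c := e) (n := 1)
          (by simp [φ, hge.symm, hhe.symm, htR1]) (fun d hd h => hd ((hφe d).1 h)), one_mul] at h1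
  intro u v huv hu
  rw [key] at hu ⊢
  exact hp _ _ (hR.context p q _ _ (hR.subst φ u v huv)) hu

theorem preserves_patPower {h e : Letter} (hhe : h ≠ e) : Preserves R (PatPower h e) := by
  obtain ⟨g, hg⟩ := Infinite.exists_notMem_finset ({h, e} : Finset Letter)
  simp only [Finset.mem_insert, Finset.mem_singleton, not_or] at hg
  intro u v huv hu
  rw [patPower_iff_patSquare hg.1 hg.2 hhe] at hu ⊢
  exact G.preserves_patSquare hR hξ hp hg.1 hg.2 hhe _ _
    (hR.context _ _ _ _ (hR.subst _ _ _ huv)) hu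

end Guard

end Detection

/-! ### Identities of the variety preserve the guard patterns. -/

section BaseInvariance

open Letter FreeMonoid

theorem ofList_wsub (θ : Letter → List Letter) (u : List Letter) :
    (ofList (wsub θ u) : Word) = lift (fun c => (ofList (θ c) : Word)) (ofList u) := by
  apply toList.injective
  rw [toList_lift]
  simp

/-- The relation given by the identities of a variety. -/
def identityRel (V : MonoidVariety) (u v : List Letter) : Prop :=
  V.Satisfies ((ofList u : Word), (ofList v : Word))

theorem identityRel_closed (V : MonoidVariety) : ClosedRel (identityRel V) where
  symm _ _ h M hM := (h M hM).symm
  context l r _ _ h M hM := (h M hM).context (ofList l) (ofList r)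
  subst θ u v h M hM := by
    rw [ofList_wsub, ofList_wsub]
    exact (h M hM).comp _

theorem saturated_of_preserves {V : MonoidVariety} {C : List Letter → Prop}
    (h : Preserves (identityRel V) C) : Saturated V fun w => C (toList w) :=
  fun u v huv hu => h (toList u) (toList v) huv hu

namespace Guard

variable (G : Guard)

/-- The renaming of the outer letter. -/
def rename (ξ : Letter) (c : Letter) : Letter := if c = ξ then x else c

theorem map_word {ξ : Letter} (hξ : Outer ξ) : (G.word ξ).map (rename ξ) = G.word x := by
  have h : ∀ w : List Letter, ξ ∉ w → w.map (rename ξ) = w := by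
    intro w hw
    refine (List.map_congr_left (g := id) fun c hc => ?_).trans (List.map_id w)
    have : c ≠ ξ := fun h => hw (h ▸ hc)
    simp [rename, this]
  simp only [word, List.map_append, h _ (G.outer_not_mem_pre hξ), h _ (G.outer_not_mem_core hξ),
    h _ (G.outer_not_mem_suf hξ)]
  simp [rename]

theorem rename_injOn {ξ : Letter} :
    ∀ c ∈ G.word ξ, ∀ d ∈ G.word ξ, rename ξ c = rename ξ d → c = d := by
  have hx : ∀ c ∈ G.word ξ, c ≠ ξ → c ≠ x := by
    rintro c hc hne rfl
    rcases G.mem_word_cases hc with h | ⟨j, _, h | h⟩ | ⟨i, _, h⟩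
    · exact hne h
    · cases h
    · cases h
    · cases h
  intro c hc d hd hcd
  simp only [rename] at hcd
  split_ifs at hcd with h1 h2 h3
  · rw [h1, h2]
  · exact absurd hcd.symm (hx d hd h2)
  · exact absurd hcd (hx c hc h1)
  · exact hcd

theorem isY_rename {ξ : Letter} (hξ : Outer ξ) (c : Letter) : IsY (rename ξ c) ↔ IsY c := by
  unfold rename
  split_ifs with h
  · subst h
    simp only [hξ.not_isY, iff_false]
    rintro ⟨i, _, h⟩
    cases h
  · rfl

/-- Delete the letters foreign to the guard word, rename the outer letter to `x` and square the `y
i`. If `u` has the pattern, its image lies in the class of `w`; then so does the image of `v`, and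
membership in that class gives back the pattern of `v`. -/
theorem preserves_pat {w : Word} {V : MonoidVariety}
    (hV : V = sapirVariety alphaOneAperiodic {((w : Word) : alphaOneAperiodic.Quotient)})
    (hw : toList w = G.word x)
    (hsq : aperiodicClass (wsub squareY (G.word x)) = aperiodicClass (G.word x))
    {ξ : Letter} (hξ : Outer ξ) : Preserves (identityRel V) (Pat (G.word ξ) IsY) := by
  intro u v huv hu
  subst hV
  set ρ : Letter → List Letter := fun c => if c ∈ G.word ξ then [rename ξ c] else [] with hρ
  have hpat : ∀ u, Pat (G.word x) IsY (wsub ρ u) ↔ Pat (G.word ξ) IsY u := by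
    intro u
    have := pat_map (D := IsY) (D' := IsY) G.rename_injOn (fun c _ => isY_rename hξ c) u
    rwa [G.map_word hξ] at this
  have hx : Outer x := Or.inl rfl
  have hcont : ∀ c ∈ wsub ρ u, c ∈ G.word x := by
    intro c hc
    obtain ⟨d, _, hd⟩ := mem_wsub.1 hc
    simp only [hρ] at hd
    split_ifs at hd with h
    · rw [List.mem_singleton.1 hd, ← G.map_word hξ]
      exact List.mem_map_of_mem h
    · simp at hd
  have h1 := G.aperiodicClass_eq_of_pat hx ((hpat u).2 hu) hcont
  rw [hsq, wsub_wsub, aperiodicClass_eq, ← hw] at h1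
  have h2 := sapirVariety_satisfies huv (fun c => ofList (wsub squareY (ρ c))) 1 1 (by
    rw [one_mul, mul_one, ← ofList_wsub]
    exact h1)
  rw [one_mul, mul_one, ← ofList_wsub, ← wsub_wsub] at h2
  have h3 := G.pat_of_aperiodic hx (alphaOneAperiodic.symm h2) (by
    rw [hw]
    exact Pat.refl _ _)
  classical
  -- Squaring affects only letters whose multiplicity the pattern ignores, so it can be undone.
  have h4 : Pat (G.word x) IsY (wsub squareY (wsub ρ v)) := h3
  unfold squareY at h4
  rw [pat_expand (fun c => by split_ifs <;> simp) (fun c hc => by simp [hc])] at h4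
  exact (hpat v).1 h4

end Guard

end BaseInvariance

/-! ### Repeated blocks and the pigeonhole argument. -/

section Blocks

open Letter

theorem wsub_block (θ : Letter → List Letter) (A1 A2 A3 : List Letter) (v : Letter)
    (l r : List Letter) : l ++ wsub θ (A1 ++ [v] ++ A2 ++ [v] ++ A3) ++ r =
      (l ++ wsub θ A1) ++ θ v ++ wsub θ A2 ++ θ v ++ (wsub θ A3 ++ r) := by
  simp

theorem two_le_count_of_mem_middle {θ : Letter → List Letter} {A A2 l r : List Letter}
    (h2 : ∀ v ∈ A2, 2 ≤ A.count v) {f : Letter} (hf : f ∈ wsub θ A2) :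
    2 ≤ (l ++ wsub θ A ++ r).count f := by
  obtain ⟨v, hv, hfv⟩ := mem_wsub.1 hf
  have h3 := h2 v hv
  have h4 := count_le_count_wsub hfv A
  simp only [List.count_append]
  omega

/-- The pigeonhole argument: the letters of `H` lie between the two occurrences of a block and
behind them, in images of letters from `B`; if they are separated by letters that occur once,
then there are at most as many of them as letters in `B`. -/
theorem not_mem_block_of_separated {θ : Letter → List Letter} {A1 A2 A3 l r U : List Letter}
    {v0 : Letter} (hU : U = l ++ wsub θ (A1 ++ [v0] ++ A2 ++ [v0] ++ A3) ++ r)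
    {H B : Finset Letter} (hcard : B.card < H.card) {o η : Letter} (ho : U.count o = 2)
    (hη : η ∈ U) (hηo : LastLT U η o)
    (hH : ∀ c ∈ H, FirstLT U o c ∧ FirstLT U c η ∧ LastLT U o c ∧ U.count c = 2 ∧ c ∉ θ v0)
    (hsep : ∀ c ∈ H, ∀ d ∈ H, c ≠ d → ∃ e, U.count e = 1 ∧
      ((LastLT U c e ∧ LastLT U e d) ∨ (LastLT U d e ∧ LastLT U e c)))
    (hB : ∀ v ∈ A2, v ∈ A1 ∨ 2 ≤ A2.count v ∨ (v ∈ B ∧ v ∈ A3)) : o ∉ θ v0 := by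
  intro hoW
  rw [wsub_block] at hU
  have h1 := List.count_pos_iff.2 hoW
  have ho' := ho
  rw [hU] at ho'
  simp only [List.count_append] at ho'
  have hoP : o ∉ l ++ wsub θ A1 := by
    rw [← List.count_eq_zero, List.count_append]
    omega
  have hoM : o ∉ wsub θ A2 := by
    rw [← List.count_eq_zero]
    omega
  have hoQ : o ∉ wsub θ A3 ++ r := by
    rw [← List.count_eq_zero, List.count_append]
    omega
  have key : ∀ c ∈ H, c ∉ l ++ wsub θ A1 ∧ c ∈ wsub θ A2 ∧ c ∈ wsub θ A3 ++ r := by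
    intro c hc
    obtain ⟨h1, h2, h3, h4, h5⟩ := hH c hc
    rw [hU] at h1 h2 h3 hηo hη
    have hcP : c ∉ l ++ wsub θ A1 := by
      have h1' : FirstLT ((l ++ wsub θ A1) ++
          (θ v0 ++ (wsub θ A2 ++ (θ v0 ++ (wsub θ A3 ++ r))))) o c := by
        simpa only [List.append_assoc] using h1
      exact h1'.not_mem_left hoP
    refine ⟨hcP, ?_, ?_⟩
    · by_contra hcM
      have hcA : c ∉ (l ++ wsub θ A1) ++ θ v0 ++ wsub θ A2 ++ θ v0 := by
        simp only [List.mem_append] at hcP ⊢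
        tauto
      have hη1 := h2.not_mem_left hcA
      have hη2 := hηo.not_mem_right hoQ
      exact (List.mem_append.1 hη).elim hη1 hη2
    · by_contra hcQ
      exact (h3.left hcQ).not_mem_right h5 hoW
  -- The letter of `A2` whose image contains `c` is not in `A1`, as `c` does not occur before the
  -- first block. It is not repeated in `A2` either, since `c` occurs twice in all and once behind
  -- the blocks.
  have hex : ∀ c ∈ H, ∃ v ∈ B, v ∈ A3 ∧ v ∈ A2 ∧ c ∈ θ v := by
    intro c hc
    obtain ⟨hP, hM, hQ⟩ := key c hc
    have h4 := (hH c hc).2.2.2.1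
    obtain ⟨v, hv, hcv⟩ := mem_wsub.1 hM
    rcases hB v hv with h | h | h
    · exact absurd (List.mem_append_right _ (mem_wsub.2 ⟨v, h, hcv⟩)) hP
    · have h5 := count_le_count_wsub hcv A2
      have h6 := List.count_pos_iff.2 hQ
      rw [hU, List.count_append, List.count_append, List.count_append] at h4
      omega
    · exact ⟨v, h.1, h.2, hv, hcv⟩
  choose! f hfB hf3 hf2 hfm using hex
  obtain ⟨c, hc, d, hd, hcd, hfcd⟩ := Finset.exists_ne_map_eq_of_card_lt_of_maps_to hcard hfB
  -- If `c` and `d` come from the same letter, their last occurrences force the separator `e` into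
  -- the image of that letter. This image occurs in both `A2` and `A3`, so `e` is not linear.
  have main : ∀ c d e, c ∈ H → d ∈ H → f c = f d → U.count e = 1 → LastLT U c e → LastLT U e d →
      False := by
    intro c d e hc hd hfcd he h1 h2
    have hdv : d ∈ θ (f c) := hfcd ▸ hfm d hd
    obtain ⟨A3a, A3b, hA3⟩ := List.append_of_mem (hf3 c hc)
    have hd2 := (hH d hd).2.2.2.1
    have hdc := List.count_pos_iff.2 hdv
    have hdM := List.count_pos_iff.2 (key d hd).2.1
    set V := θ (f c) with hV
    have hU' : U = (l ++ wsub θ A1 ++ θ v0 ++ wsub θ A2 ++ θ v0 ++ wsub θ A3a ++ V) ++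
        (wsub θ A3b ++ r) := by
      rw [hU, hA3]
      simp [hV]
    have hdQ : d ∉ wsub θ A3b ++ r := by
      rw [← List.count_eq_zero]
      rw [hU'] at hd2
      simp only [List.count_append] at hd2 ⊢
      omega
    rw [hU'] at h1 h2
    have heQ := h2.not_mem_right hdQ
    have heV : e ∈ V := by
      by_contra heV
      exact (h1.left heQ).not_mem_right heV (hfm c hc)
    have heM : e ∈ wsub θ A2 := mem_wsub.2 ⟨f c, hf2 c hc, heV⟩
    have n1 := List.count_pos_iff.2 heV
    have n2 := List.count_pos_iff.2 heM
    rw [hU'] at he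
    simp only [List.count_append] at he
    omega
  obtain ⟨e, he, ⟨h1, h2⟩ | ⟨h1, h2⟩⟩ := hsep c hc d hd hcd
  · exact main c d e hc hd hfcd he h1 h2
  · exact main d c e hd hc hfcd.symm he h1 h2

/-! ### Frames, the pattern `Left`, and the blocks that may be doubled in it. -/

/-- The data that determine the words witnessing nondistributivity. -/
structure Frame where
  G : Guard
  ξ : Letter
  ξ' : Letter
  m : ℕ
  n : ℕ
  outer : Guard.Outer ξ
  outer' : Guard.Outer ξ'
  ne : ξ ≠ ξ'
  m_not : m ∉ G.I ∧ m ∉ G.J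
  n_not : n ∉ G.I ∧ n ∉ G.J
  m_ne_n : m ≠ n

namespace Frame

/-- The frame read backwards. -/
def rev (F : Frame) : Frame where
  G := F.G.rev
  ξ := F.ξ'
  ξ' := F.ξ
  m := F.n
  n := F.m
  outer := F.outer'
  outer' := F.outer
  ne := F.ne.symm
  m_not := by simpa [Guard.rev] using F.n_not.symm
  n_not := by simpa [Guard.rev] using F.m_not.symm
  m_ne_n := F.m_ne_n.symm

variable (F : Frame)

/-- The first index of the second half. -/
def j0 : ℕ := F.G.J.headI

theorem J_eq : F.G.J = F.j0 :: F.G.J.tail := by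
  unfold j0
  have := List.ne_nil_of_mem F.G.κ_mem
  cases h : F.G.J with
  | nil => exact absurd h this
  | cons a J => rfl

theorem j0_mem : F.j0 ∈ F.G.J := by
  rw [J_eq]
  exact List.mem_cons_self

/-- The pattern in which the outer letter `ξ` precedes the first occurrence of `z n`. -/
def Left (u : List Letter) : Prop :=
  Pat (F.G.word F.ξ) IsY u ∧ PatSquare (z F.n) (y F.G.h) (t F.n) u ∧ PatPower F.ξ (t F.n) u ∧
    ¬ PatSquare (z F.n) F.ξ (t F.n) u ∧ PatSquare (z F.n) F.ξ' (t F.n) u ∧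
    PatPower (z F.n) (t F.j0) u

/-- Each clause is a preserved pattern or the negation of one; negation is harmless as `R` is
symmetric. -/
theorem preserves_left {R : List Letter → List Letter → Prop} (hR : ClosedRel R)
    (hp : Preserves R (Pat (F.G.word F.ξ) IsY)) : Preserves R F.Left := by
  have hz : ∀ ξ, Guard.Outer ξ → z F.n ≠ ξ := fun ξ h => (h.ne_z _).symm
  have hzt : z F.n ≠ t F.n := by simp
  exact hp.and ((F.G.preserves_patSquare hR F.outer hp (by simp) hzt (by simp)).and
    ((F.G.preserves_patPower hR F.outer hp (F.outer.ne_t _)).and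
    (((F.G.preserves_patSquare hR F.outer hp (hz _ F.outer) hzt (F.outer.ne_t _)).not hR).and
    ((F.G.preserves_patSquare hR F.outer hp (hz _ F.outer') hzt (F.outer'.ne_t _)).and
    (F.G.preserves_patPower hR F.outer hp (by simp))))))

/-- The orders of occurrences that make up the pattern `Left`. -/
structure LeftOrders (u : List Letter) : Prop where
  pat : Pat (F.G.word F.ξ) IsY u
  first_outer : FirstLT u F.ξ (z F.n)
  first_yh : FirstLT u (z F.n) (y F.G.h)
  first_outer' : FirstLT u (z F.n) F.ξ'
  first_t : FirstLT u (z F.n) (t F.n)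
  last_yh : LastLT u (y F.G.h) (t F.n)
  last_outer : LastLT u F.ξ (t F.n)
  last_outer' : LastLT u F.ξ' (t F.n)
  last_t : LastLT u (t F.n) (z F.n)
  last_head : LastLT u (z F.n) (t F.j0)
  first_head : FirstLT u (z F.n) (t F.j0)
  yh_t : FirstLT u (y F.G.h) (t F.n)
  outer_t' : FirstLT u F.ξ' (t F.n)
  count_z : u.count (z F.n) = 2
  count_t : u.count (t F.n) = 1

theorem left_iff (u : List Letter) : F.Left u ↔ F.LeftOrders u := by
  have h1 : z F.n ≠ F.ξ := (F.outer.ne_z _).symm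
  have h2 : z F.n ≠ F.ξ' := (F.outer'.ne_z _).symm
  have h3 : F.ξ ≠ t F.n := F.outer.ne_t _
  have h4 : F.ξ' ≠ t F.n := F.outer'.ne_t _
  have hcount : ∀ u, Pat (F.G.word F.ξ) IsY u → u.count (t F.j0) = 1 := fun u hu =>
    F.G.pat_count_t hu F.outer (Or.inr F.j0_mem)
  unfold Left
  rw [patSquare_iff (by simp) (by simp) (by simp), patSquare_iff h1 (by simp) h3,
    patSquare_iff h2 (by simp) h4, patPower_iff h3, patPower_iff (by simp)]
  constructor
  · rintro ⟨p, ⟨a1, a2, a3, a4, a5, a6, a7, a8⟩, ⟨b1, b2, -⟩, hn, ⟨c1, c2, c3, c4, c5, c6, -, -⟩,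
      ⟨d1, d2, -⟩⟩
    refine ⟨p, ?_, a1, c1, a2, a4, b2, c4, a6, d2, d1, a3, c3, a7, a8⟩
    -- The other clauses supply everything in the negated pattern except that `z n` first occurs
    -- before `ξ`; so the negation says that `ξ` comes first.
    rcases FirstLT.total (d := F.ξ) a1.mem with h | h
    · exact absurd ⟨h, a2, b1, b2, b2.trans a6, a6, a7, a8⟩ hn
    · exact h
  · intro h
    exact ⟨h.pat, ⟨h.first_yh, h.first_t, h.yh_t, h.last_yh, h.last_yh.trans h.last_t, h.last_t,
      h.count_z, h.count_t⟩, ⟨h.first_outer.trans h.first_t, h.last_outer, h.count_t⟩,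
      fun h' => (h.first_outer.asymm h1.symm) h'.1,
      ⟨h.first_outer', h.first_t, h.outer_t', h.last_outer', h.last_outer'.trans h.last_t, h.last_t,
        h.count_z, h.count_t⟩, ⟨h.first_head, h.last_head, hcount u h.pat⟩⟩

/-- The letters of the pattern that must keep their number of occurrences are not in `W`. -/
def Avoids (W : List Letter) : Prop :=
  ∀ c ∈ W, (c ∈ F.G.word F.ξ → IsY c) ∧ c ≠ z F.n ∧ c ≠ t F.n

variable {F}

theorem left_doubleAt {θ : Letter → List Letter} {v : Letter} (h : F.Avoids (θ v))
    (l r A : List Letter) :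
    F.Left (l ++ wsub (doubleAt θ v) A ++ r) ↔ F.Left (l ++ wsub θ A ++ r) := by
  have hsq : ∀ e, PatSquare (z F.n) e (t F.n) (l ++ wsub (doubleAt θ v) A ++ r) ↔
      PatSquare (z F.n) e (t F.n) (l ++ wsub θ A ++ r) := by
    intro e
    refine pat_doubleAt ?_ l r A
    intro c hc hcW
    have := h c hcW
    simp only [List.mem_cons, List.not_mem_nil, or_false] at hc
    tauto
  unfold Left
  rw [hsq, hsq, hsq, pat_doubleAt (fun c hc hcW => (h c hcW).1 hc)]
  have h1 : PatPower F.ξ (t F.n) (l ++ wsub (doubleAt θ v) A ++ r) ↔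
      PatPower F.ξ (t F.n) (l ++ wsub θ A ++ r) := by
    refine pat_doubleAt ?_ l r A
    intro c hc hcW
    have := h c hcW
    simp only [List.mem_cons, List.not_mem_nil, or_false] at hc
    tauto
  have h2 : PatPower (z F.n) (t F.j0) (l ++ wsub (doubleAt θ v) A ++ r) ↔
      PatPower (z F.n) (t F.j0) (l ++ wsub θ A ++ r) := by
    refine pat_doubleAt ?_ l r A
    intro c hc hcW
    have h3 := (h c hcW).1
    simp only [List.mem_cons, List.not_mem_nil, or_false] at hc
    rcases hc with rfl | rfl
    · rfl
    · exact absurd (h3 (F.G.t_mem_word (Or.inr F.j0_mem))) (Guard.not_isY_t _)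
  rw [h1, h2]

/-- If a word with a doubled block has the pattern, then the block avoids the rigid letters. -/
theorem LeftOrders.avoids_of_double {θ : Letter → List Letter} {v : Letter} {l r A : List Letter}
    (h : F.LeftOrders (l ++ wsub (doubleAt θ v) A ++ r)) (hv : 2 ≤ A.count v) :
    F.Avoids (θ v) := by
  intro c hc
  -- Two occurrences of `v`, each doubled, give four occurrences of `c`, whereas rigid letters occur
  -- at most twice.
  have h4 : 4 ≤ (l ++ wsub (doubleAt θ v) A ++ r).count c := by
    have : 4 ≤ (wsub (doubleAt θ v) A).count c := by
      have hpos := List.count_pos_iff.2 hc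
      clear h
      have : ∀ A : List Letter, 2 * A.count v ≤ (wsub (doubleAt θ v) A).count c := by
        intro A
        induction A with
        | nil => simp
        | cons e A ih =>
          rw [wsub_cons, List.count_append, List.count_cons]
          by_cases he : e = v
          · subst he
            simp only [doubleAt, if_true, List.count_append, beq_self_eq_true]
            have h5 : (wsub (fun c => if c = e then θ c ++ θ c else θ c) A) =
              wsub (doubleAt θ e) A := rfl
            omega
          · simp only [beq_iff_eq, he, if_false]
            omega
      have := this A
      omega
    simp only [List.count_append]
    omega
  refine ⟨fun hcw => ?_, ?_, ?_⟩
  · by_contra hY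
    have h1 := h.pat.cnt c hcw hY
    have h2 := F.G.count_word_le_two F.outer hY
    omega
  · rintro rfl
    have := h.count_z
    omega
  · rintro rfl
    have := h.count_t
    omega

section

variable {θ : Letter → List Letter} {A1 A2 A3 l r U : List Letter} {v0 : Letter}
  (h : F.LeftOrders U) (hU : U = l ++ wsub θ (A1 ++ [v0] ++ A2 ++ [v0] ++ A3) ++ r)
  (h2 : ∀ v ∈ A2, 2 ≤ (A1 ++ [v0] ++ A2 ++ [v0] ++ A3).count v)
include h hU h2

theorem LeftOrders.not_mem_block : (∀ j, j ∈ F.G.I ∨ j ∈ F.G.J → z j ∉ θ v0 ∧ t j ∉ θ v0) ∧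
    z F.n ∉ θ v0 ∧ t F.n ∉ θ v0 := by
  have hM : ∀ f ∈ wsub θ A2, 2 ≤ U.count f := by
    intro f hf
    rw [hU]
    exact two_le_count_of_mem_middle h2 hf
  rw [wsub_block] at hU
  refine ⟨fun j hj => ⟨F.G.z_not_mem_block h.pat F.outer hU hM hj,
    F.G.t_not_mem_block h.pat F.outer hU hj⟩,
    not_mem_of_surrounds hU h.count_z h.count_t h.first_t h.last_t hM, ?_⟩
  intro hm
  have h1 := h.count_t
  have h3 := List.count_pos_iff.2 hm
  rw [hU] at h1
  simp only [List.count_append] at h1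
  omega

omit hU h2 in
theorem LeftOrders.mem_yh : y F.G.h ∈ U := h.pat.mem _ (F.G.yh_mem_word _)

omit hU h2 in
theorem LeftOrders.last_yh_outer : LastLT U (y F.G.h) F.ξ :=
  h.pat.last _ (F.G.yh_mem_word _) _ (F.G.outer_mem_word _) (F.outer.ne_y F.G.h_ne).symm
    (fun h => F.outer.not_isY h.2) (F.G.last_y_outer F.outer (Guard.isY_y F.G.h_ne))

omit hU h2 in
theorem LeftOrders.orders_z {j : ℕ} (hj : j ∈ F.G.J) : FirstLT U F.ξ (z j) ∧
    FirstLT U (z j) (y F.G.h) ∧ LastLT U F.ξ (z j) ∧ U.count (z j) = 2 := by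
  have hz := F.G.z_mem_word (ξ := F.ξ) (Or.inr hj)
  have ho := F.G.outer_mem_word F.ξ
  exact ⟨h.pat.first _ ho _ hz (F.outer.ne_z _) (fun h => Guard.not_isY_z _ h.2)
      (F.G.first_outer_z F.outer hj),
    h.pat.first _ hz _ (F.G.yh_mem_word _) (by simp) (fun h => Guard.not_isY_z _ h.1)
      (F.G.first_z_yh F.outer hj),
    h.pat.last _ ho _ hz (F.outer.ne_z _) (fun h => Guard.not_isY_z _ h.2)
      (F.G.last_outer_z F.outer hj), F.G.pat_count_z h.pat F.outer (Or.inr hj)⟩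

omit hU h2 in
theorem LeftOrders.last_t_z {j : ℕ} (hj : j ∈ F.G.J) : LastLT U (t F.j0) (z j) :=
  h.pat.last _ (F.G.t_mem_word (Or.inr F.j0_mem)) _ (F.G.z_mem_word (Or.inr hj)) (by simp)
    (fun h => Guard.not_isY_z _ h.2) (F.G.last_head_t_z F.J_eq hj)

omit hU h2 in
theorem LeftOrders.separated {i j : ℕ} (hi : i ∈ F.G.J) (hj : j ∈ F.G.J) (hij : i ≠ j) :
    ∃ e, U.count e = 1 ∧ ((LastLT U (z i) e ∧ LastLT U e (z j)) ∨
      (LastLT U (z j) e ∧ LastLT U e (z i))) := by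
  have key : ∀ {i j J1 J2}, F.G.J = J1 ++ i :: J2 → j ∈ J2 →
      LastLT U (z i) (t j) ∧ LastLT U (t j) (z j) := by
    intro i j J1 J2 hJ hj
    have hi' : i ∈ F.G.J := by simp [hJ]
    have hj' : j ∈ F.G.J := by simp [hJ, hj]
    exact ⟨h.pat.last _ (F.G.z_mem_word (Or.inr hi')) _ (F.G.t_mem_word (Or.inr hj')) (by simp)
        (fun h => Guard.not_isY_t _ h.2) (F.G.last_separated hJ hj),
      h.pat.last _ (F.G.t_mem_word (Or.inr hj')) _ (F.G.z_mem_word (Or.inr hj')) (by simp)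
        (fun h => Guard.not_isY_t _ h.1) (F.G.last_t_z hj')⟩
  obtain ⟨J1, J2, hJ⟩ := List.append_of_mem hi
  have hj' := hj
  rw [hJ, List.mem_append, List.mem_cons] at hj'
  rcases hj' with hj' | hj' | hj'
  · obtain ⟨J3, J4, hJ'⟩ := List.append_of_mem hj'
    refine ⟨t i, F.G.pat_count_t h.pat F.outer (Or.inr hi), Or.inr (key (J1 := J3)
      (J2 := J4 ++ i :: J2) ?_ (by simp))⟩
    rw [hJ, hJ']
    simp
  · exact absurd hj'.symm hij
  · exact ⟨t j, F.G.pat_count_t h.pat F.outer (Or.inr hj), Or.inl (key hJ hj')⟩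

/-- Pigeonhole with `z n` and all `z j`, `j ∈ J`, against the `z j` alone. The letter `z n` is the
surplus one; its last occurrence precedes the linear `t j0`, which precedes all last occurrences of
the `z j`. -/
theorem LeftOrders.outer_not_mem_block
    (hB : ∀ v ∈ A2, v ∈ A1 ∨ 2 ≤ A2.count v ∨ ∃ j ∈ F.G.J, v = z j ∧ v ∈ A3) :
    F.ξ ∉ θ v0 := by
  obtain ⟨b1, b2, b3⟩ := h.not_mem_block hU h2
  have hn : z F.n ∉ F.G.J.toFinset.image z := by simpa using F.n_not.2
  refine not_mem_block_of_separated hU (H := insert (z F.n) (F.G.J.toFinset.image z))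
    (B := F.G.J.toFinset.image z) (by rw [Finset.card_insert_of_notMem hn]; omega)
    (F.G.pat_count_outer h.pat F.outer) h.mem_yh h.last_yh_outer ?_ ?_ ?_
  · intro c hc
    simp only [Finset.mem_insert, Finset.mem_image, List.mem_toFinset] at hc
    rcases hc with rfl | ⟨j, hj, rfl⟩
    · exact ⟨h.first_outer, h.first_yh, h.last_outer.trans h.last_t, h.count_z, b2⟩
    · obtain ⟨o1, o2, o3, o4⟩ := h.orders_z hj
      exact ⟨o1, o2, o3, o4, (b1 j (Or.inr hj)).1⟩
  · intro c hc d hd hcd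
    simp only [Finset.mem_insert, Finset.mem_image, List.mem_toFinset] at hc hd
    have ht := F.G.pat_count_t h.pat F.outer (Or.inr F.j0_mem)
    rcases hc with rfl | ⟨i, hi, rfl⟩ <;> rcases hd with rfl | ⟨j, hj, rfl⟩
    · exact absurd rfl hcd
    · exact ⟨_, ht, Or.inl ⟨h.last_head, h.last_t_z hj⟩⟩
    · exact ⟨_, ht, Or.inr ⟨h.last_head, h.last_t_z hi⟩⟩
    · exact h.separated hi hj (fun h => hcd (by rw [h]))
  · intro v hv
    rcases hB v hv with h | h | ⟨j, hj, rfl, h⟩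
    · exact Or.inl h
    · exact Or.inr (Or.inl h)
    · exact Or.inr (Or.inr ⟨by simpa using hj, h⟩)

theorem LeftOrders.avoids
    (hB : ∀ v ∈ A2, v ∈ A1 ∨ 2 ≤ A2.count v ∨ ∃ j ∈ F.G.J, v = z j ∧ v ∈ A3) :
    F.Avoids (θ v0) := by
  obtain ⟨b1, b2, b3⟩ := h.not_mem_block hU h2
  have b4 := h.outer_not_mem_block hU h2 hB
  intro c hc
  refine ⟨fun hcw => ?_, fun h => b2 (h ▸ hc), fun h => b3 (h ▸ hc)⟩
  rcases F.G.mem_word_cases hcw with rfl | ⟨j, hj, rfl | rfl⟩ | h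
  · exact absurd hc b4
  · exact absurd hc (b1 j hj).1
  · exact absurd hc (b1 j hj).2
  · exact h

/-- If the other outer letter lies between the outer letters, it serves as a further
separated letter. -/
theorem LeftOrders.avoids_of_outer' (h1 : FirstLT U F.ξ' (y F.G.h)) (h3 : LastLT U F.ξ F.ξ')
    (h4 : U.count F.ξ' = 2) (h5 : F.ξ' ∉ θ v0)
    (hB : ∀ v ∈ A2, v ∈ A1 ∨ 2 ≤ A2.count v ∨
      ((v = z F.n ∨ ∃ j ∈ F.G.J, v = z j) ∧ v ∈ A3)) :
    F.Avoids (θ v0) := by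
  obtain ⟨b1, b2, b3⟩ := h.not_mem_block hU h2
  have hn : F.ξ' ∉ insert (z F.n) (F.G.J.toFinset.image z) := by
    simp only [Finset.mem_insert, Finset.mem_image, List.mem_toFinset, not_or, not_exists]
    exact ⟨F.outer'.ne_z _, fun j hj => F.outer'.ne_z _ hj.2.symm⟩
  have b4 : F.ξ ∉ θ v0 := by
    -- Now `z n` may itself produce letters, so `ξ'` supplies the surplus; `t n` separates it from
    -- `z n` and from every `z j`.
    refine not_mem_block_of_separated hU
      (H := insert F.ξ' (insert (z F.n) (F.G.J.toFinset.image z)))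
      (B := insert (z F.n) (F.G.J.toFinset.image z))
      (by rw [Finset.card_insert_of_notMem hn]; omega)
      (F.G.pat_count_outer h.pat F.outer) h.mem_yh h.last_yh_outer ?_ ?_ ?_
    · intro c hc
      simp only [Finset.mem_insert, Finset.mem_image, List.mem_toFinset] at hc
      rcases hc with rfl | rfl | ⟨j, hj, rfl⟩
      · exact ⟨h.first_outer.trans h.first_outer', h1, h3, h4, h5⟩
      · exact ⟨h.first_outer, h.first_yh, h.last_outer.trans h.last_t, h.count_z, b2⟩
      · obtain ⟨o1, o2, o3, o4⟩ := h.orders_z hj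
        exact ⟨o1, o2, o3, o4, (b1 j (Or.inr hj)).1⟩
    · intro c hc d hd hcd
      simp only [Finset.mem_insert, Finset.mem_image, List.mem_toFinset] at hc hd
      have ht := F.G.pat_count_t h.pat F.outer (Or.inr F.j0_mem)
      have hs : ∀ {j}, j ∈ F.G.J → LastLT U (t F.n) (z j) := fun hj =>
        h.last_t.trans (h.last_head.trans (h.last_t_z hj))
      rcases hc with rfl | rfl | ⟨i, hi, rfl⟩ <;> rcases hd with rfl | rfl | ⟨j, hj, rfl⟩
      · exact absurd rfl hcd
      · exact ⟨_, h.count_t, Or.inl ⟨h.last_outer', h.last_t⟩⟩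
      · exact ⟨_, h.count_t, Or.inl ⟨h.last_outer', hs hj⟩⟩
      · exact ⟨_, h.count_t, Or.inr ⟨h.last_outer', h.last_t⟩⟩
      · exact absurd rfl hcd
      · exact ⟨_, ht, Or.inl ⟨h.last_head, h.last_t_z hj⟩⟩
      · exact ⟨_, h.count_t, Or.inr ⟨h.last_outer', hs hi⟩⟩
      · exact ⟨_, ht, Or.inr ⟨h.last_head, h.last_t_z hi⟩⟩
      · exact h.separated hi hj (fun h => hcd (by rw [h]))
    · intro v hv
      rcases hB v hv with h | h | ⟨rfl | ⟨j, hj, rfl⟩, h⟩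
      · exact Or.inl h
      · exact Or.inr (Or.inl h)
      · exact Or.inr (Or.inr ⟨by simp, h⟩)
      · exact Or.inr (Or.inr ⟨by simp [hj], h⟩)
  intro c hc
  refine ⟨fun hcw => ?_, fun h => b2 (h ▸ hc), fun h => b3 (h ▸ hc)⟩
  rcases F.G.mem_word_cases hcw with rfl | ⟨j, hj, rfl | rfl⟩ | h
  · exact absurd hc b4
  · exact absurd hc (b1 j hj).1
  · exact absurd hc (b1 j hj).2
  · exact h

end

end Frame

end Blocks

/-! ### The four witness words and stability of `Left`, of `Right` and of their conjunction. -/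

section FrameWords

open Letter FreeMonoid

theorem wsub_doubleAt_of_not_mem (θ : Letter → List Letter) {v : Letter} {u : List Letter}
    (h : v ∉ u) : wsub (doubleAt θ v) u = wsub θ u :=
  wsub_congr fun c hc => by
    have : c ≠ v := fun h' => h (h' ▸ hc)
    simp [doubleAt, this]

theorem Guard.two_le_count_core (G : Guard) {c : Letter} (hc : c ∈ G.core) (hY : IsY c) :
    2 ≤ G.core.count c := by
  obtain ⟨i, _, rfl⟩ := hY
  simp only [Guard.core, List.mem_append, List.mem_cons, List.not_mem_nil, or_false] at hc
  simp only [Guard.core, List.count_append]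
  rcases hc with (hc | hc) | hc
  · rcases G.CF_mem _ hc with ⟨j, _, h⟩ | ⟨j, _, _, h, h2⟩
    · cases h
    · omega
  · have : i = G.h := by
      rcases hc with h | h <;> exact Letter.y.inj h
    subst this
    simp
    omega
  · rcases G.CL_mem _ hc with ⟨j, _, h⟩ | ⟨j, _, _, h, h2⟩
    · cases h
    · omega

namespace Frame

variable (F : Frame)

/-- The word of the frame, with blocks `X` and `X'` for the two outer letters. -/
def gen (X X' : List Letter) : List Letter :=
  F.G.pre ++ [z F.m, t F.m] ++ X ++ [z F.n] ++ X' ++ F.G.core ++ X ++ [z F.m] ++ X' ++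
    [t F.n, z F.n] ++ F.G.suf

theorem gen_reverse (X X' : List Letter) :
    (F.gen X X').reverse = F.rev.gen X'.reverse X.reverse := by
  simp [gen, rev, Guard.rev_pre, Guard.rev_suf, Guard.rev_core]

theorem wsub_gen (θ : Letter → List Letter) {v : Letter} (h : v = F.ξ ∨ v = F.ξ')
    (X X' : List Letter) : wsub (doubleAt θ v) (F.gen X X') =
      wsub θ (F.gen (wsub (doubleAt (fun c => [c]) v) X) (wsub (doubleAt (fun c => [c]) v) X')) := by
  have hv : Guard.Outer v := by
    rcases h with rfl | rfl
    · exact F.outer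
    · exact F.outer'
  have key : ∀ X, wsub θ (wsub (doubleAt (fun c => [c]) v) X) = wsub (doubleAt θ v) X := by
    intro X
    rw [wsub_wsub]
    refine wsub_congr fun c _ => ?_
    unfold doubleAt
    split_ifs <;> simp
  simp only [gen, wsub_append, key, wsub_doubleAt_of_not_mem θ (F.G.outer_not_mem_pre hv),
    wsub_doubleAt_of_not_mem θ (F.G.outer_not_mem_suf hv),
    wsub_doubleAt_of_not_mem θ (F.G.outer_not_mem_core hv)]
  have hz : ∀ i, z i ≠ v := fun i => (hv.ne_z i).symm
  have ht : ∀ i, t i ≠ v := fun i => (hv.ne_t i).symm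
  simp [doubleAt, hz, ht]

theorem wsub_gen_outer (θ : Letter → List Letter) (X' : List Letter) (h : F.ξ ∉ X') :
    wsub (doubleAt θ F.ξ) (F.gen [F.ξ] X') = wsub θ (F.gen [F.ξ, F.ξ] X') := by
  rw [F.wsub_gen θ (Or.inl rfl), wsub_doubleAt_of_not_mem _ h, wsub_id]
  simp [doubleAt]

theorem wsub_gen_outer' (θ : Letter → List Letter) (X : List Letter) (h : F.ξ' ∉ X) :
    wsub (doubleAt θ F.ξ') (F.gen X [F.ξ']) = wsub θ (F.gen X [F.ξ', F.ξ']) := by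
  rw [F.wsub_gen θ (Or.inr rfl), wsub_doubleAt_of_not_mem _ h, wsub_id]
  simp [doubleAt]

theorem outer'_not_mem_word : F.ξ' ∉ F.G.word F.ξ := by
  intro h
  rcases F.G.mem_word_cases h with h | ⟨j, _, h | h⟩ | h
  · exact F.ne h.symm
  · exact F.outer'.ne_z _ h
  · exact F.outer'.ne_t _ h
  · exact F.outer'.not_isY h

theorem index_not_mem_word {i : ℕ} (h : i ∉ F.G.I ∧ i ∉ F.G.J) :
    z i ∉ F.G.word F.ξ ∧ t i ∉ F.G.word F.ξ := by
  constructor <;> intro h'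
  · rcases F.G.mem_word_cases h' with h' | ⟨j, hj, h' | h'⟩ | h'
    · exact F.outer.ne_z _ h'.symm
    · cases h'
      tauto
    · cases h'
    · exact Guard.not_isY_z _ h'
  · rcases F.G.mem_word_cases h' with h' | ⟨j, hj, h' | h'⟩ | h'
    · exact F.outer.ne_t _ h'.symm
    · cases h'
    · cases h'
      tauto
    · exact Guard.not_isY_t _ h'

/-- Erasing the letters foreign to the guard word with outer letter `ξ` leaves exactly that guard
word. -/
theorem pat_gen : Pat (F.G.word F.ξ) IsY (F.gen [F.ξ] [F.ξ']) := by
  have hmap := pat_map (b := F.G.word F.ξ) (f := id) (D := IsY) (D' := IsY)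
    (fun _ _ _ _ h => h) (fun _ _ => Iff.rfl) (F.gen [F.ξ] [F.ξ'])
  rw [List.map_id] at hmap
  refine hmap.1 ?_
  have key : ∀ w, (∀ c ∈ w, c ∈ F.G.word F.ξ) →
      wsub (fun c => if c ∈ F.G.word F.ξ then [id c] else []) w = w := by
    intro w hw
    refine (wsub_congr (τ := fun c => [c]) fun c hc => ?_).trans (wsub_id w)
    simp [hw c hc]
  have h1 := key F.G.pre fun c hc => by simp [Guard.mem_word, hc]
  have h2 := key F.G.core fun c hc => by simp [Guard.mem_word, hc]
  have h3 := key F.G.suf fun c hc => by simp [Guard.mem_word, hc]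
  have h4 := F.index_not_mem_word F.m_not
  have h5 := F.index_not_mem_word F.n_not
  have : wsub (fun c => if c ∈ F.G.word F.ξ then [id c] else []) (F.gen [F.ξ] [F.ξ']) =
      F.G.word F.ξ := by
    simp only [gen, wsub_append, h1, h2, h3]
    simp only [wsub_cons, wsub_nil, h4, h5, F.outer'_not_mem_word, F.G.outer_mem_word F.ξ, if_true,
      if_false, id, List.append_nil]
    simp [Guard.word]
  rw [this]
  exact Pat.refl _ _

theorem leftOrders_gen : F.LeftOrders (F.gen [F.ξ] [F.ξ']) := by
  have o1 := F.outer.ne_z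
  have o2 := F.outer.ne_t
  have o3 := F.outer'.ne_z
  have o4 := F.outer'.ne_t
  have o5 := F.outer.ne_y F.G.h_ne
  have o6 := F.outer'.ne_y F.G.h_ne
  have zt : ∀ i j, z i ≠ t j := by simp
  have hm := F.m_not
  have hn := F.n_not
  have hmn := F.m_ne_n
  have hj := F.j0_mem
  have hjI : F.j0 ∉ F.G.I := fun h => F.G.disjoint h hj rfl
  have hjm : F.j0 ≠ F.m := fun h => hm.2 (h ▸ hj)
  have hzc : ∀ i, i ∉ F.G.I ∧ i ∉ F.G.J → z i ∉ F.G.core := by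
    intro i hi h
    rcases F.G.mem_core h with ⟨j, hj, h⟩ | h
    · cases h
      tauto
    · exact Guard.not_isY_z _ h
  have htc : ∀ i, t i ∉ F.G.core := by
    intro i h
    rcases F.G.mem_core h with ⟨j, hj, h⟩ | h
    · cases h
    · exact Guard.not_isY_t _ h
  have hyc : y F.G.h ∈ F.G.core := by simp [Guard.core]
  have first : ∀ c, c ∉ F.G.pre ++ [z F.m, t F.m, F.ξ, z F.n] →
      FirstLT (F.gen [F.ξ] [F.ξ']) (z F.n) c := by
    intro c hc
    have := firstLT_split (p := F.G.pre ++ [z F.m, t F.m, F.ξ, z F.n])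
      (q := [F.ξ'] ++ F.G.core ++ [F.ξ, z F.m, F.ξ', t F.n, z F.n] ++ F.G.suf) (c := z F.n)
      (d := c) (by simp) hc
    simpa [gen] using this
  have last : ∀ c, c ∉ [t F.n, z F.n] ++ F.G.suf → LastLT (F.gen [F.ξ] [F.ξ']) c (t F.n) := by
    intro c hc
    have := lastLT_split (p := F.G.pre ++ [z F.m, t F.m, F.ξ, z F.n, F.ξ'] ++ F.G.core ++
      [F.ξ, z F.m, F.ξ']) (q := [t F.n, z F.n] ++ F.G.suf) (c := c) (d := t F.n) hc (by simp)
    simpa [gen] using this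
  have before : ∀ c, c ∈ [F.ξ'] ++ F.G.core → FirstLT (F.gen [F.ξ] [F.ξ']) c (t F.n) := by
    intro c hc
    have := firstLT_split (p := F.G.pre ++ [z F.m, t F.m, F.ξ, z F.n] ++ ([F.ξ'] ++ F.G.core) ++
      [F.ξ, z F.m, F.ξ']) (q := [t F.n, z F.n] ++ F.G.suf) (c := c) (d := t F.n)
      (List.mem_append_left _ (List.mem_append_right _ hc))
      (by simp [Guard.t_mem_pre, hn, htc, (o2 _).symm, (o4 _).symm, hmn.symm])
    simpa [gen] using this
  refine ⟨F.pat_gen, ?_, first _ ?_, first _ ?_, first _ ?_, last _ ?_, last _ ?_, last _ ?_, ?_,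
    ?_, first _ ?_, before _ ?_, before _ ?_, ?_, ?_⟩
  · have := firstLT_split (p := F.G.pre ++ [z F.m, t F.m, F.ξ])
      (q := [z F.n, F.ξ'] ++ F.G.core ++ [F.ξ, z F.m, F.ξ', t F.n, z F.n] ++ F.G.suf) (c := F.ξ)
      (d := z F.n) (by simp) (by simp [Guard.z_mem_pre, hn, hmn.symm, (o1 _).symm])
    simpa [gen] using this
  · simp [Guard.y_not_mem_pre, o5.symm]
  · simp [F.G.outer_not_mem_pre F.outer', o3, o4, F.ne.symm]
  · simp [Guard.t_mem_pre, hn, hmn.symm, (o2 _).symm]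
  · simp [Guard.y_not_mem_suf]
  · simp [F.G.outer_not_mem_suf F.outer, o1, o2]
  · simp [F.G.outer_not_mem_suf F.outer', o3, o4]
  · have := lastLT_split (p := F.G.pre ++ [z F.m, t F.m, F.ξ, z F.n, F.ξ'] ++ F.G.core ++
      [F.ξ, z F.m, F.ξ', t F.n]) (q := [z F.n] ++ F.G.suf) (c := t F.n) (d := z F.n)
      (by simp [Guard.t_mem_suf, hn]) (by simp)
    simpa [gen] using this
  · exact lastLT_split (by simp [Guard.z_mem_suf, hn]) (by simp [Guard.t_mem_suf, hj])
  · simp [Guard.t_mem_pre, hjI, hjm, (o2 _).symm]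
  · simp [hyc]
  · simp
  · simp [gen, (F.G.count_pre _).1, (F.G.count_suf _).1, List.count_eq_zero_of_not_mem hn.1,
      List.count_eq_zero_of_not_mem hn.2, List.count_eq_zero_of_not_mem (hzc _ hn), o1, o3, hmn]
  · simp [gen, (F.G.count_pre _).2, (F.G.count_suf _).2, List.count_eq_zero_of_not_mem hn.1,
      List.count_eq_zero_of_not_mem hn.2, List.count_eq_zero_of_not_mem (htc _), o2, o4, hmn]

theorem left_gen : F.Left (F.gen [F.ξ] [F.ξ']) := (F.left_iff _).2 F.leftOrders_gen

variable {F}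

theorem two_le_count_of_mem_core {c : Letter} (hc : c ∈ F.G.core) (X X' : List Letter) :
    2 ≤ (F.gen X X').count c := by
  rcases F.G.mem_core hc with ⟨j, hj, rfl⟩ | hY
  · have := F.G.count_IJ hj
    have h1 := F.G.count_z_core hj
    simp only [gen, List.count_append, (F.G.count_pre _).1, (F.G.count_suf _).1, h1]
    omega
  · have := F.G.two_le_count_core hc hY
    simp only [gen, List.count_append]
    omega

/-- The right side arises by doubling the image of `ξ'`. From left to right, the pigeonhole argument
keeps rigid letters out of that image: between the two `ξ'` only the `z j` with `j ∈ J` are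
unrepeated and new. From right to left, counting suffices. -/
theorem left_stable (θ : Letter → List Letter) (l r : List Letter) :
    F.Left (l ++ wsub θ (F.gen [F.ξ] [F.ξ']) ++ r) ↔
      F.Left (l ++ wsub θ (F.gen [F.ξ] [F.ξ', F.ξ']) ++ r) := by
  have hne : F.ξ' ∉ [F.ξ] := by simpa using F.ne.symm
  rw [← F.wsub_gen_outer' θ _ hne]
  have hA : F.gen [F.ξ] [F.ξ'] = (F.G.pre ++ [z F.m, t F.m, F.ξ, z F.n]) ++ [F.ξ'] ++
      (F.G.core ++ [F.ξ, z F.m]) ++ [F.ξ'] ++ ([t F.n, z F.n] ++ F.G.suf) := by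
    simp [gen]
  constructor
  · intro h
    refine (left_doubleAt ?_ l r _).2 h
    rw [left_iff] at h
    refine h.avoids (by rw [← hA]) ?_ ?_
    · intro v hv
      rw [← hA]
      simp only [List.mem_append, List.mem_cons, List.not_mem_nil, or_false] at hv
      rcases hv with hv | rfl | rfl
      · exact two_le_count_of_mem_core hv _ _
      · simp only [gen, List.count_append, List.count_cons_self]
        omega
      · simp only [gen, List.count_append, List.count_cons_self]
        omega
    · intro v hv
      simp only [List.mem_append, List.mem_cons, List.not_mem_nil, or_false] at hv
      rcases hv with hv | rfl | rfl
      · rcases F.G.mem_core hv with ⟨j, hj | hj, rfl⟩ | hY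
        · exact Or.inl (by simp [Guard.z_mem_pre, hj])
        · exact Or.inr (Or.inr ⟨j, hj, rfl, by simp [Guard.z_mem_suf, hj]⟩)
        · refine Or.inr (Or.inl ?_)
          have := F.G.two_le_count_core hv hY
          rw [List.count_append]
          omega
      · exact Or.inl (by simp)
      · exact Or.inl (by simp)
  · intro h
    refine (left_doubleAt ?_ l r _).1 h
    rw [left_iff] at h
    refine h.avoids_of_double ?_
    simp only [gen, List.count_append, List.count_cons_self]
    omega

variable (F) in
/-- The dual of the pattern `Left`. -/
def Right (u : List Letter) : Prop := F.rev.Left u.reverse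

theorem reverse_context (θ : Letter → List Letter) (l r u : List Letter) :
    (l ++ wsub θ u ++ r).reverse =
      r.reverse ++ wsub (fun c => (θ c).reverse) u.reverse ++ l.reverse := by
  simp [wsub_reverse]

theorem right_stable (θ : Letter → List Letter) (l r : List Letter) :
    F.Right (l ++ wsub θ (F.gen [F.ξ] [F.ξ']) ++ r) ↔
      F.Right (l ++ wsub θ (F.gen [F.ξ, F.ξ] [F.ξ']) ++ r) := by
  unfold Right
  rw [reverse_context, reverse_context, gen_reverse, gen_reverse]
  exact F.rev.left_stable _ _ _

/-- Now the image of `ξ` is doubled. `Right` is treated first, by the plain pigeonhole argument read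
backwards. It yields that `ξ'` occurs twice, is absent from the image of `ξ`, and has its
occurrences where the sharper pigeonhole argument for `Left` needs them. -/
theorem both_stable (θ : Letter → List Letter) (l r : List Letter) :
    (F.Left (l ++ wsub θ (F.gen [F.ξ] [F.ξ', F.ξ']) ++ r) ∧
        F.Right (l ++ wsub θ (F.gen [F.ξ] [F.ξ', F.ξ']) ++ r)) ↔
      (F.Left (l ++ wsub θ (F.gen [F.ξ, F.ξ] [F.ξ', F.ξ']) ++ r) ∧
        F.Right (l ++ wsub θ (F.gen [F.ξ, F.ξ] [F.ξ', F.ξ']) ++ r)) := by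
  have hne : F.ξ ∉ [F.ξ', F.ξ'] := by simpa using F.ne
  rw [← F.wsub_gen_outer θ _ hne]
  set A := F.gen [F.ξ] [F.ξ', F.ξ'] with hAdef
  have hcount : 2 ≤ A.count F.ξ := by
    simp only [hAdef, gen, List.count_append, List.count_cons_self]
    omega
  have hdouble : (fun c => (doubleAt θ F.ξ c).reverse) =
      doubleAt (fun c => (θ c).reverse) F.ξ := by
    funext c
    unfold doubleAt
    split_ifs <;> simp
  have transfer : F.Avoids (θ F.ξ) → F.rev.Avoids (θ F.ξ).reverse →
      ((F.Left (l ++ wsub θ A ++ r) ∧ F.Right (l ++ wsub θ A ++ r)) ↔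
        (F.Left (l ++ wsub (doubleAt θ F.ξ) A ++ r) ∧
          F.Right (l ++ wsub (doubleAt θ F.ξ) A ++ r))) := by
    intro h1 h2
    unfold Right
    rw [reverse_context, reverse_context, hdouble, left_doubleAt h1,
      left_doubleAt (θ := fun c => (θ c).reverse) h2]
  have hA : A = (F.G.pre ++ [z F.m, t F.m]) ++ [F.ξ] ++ ([z F.n, F.ξ', F.ξ'] ++ F.G.core) ++
      [F.ξ] ++ ([z F.m, F.ξ', F.ξ', t F.n, z F.n] ++ F.G.suf) := by
    simp [hAdef, gen]
  have h2 : ∀ v ∈ [z F.n, F.ξ', F.ξ'] ++ F.G.core, 2 ≤ A.count v := by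
    intro v hv
    simp only [List.mem_append, List.mem_cons, List.not_mem_nil, or_false] at hv
    rcases hv with (rfl | rfl | rfl) | hv
    · simp only [hAdef, gen, List.count_append, List.count_cons_self, List.count_cons]
      simp
      omega
    · simp only [hAdef, gen, List.count_append, List.count_cons_self]
      omega
    · simp only [hAdef, gen, List.count_append, List.count_cons_self]
      omega
    · exact two_le_count_of_mem_core hv _ _
  constructor
  · rintro ⟨hL, hR⟩
    have hL' := (F.left_iff _).1 hL
    have hR' := hR
    unfold Right at hR'
    rw [left_iff] at hR'
    have hav' : F.rev.Avoids (θ F.ξ).reverse := by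
      have hA' : A.reverse = ([z F.m, F.ξ', F.ξ', t F.n, z F.n] ++ F.G.suf).reverse ++ [F.ξ] ++
          ([z F.n, F.ξ', F.ξ'] ++ F.G.core).reverse ++ [F.ξ] ++
          (F.G.pre ++ [z F.m, t F.m]).reverse := by
        rw [hA]
        simp
      refine hR'.avoids (θ := fun c => (θ c).reverse) (v0 := F.ξ) (by
        rw [reverse_context, hA']) ?_ ?_
      · intro v hv
        rw [← hA', List.count_reverse]
        exact h2 v (List.mem_reverse.1 hv)
      · intro v hv
        rw [List.mem_reverse] at hv
        simp only [List.mem_append, List.mem_cons, List.not_mem_nil, or_false] at hv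
        rcases hv with (rfl | rfl | rfl) | hv
        · exact Or.inl (by simp)
        · exact Or.inl (by simp)
        · exact Or.inl (by simp)
        · rcases F.G.mem_core hv with ⟨j, hj | hj, rfl⟩ | hY
          · exact Or.inr (Or.inr ⟨j, by simpa [rev, Guard.rev] using hj, rfl,
              by simp [Guard.z_mem_pre, hj]⟩)
          · exact Or.inl (by simp [Guard.z_mem_suf, hj])
          · refine Or.inr (Or.inl ?_)
            have := F.G.two_le_count_core hv hY
            rw [List.count_reverse, List.count_append]
            omega
    have hξ' : F.ξ' ∉ θ F.ξ := by
      intro h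
      exact F.outer'.not_isY ((hav' F.ξ' (by simpa using h)).1 (F.rev.G.outer_mem_word _))
    have ho := hR'.last_yh_outer
    have ho2 := hR'.first_outer.trans hR'.first_outer'
    have ho3 := F.rev.G.pat_count_outer hR'.pat F.rev.outer
    rw [lastLT_reverse] at ho
    rw [firstLT_reverse] at ho2
    rw [List.count_reverse] at ho3
    have hav : F.Avoids (θ F.ξ) := by
      refine hL'.avoids_of_outer' (by rw [← hA]) ?_ ho ho2 ho3 hξ' ?_
      · rw [← hA]
        exact h2
      · intro v hv
        simp only [List.mem_append, List.mem_cons, List.not_mem_nil, or_false] at hv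
        rcases hv with (rfl | rfl | rfl) | hv
        · exact Or.inr (Or.inr ⟨Or.inl rfl, by simp⟩)
        -- This is where `ξ'` must already be doubled: occurring twice in the middle, it cannot
        -- produce any of the separated letters.
        · exact Or.inr (Or.inl (by simp [List.count_cons]; omega))
        · exact Or.inr (Or.inl (by simp [List.count_cons]; omega))
        · rcases F.G.mem_core hv with ⟨j, hj | hj, rfl⟩ | hY
          · exact Or.inl (by simp [Guard.z_mem_pre, hj])
          · exact Or.inr (Or.inr ⟨Or.inr ⟨j, hj, rfl⟩, by simp [Guard.z_mem_suf, hj]⟩)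
          · refine Or.inr (Or.inl ?_)
            have := F.G.two_le_count_core hv hY
            rw [List.count_append]
            omega
    exact (transfer hav hav').1 ⟨hL, hR⟩
  · rintro ⟨hL, hR⟩
    refine (transfer (((F.left_iff _).1 hL).avoids_of_double hcount) ?_).2 ⟨hL, hR⟩
    unfold Right at hR
    rw [reverse_context, hdouble, left_iff] at hR
    exact hR.avoids_of_double (θ := fun c => (θ c).reverse) (by rwa [List.count_reverse])

variable (F)

theorem preserves_right {R : List Letter → List Letter → Prop} (hR : ClosedRel R)
    (hp : Preserves R (Pat (F.G.word F.ξ') IsY)) : Preserves R F.Right := by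
  have h := F.rev.preserves_left hR.reverse fun u v huv hu => by
    have h1 : Pat (F.G.word F.ξ') IsY u.reverse := by
      rw [← pat_reverse, ← Guard.rev_word, List.reverse_reverse]
      exact hu
    have h2 := hp _ _ huv h1
    rw [← pat_reverse, ← Guard.rev_word, List.reverse_reverse] at h2
    exact h2
  intro u v huv hu
  exact h u.reverse v.reverse (by simpa using huv) hu

/-- Substitute `ξξ` for `ξ`. -/
theorem satisfies_double {M : Type} [Monoid M]
    (h : MonoidSatisfies M (ofList (F.gen [F.ξ] [F.ξ']), ofList (F.gen [F.ξ] [F.ξ', F.ξ']))) :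
    MonoidSatisfies M
      (ofList (F.gen [F.ξ, F.ξ] [F.ξ']), ofList (F.gen [F.ξ, F.ξ] [F.ξ', F.ξ'])) := by
  have := h.comp fun c => ofList (doubleAt (fun c => [c]) F.ξ c)
  rw [← ofList_wsub, ← ofList_wsub, F.wsub_gen_outer _ _ (by simpa using F.ne),
    F.wsub_gen_outer _ _ (by simpa using F.ne), wsub_id, wsub_id] at this
  exact this

/-- A variety whose identities preserve the patterns of the guard words does not have a
distributive lattice of subvarieties. -/
theorem not_isDistributive {V : MonoidVariety}
    (h : Preserves (identityRel V) (Pat (F.G.word F.ξ) IsY))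
    (h' : Preserves (identityRel V) (Pat (F.G.word F.ξ') IsY)) : ¬ V.IsDistributive := by
  have hcl := identityRel_closed V
  refine not_isDistributive_of_saturated
    (e0 := (ofList (F.gen [F.ξ] [F.ξ', F.ξ']), ofList (F.gen [F.ξ, F.ξ] [F.ξ', F.ξ'])))
    (e1 := (ofList (F.gen [F.ξ] [F.ξ']), ofList (F.gen [F.ξ] [F.ξ', F.ξ'])))
    (e2 := (ofList (F.gen [F.ξ] [F.ξ']), ofList (F.gen [F.ξ, F.ξ] [F.ξ'])))
    (u := ofList (F.gen [F.ξ] [F.ξ'])) (v := ofList (F.gen [F.ξ, F.ξ] [F.ξ']))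
    (saturated_of_preserves (F.preserves_left hcl h))
    (saturated_of_preserves (F.preserves_right hcl h')) ?_ ?_ ?_ F.left_gen ?_ ?_ ?_ ?_
  · intro θ l r
    simpa only [toList_mul, toList_lift, toList_ofList] using
      left_stable (F := F) (fun c => toList (θ c)) (toList l) (toList r)
  · intro θ l r
    simpa only [toList_mul, toList_lift, toList_ofList] using
      right_stable (F := F) (fun c => toList (θ c)) (toList l) (toList r)
  · intro θ l r
    simpa only [toList_mul, toList_lift, toList_ofList] using
      both_stable (F := F) (fun c => toList (θ c)) (toList l) (toList r)
  · have : F.rev.Left (F.gen [F.ξ] [F.ξ']).reverse := by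
      rw [gen_reverse]
      exact F.rev.left_gen
    exact this
  -- With `ξ` doubled it occurs four times, but `Left` allows two.
  · rintro ⟨hL, -⟩
    have h1 := F.G.pat_count_outer hL.1 F.outer
    simp only [toList_ofList, gen, List.count_append, List.count_cons_self] at h1
    omega
  · intro M h0 h1
    exact (h1.trans h0).trans (F.satisfies_double h1).symm
  · intro M _ h2
    exact h2

end Frame

end FrameWords

/-! ### The guard and the frame of `a_{k,k}[π]`. -/

section ConcreteGuard

open Letter FreeMonoid

theorem count_le_count_wsub_of_mem {α β : Type} [DecidableEq β] {θ : α → List β} {u : List α}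
    {v : α} (hv : v ∈ u) (c : β) : (θ v).count c ≤ (wsub θ u).count c := by
  obtain ⟨a, b, rfl⟩ := List.append_of_mem hv
  rw [wsub_append, wsub_cons, List.count_append, List.count_append]
  omega

/-- The index of the letter `z` at position `i` in the permuted block. -/
def permIndex {N : ℕ} (π : Equiv.Perm (Fin N)) (i : ℕ) : ℕ :=
  if h : i < N then (π ⟨i, h⟩ : ℕ) + 1 else 0

theorem permIndex_injOn {N : ℕ} (π : Equiv.Perm (Fin N)) {i e : ℕ} (hi : i < N)
    (h : permIndex π e = permIndex π i) : e = i := by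
  unfold permIndex at h
  rw [dif_pos hi] at h
  -- An `e` out of range would have index `0`, whereas indices in range are positive.
  split_ifs at h with he
  have h1 : π ⟨e, he⟩ = π ⟨i, hi⟩ := Fin.ext (by omega)
  exact congrArg Fin.val (π.injective h1)

theorem permIndex_surj {N : ℕ} (π : Equiv.Perm (Fin N)) {a : ℕ} (ha : a < N) :
    ∃ i, i < N ∧ permIndex π i = a + 1 := by
  refine ⟨π.symm ⟨a, ha⟩, (π.symm ⟨a, ha⟩).2, ?_⟩
  simp [permIndex]

/-- The block of the permuted part at position `i`. -/
def permBlock {N : ℕ} (π : Equiv.Perm (Fin N)) (i : ℕ) : List Letter :=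
  z (permIndex π i) :: if i + 1 < N then [y (i + 1), y (i + 1)] else []

theorem z_mem_permBlock {N : ℕ} (π : Equiv.Perm (Fin N)) (i j : ℕ) :
    z j ∈ permBlock π i ↔ j = permIndex π i := by
  unfold permBlock
  split_ifs <;> simp

theorem count_permBlock {N : ℕ} (π : Equiv.Perm (Fin N)) {i : ℕ} (hi : i < N) (u : List ℕ) :
    (wsub (permBlock π) u).count (z (permIndex π i)) = u.count i := by
  rw [count_wsub (c := i) (n := 1), one_mul]
  · unfold permBlock
    split_ifs <;> simp
  · intro e he h
    rw [z_mem_permBlock] at h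
    exact he (permIndex_injOn π hi h.symm)

section

variable {k : ℕ} {π : Equiv.Perm (Fin (k + 1 + (k + 1)))} (hπ : π ∈ sharpPerm (k + 1))
include hπ

theorem permIndex_of_lt {i : ℕ} (hi : i < k + 1) :
    ∃ a < k + 1, permIndex π i = k + 1 + a + 1 := by
  have hi' : i < k + 1 + (k + 1) := by omega
  have h1 := hπ.1 ⟨i, hi'⟩ hi
  have h2 := (π ⟨i, hi'⟩).2
  refine ⟨(π ⟨i, hi'⟩ : ℕ) - (k + 1), by omega, ?_⟩
  rw [permIndex, dif_pos hi']
  omega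

theorem permIndex_of_ge {i : ℕ} (hi : k + 1 ≤ i) (hi' : i < k + 1 + (k + 1)) :
    ∃ a < k + 1, permIndex π i = a + 1 := by
  refine ⟨π ⟨i, hi'⟩, hπ.2 ⟨i, hi'⟩ hi, ?_⟩
  rw [permIndex, dif_pos hi']

end

variable {k : ℕ} {π : Equiv.Perm (Fin (k + 1 + (k + 1)))}

/-- The first half of the permuted part. -/
def firstHalf (π : Equiv.Perm (Fin (k + 1 + (k + 1)))) : List Letter :=
  wsub (permBlock π) (List.range k) ++ [z (permIndex π k)]

/-- The second half of the permuted part. -/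
def secondHalf (π : Equiv.Perm (Fin (k + 1 + (k + 1)))) : List Letter :=
  wsub (permBlock π) ((List.range (k + 1)).map (k + 1 + ·))

theorem firstHalf_append (π : Equiv.Perm (Fin (k + 1 + (k + 1)))) :
    firstHalf π ++ [y (k + 1), y (k + 1)] = wsub (permBlock π) (List.range (k + 1)) := by
  rw [List.range_succ, wsub_append]
  simp [firstHalf, permBlock]

/-- The guard of the word `a_{k,k}[π]`. -/
def permGuard (hπ : π ∈ sharpPerm (k + 1)) : Guard where
  I := (List.range (k + 1)).map (· + 1)
  J := (List.range (k + 1)).map (k + 1 + · + 1)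
  CF := firstHalf π
  CL := secondHalf π
  -- The parameter is shifted by one: the permuted part has two halves of `k + 1` letters `z`, and
  -- the square of `y (k + 1)` stands between them.
  h := k + 1
  κ := permIndex π k
  ζ := permIndex π (k + 1)
  h_ne := by omega
  nodup := by
    rw [List.nodup_append]
    refine ⟨List.nodup_range.map fun a b h => by omega,
      List.nodup_range.map fun a b h => by omega, ?_⟩
    intro a ha b hb
    simp only [List.mem_map, List.mem_range] at ha hb
    omega
  CF_count := by
    intro j hj
    simp only [List.mem_map, List.mem_range] at hj
    obtain ⟨a, ha, rfl⟩ := hj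
    obtain ⟨i, hi, hia⟩ := permIndex_surj π (a := k + 1 + a) (by omega)
    -- Sharpness of `π` places exactly the `z j` with `j ∈ J` in the first half.
    have hik : i < k + 1 := by
      by_contra h
      obtain ⟨b, hb, hb'⟩ := permIndex_of_ge hπ (by omega) hi
      omega
    have h1 := count_permBlock π hi (List.range (k + 1))
    rw [← firstHalf_append, List.count_eq_one_of_mem List.nodup_range (by simpa using hik)] at h1
    rw [← hia]
    simpa using h1
  CL_count := by
    intro j hj
    simp only [List.mem_map, List.mem_range] at hj
    obtain ⟨a, ha, rfl⟩ := hj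
    obtain ⟨i, hi, hia⟩ := permIndex_surj π (a := a) (by omega)
    have hik : k + 1 ≤ i := by
      by_contra h
      obtain ⟨b, hb, hb'⟩ := permIndex_of_lt hπ (i := i) (by omega)
      omega
    have h1 := count_permBlock π hi ((List.range (k + 1)).map (k + 1 + ·))
    rw [List.count_eq_one_of_mem (List.nodup_range.map fun a b h => by omega) (by
      simp only [List.mem_map, List.mem_range]
      exact ⟨i - (k + 1), by omega, by omega⟩)] at h1
    rw [← hia]
    exact h1
  CF_mem := by
    have hz : ∀ i < k + 1, ∃ j ∈ (List.range (k + 1)).map (k + 1 + · + 1),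
        z (permIndex π i) = z j := by
      intro i hi
      obtain ⟨a, ha, h⟩ := permIndex_of_lt hπ hi
      exact ⟨permIndex π i, List.mem_map.2 ⟨a, by simpa using ha, h.symm⟩, rfl⟩
    intro c hc
    simp only [firstHalf, List.mem_append, mem_wsub, List.mem_range, List.mem_singleton] at hc
    rcases hc with ⟨i, hi, hc⟩ | rfl
    · have hi' : i + 1 < k + 1 + (k + 1) := by omega
      have hb : permBlock π i = [z (permIndex π i), y (i + 1), y (i + 1)] := by
        simp [permBlock, hi']
      have h2 := count_le_count_wsub_of_mem (θ := permBlock π) (List.mem_range.2 hi) (y (i + 1))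
      simp only [hb, List.mem_cons, List.not_mem_nil, or_false] at hc
      rcases hc with rfl | hc
      · exact Or.inl (hz i (by omega))
      · refine Or.inr ⟨i + 1, by omega, by omega, by tauto, ?_⟩
        have hc' : c = y (i + 1) := by tauto
        rw [hb] at h2
        simp at h2
        rw [hc', firstHalf, List.count_append]
        omega
    · exact Or.inl (hz k (by omega))
  CL_mem := by
    intro c hc
    simp only [secondHalf, mem_wsub, List.mem_map, List.mem_range] at hc
    obtain ⟨_, ⟨i, hi, rfl⟩, hc⟩ := hc
    have h2 := count_le_count_wsub_of_mem (θ := permBlock π) (u := (List.range (k + 1)).map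
      (k + 1 + ·)) (v := k + 1 + i) (by simpa using hi) c
    simp only [permBlock, List.mem_cons] at hc
    rcases hc with rfl | hc
    · obtain ⟨a, ha, h⟩ := permIndex_of_ge hπ (i := k + 1 + i) (by omega) (by omega)
      exact Or.inl ⟨_, List.mem_map.2 ⟨a, by simpa using ha, h.symm⟩, rfl⟩
    · split_ifs at hc with h
      · have hc' : c = y (k + 1 + i + 1) := by
          simpa using hc
        subst hc'
        refine Or.inr ⟨k + 1 + i + 1, by omega, by omega, rfl, ?_⟩
        have hb : permBlock π (k + 1 + i) =
            [z (permIndex π (k + 1 + i)), y (k + 1 + i + 1), y (k + 1 + i + 1)] := by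
          simp [permBlock, h]
        rw [hb] at h2
        simp at h2
        exact h2
      · simp at hc
  κ_mem := by
    obtain ⟨a, ha, h⟩ := permIndex_of_lt hπ (i := k) (by omega)
    exact List.mem_map.2 ⟨a, by simpa using ha, h.symm⟩
  ζ_mem := by
    obtain ⟨a, ha, h⟩ := permIndex_of_ge hπ (i := k + 1) le_rfl (by omega)
    exact List.mem_map.2 ⟨a, by simpa using ha, h.symm⟩
  CF_last := ⟨_, rfl⟩
  CL_head := by
    rw [secondHalf, List.range_succ_eq_map, List.map_cons, wsub_cons, permBlock]
    exact ⟨_, rfl⟩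

theorem permGuard_core (hπ : π ∈ sharpPerm (k + 1)) :
    (permGuard hπ).core = wsub (permBlock π) (List.range (k + 1 + (k + 1))) := by
  rw [Guard.core]
  change firstHalf π ++ [y (k + 1), y (k + 1)] ++ secondHalf π = _
  rw [firstHalf_append, secondHalf, ← wsub_append, ← List.range_add]

theorem toList_prod_map {α : Type} (f : α → Word) (u : List α) :
    toList (u.map f).prod = wsub (fun i => toList (f i)) u := by
  induction u with
  | nil => rfl
  | cons c u ih => simp [ih]

theorem wsub_map {α β γ : Type} (θ : β → List γ) (f : α → β) (u : List α) :
    wsub θ (u.map f) = wsub (fun a => θ (f a)) u := by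
  induction u with
  | nil => rfl
  | cons c u ih => simp [ih]

theorem toList_aWord (hπ : π ∈ sharpPerm (k + 1)) :
    toList (aWord (k + 1) (k + 1) π) = (permGuard hπ).word x := by
  have h1 : (permGuard hπ).pre = wsub (fun i => [z (i + 1), t (i + 1)]) (List.range (k + 1)) :=
    wsub_map _ _ _
  have h2 : (permGuard hπ).suf =
      wsub (fun i => [t (k + 1 + i + 1), z (k + 1 + i + 1)]) (List.range (k + 1)) :=
    wsub_map _ _ _
  have h3 : (permGuard hπ).core = wsub (fun i : Fin (k + 1 + (k + 1)) => permBlock π i)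
      (List.finRange (k + 1 + (k + 1))) := by
    rw [permGuard_core, ← List.map_coe_finRange_eq_range, wsub_map]
  have h4 : ∀ i : Fin (k + 1 + (k + 1)), toList (wz ((π i : ℕ) + 1) *
      (if (i : ℕ) + 1 < k + 1 + (k + 1) then wy ((i : ℕ) + 1) ^ 2 else 1)) = permBlock π i := by
    intro i
    have : permIndex π i = (π i : ℕ) + 1 := by simp [permIndex]
    unfold permBlock
    rw [this]
    split_ifs <;> simp [wz, wy, pow_succ, toList_mul]
  simp only [aWord, toList_mul, toList_prod_map, Guard.word, h1, h2, h3, h4]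
  simp [wx, wz, wt]

theorem squareY_of_not {c : Letter} (h : ¬ IsY c) : squareY c = [c] := by
  simp [squareY, expand, h]

theorem squareY_of_isY {c : Letter} (h : IsY c) : squareY c = [c, c] := by
  simp [squareY, expand, h]

theorem wsub_squareY_of_not {u : List Letter} (h : ∀ c ∈ u, ¬ IsY c) : wsub squareY u = u :=
  (wsub_congr (τ := fun c => [c]) fun c hc => squareY_of_not (h c hc)).trans (wsub_id u)

/-- The `y i` already occur as squares, and `Y⁴ = Y²` modulo `α₁°`. So the word belongs to the class
on which the sorting argument lands. -/
theorem aperiodicClass_squareY_permBlock {N : ℕ} (π : Equiv.Perm (Fin N)) (i : ℕ) :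
    aperiodicClass (wsub squareY (permBlock π i)) = aperiodicClass (permBlock π i) := by
  unfold permBlock
  rw [wsub_cons, squareY_of_not (Guard.not_isY_z _)]
  split_ifs
  · have h : wsub squareY [y (i + 1), y (i + 1)] =
        ([y (i + 1)] ++ [y (i + 1)] ++ [y (i + 1)]) ++ [y (i + 1)] := by
      simp [squareY_of_isY (Guard.isY_y (Nat.succ_ne_zero i))]
    have h' : z (permIndex π i) :: [y (i + 1), y (i + 1)] =
        [z (permIndex π i)] ++ ([y (i + 1)] ++ [y (i + 1)]) := rfl
    rw [h, h']
    simp only [aperiodicClass_append]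
    rw [← aperiodic_square, ← aperiodic_square]
  · simp

theorem aperiodicClass_squareY_permGuard (hπ : π ∈ sharpPerm (k + 1)) :
    aperiodicClass (wsub squareY ((permGuard hπ).word x)) =
      aperiodicClass ((permGuard hπ).word x) := by
  have hx : ¬ IsY x := by
    rintro ⟨i, _, h⟩
    cases h
  have h1 : wsub squareY (permGuard hπ).pre = (permGuard hπ).pre := by
    refine wsub_squareY_of_not fun c hc => ?_
    obtain ⟨i, _, rfl | rfl⟩ := (Guard.mem_pre _).1 hc
    · exact Guard.not_isY_z _
    · exact Guard.not_isY_t _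
  have h2 : wsub squareY (permGuard hπ).suf = (permGuard hπ).suf := by
    refine wsub_squareY_of_not fun c hc => ?_
    obtain ⟨i, _, rfl | rfl⟩ := (Guard.mem_suf _).1 hc
    · exact Guard.not_isY_t _
    · exact Guard.not_isY_z _
  have h3 : aperiodicClass (wsub squareY (permGuard hπ).core) =
      aperiodicClass (permGuard hπ).core := by
    rw [permGuard_core, wsub_wsub, aperiodicClass_wsub, aperiodicClass_wsub]
    simp only [aperiodicClass_squareY_permBlock]
  simp only [Guard.word, wsub_append, h1, h2, aperiodicClass_append, h3, wsub_cons, wsub_nil,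
    squareY_of_not hx, List.append_nil]

/-- The frame of the word `a_{k,k}[π]`. -/
def permFrame (hπ : π ∈ sharpPerm (k + 1)) : Frame where
  G := permGuard hπ
  ξ := x
  -- `y 0` and the indices `0` and `2(k + 1) + 1` are fresh: the word uses only `y` with positive
  -- index, and `z`, `t` with indices from `1` to `2(k + 1)`.
  ξ' := y 0
  m := 0
  n := k + 1 + (k + 1) + 1
  outer := Or.inl rfl
  outer' := Or.inr rfl
  ne := by simp
  m_not := by simp [permGuard]
  n_not := by
    constructor
    · simp [permGuard]
      omega
    · simp [permGuard]
  m_ne_n := by omega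

theorem not_isDistributive_aVariety_aperiodic (hπ : π ∈ sharpPerm (k + 1)) :
    ¬ (aVariety alphaOneAperiodic (k + 1) π).IsDistributive :=
  (permFrame hπ).not_isDistributive
    ((permGuard hπ).preserves_pat rfl (toList_aWord hπ) (aperiodicClass_squareY_permGuard hπ)
      (Or.inl rfl))
    ((permGuard hπ).preserves_pat rfl (toList_aWord hπ) (aperiodicClass_squareY_permGuard hπ)
      (Or.inr rfl))

end ConcreteGuard

/-! ### The congruence `α₁`: isoterms of length three. -/

section Balanced

open Letter FreeMonoid

theorem alphaOne_le_aperiodic {u v : Word} (h : alphaOne u v) : alphaOneAperiodic u v :=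
  fun M hM => h M fun e he => hM e (Or.inr he)

/-- All three identities are balanced. This fails once `x² ≈ x³` is added, and is why `α₁` admits a
much shorter argument. -/
theorem alphaOne_count {u v : Word} (h : alphaOne u v) (c : Letter) :
    (toList u).count c = (toList v).count c := by
  refine ((fic_stable (C := fun w => (toList u).count c = (toList w).count c) ?_ h).1 rfl)
  rintro e (rfl | rfl | rfl) θ l r <;>
    simp [pow_succ, wx, wy, wz, wt, toList_mul, List.count_append] <;>
    constructor <;> intro h <;> omega

/-- The arrangements of two letters `x` and a letter `y 0`. -/
def arrangements : List (List Letter) := [[x, x, y 0], [x, y 0, x], [y 0, x, x]]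

/-- The substitution that deletes all letters but `x` and `y 0`. -/
def keep (c : Letter) : List Letter := if c = x ∨ c = y 0 then [c] else []

theorem mem_keep {u : List Letter} {c : Letter} (h : c ∈ wsub keep u) : c = x ∨ c = y 0 := by
  obtain ⟨d, _, hd⟩ := mem_wsub.1 h
  unfold keep at hd
  split_ifs at hd with h'
  · rw [List.mem_singleton.1 hd]
    exact h'
  · simp at hd

theorem mem_arrangements {s : List Letter} (hs : ∀ c ∈ s, c = x ∨ c = y 0)
    (hx : s.count x = 2) (hy : s.count (y 0) = 1) : s ∈ arrangements := by
  have key : ∀ s : List Letter, (∀ c ∈ s, c = x ∨ c = y 0) →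
      s.length = s.count x + s.count (y 0) := by
    intro s
    induction s with
    | nil => simp
    | cons c s ih =>
      intro hs
      have := ih fun d hd => hs d (List.mem_cons_of_mem _ hd)
      rcases hs c List.mem_cons_self with rfl | rfl <;> simp <;> omega
  have hl := key s hs
  rw [hx, hy] at hl
  obtain ⟨a, b, c, rfl⟩ := List.length_eq_three.1 hl
  rcases hs a (by simp) with rfl | rfl <;> rcases hs b (by simp) with rfl | rfl <;>
    rcases hs c (by simp) with rfl | rfl <;> simp_all [arrangements]

theorem arrangement_cases {L W Y R : List Letter} (hx : (L ++ W ++ W ++ Y ++ R).count x = 2)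
    (hl : (L ++ W ++ W ++ Y ++ R).length = 3)
    (hs : ∀ c ∈ L ++ W ++ W ++ Y ++ R, c = x ∨ c = y 0) : W = [] ∨ W = [x] ∧
      ((L = [y 0] ∧ Y = [] ∧ R = []) ∨ (L = [] ∧ Y = [y 0] ∧ R = []) ∨
        (L = [] ∧ Y = [] ∧ R = [y 0])) := by
  rcases W with _ | ⟨c, W⟩
  · exact Or.inl rfl
  right
  simp only [List.length_append, List.length_cons] at hl
  have hW : W = [] := List.length_eq_zero_iff.1 (by omega)
  subst hW
  have hc := hs c (by simp)
  have single : ∀ V : List Letter, V.length = 1 → (∀ d ∈ V, d ∈ L ++ [c] ++ [c] ++ Y ++ R) →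
      V = [x] ∨ V = [y 0] := by
    intro V hV hVs
    obtain ⟨d, rfl⟩ := List.length_eq_one_iff.1 hV
    rcases hs d (hVs d (by simp)) with rfl | rfl
    · exact Or.inl rfl
    · exact Or.inr rfl
  have hcases : (L.length = 1 ∧ Y = [] ∧ R = []) ∨ (L = [] ∧ Y.length = 1 ∧ R = []) ∨
      (L = [] ∧ Y = [] ∧ R.length = 1) := by
    simp only [← List.length_eq_zero_iff]
    simp only [List.length_nil] at hl
    omega
  rcases hcases with ⟨h1, rfl, rfl⟩ | ⟨rfl, h1, rfl⟩ | ⟨rfl, rfl, h1⟩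
  · rcases single L h1 (by simp; tauto) with rfl | rfl <;> rcases hc with rfl | rfl <;> simp_all
  · rcases single Y h1 (by simp; tauto) with rfl | rfl <;> rcases hc with rfl | rfl <;> simp_all
  · rcases single R h1 (by simp; tauto) with rfl | rfl <;> rcases hc with rfl | rfl <;> simp_all

/-- The image of `x` occurs twice in a word of length three with a single `y 0`, so it is empty or
`x`. Then both sides have the same image, or the contexts are empty and the substitution acts
identically, in which case `hab` decides. -/
theorem arrangement_exchange {S : Set (List Letter)} (hS : ∀ s ∈ S, s ∈ arrangements)
    {a b : List Letter} (ha : a ∈ arrangements) (hb : b ∈ arrangements) (hab : a ∈ S → b ∈ S)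
    (θ : Letter → List Letter) {L R : List Letter} (h : L ++ wsub θ a ++ R ∈ S) :
    L ++ wsub θ b ++ R ∈ S := by
  have hval : ∀ a ∈ arrangements, (L ++ wsub θ a ++ R).Perm
      (L ++ θ x ++ θ x ++ θ (y 0) ++ R) := by
    intro a ha
    rw [List.perm_iff_count]
    intro c
    simp only [arrangements, List.mem_cons, List.not_mem_nil, or_false] at ha
    rcases ha with rfl | rfl | rfl <;> simp [List.count_append] <;> omega
  have hp := hval a ha
  have hA := hS _ h
  have h3 : ∀ s ∈ arrangements, s.count x = 2 ∧ s.length = 3 ∧ ∀ c ∈ s, c = x ∨ c = y 0 := by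
    intro s hs
    simp only [arrangements, List.mem_cons, List.not_mem_nil, or_false] at hs
    rcases hs with rfl | rfl | rfl <;> simp
  obtain ⟨c1, c2, c3⟩ := h3 _ hA
  rcases arrangement_cases (L := L) (W := θ x) (Y := θ (y 0)) (R := R)
    (by rw [← hp.count_eq]; exact c1) (by rw [← hp.length_eq]; exact c2)
    (fun c hc => c3 c (hp.mem_iff.2 hc)) with hW | ⟨hW, hc⟩
  · have : ∀ a ∈ arrangements, wsub θ a = θ (y 0) := by
      intro a ha
      simp only [arrangements, List.mem_cons, List.not_mem_nil, or_false] at ha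
      rcases ha with rfl | rfl | rfl <;> simp [hW]
    rw [this a ha] at h
    rwa [this b hb]
  · rcases hc with ⟨rfl, hY, rfl⟩ | ⟨rfl, hY, rfl⟩ | ⟨rfl, hY, rfl⟩
    · have : ∀ a ∈ arrangements, wsub θ a = [x, x] := by
        intro a ha
        simp only [arrangements, List.mem_cons, List.not_mem_nil, or_false] at ha
        rcases ha with rfl | rfl | rfl <;> simp [hW, hY]
      rw [this a ha] at h
      rwa [this b hb]
    · have : ∀ a ∈ arrangements, wsub θ a = a := by
        intro a ha
        simp only [arrangements, List.mem_cons, List.not_mem_nil, or_false] at ha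
        rcases ha with rfl | rfl | rfl <;> simp [hW, hY]
      rw [this a ha] at h
      rw [this b hb]
      simpa using hab (by simpa using h)
    · have : ∀ a ∈ arrangements, wsub θ a = [x, x] := by
        intro a ha
        simp only [arrangements, List.mem_cons, List.not_mem_nil, or_false] at ha
        rcases ha with rfl | rfl | rfl <;> simp [hW, hY]
      rw [this a ha] at h
      rwa [this b hb]

theorem stable_arrangement {S : Set (List Letter)} (hS : ∀ s ∈ S, s ∈ arrangements)
    {a b : List Letter} (ha : a ∈ arrangements) (hb : b ∈ arrangements) (hab : a ∈ S ↔ b ∈ S) :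
    Stable (fun w => wsub keep (toList w) ∈ S) (ofList a, ofList b) := by
  intro θ l r
  simp only [toList_mul, toList_lift, toList_ofList, wsub_append, wsub_wsub]
  exact ⟨arrangement_exchange hS ha hb hab.1 _, arrangement_exchange hS hb ha hab.2 _⟩

namespace Guard

variable (G : Guard) {w : Word} (hw : toList w = G.word x) {V : MonoidVariety}
  (hV : V = sapirVariety alphaOne {((w : Word) : alphaOne.Quotient)})
include hw hV

theorem evaluate {s s' : List Letter} (h : identityRel V s s') {θ : Letter → List Letter}
    {p q : List Letter} (hs : p ++ wsub θ s ++ q = G.word x) :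
    Pat (G.word x) IsY (p ++ wsub θ s' ++ q) ∧
      ∀ c, (p ++ wsub θ s' ++ q).count c = (G.word x).count c := by
  subst hV
  have h1 := sapirVariety_satisfies h (fun c => ofList (θ c)) (ofList p) (ofList q) (by
    rw [← ofList_wsub, ← ofList_append, ← ofList_append, hs, ← hw]
    exact alphaOne.refl _)
  rw [← ofList_wsub, ← ofList_append, ← ofList_append] at h1
  constructor
  · refine G.pat_of_aperiodic (Or.inl rfl) (alphaOneAperiodic.symm (alphaOne_le_aperiodic h1)) ?_
    rw [hw]
    exact Pat.refl _ _
  · intro c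
    have := alphaOne_count h1 c
    rwa [hw] at this

/-- Each arrangement maps onto a factorisation of the guard word in which `y 0` takes a factor with
a linear `t`. Counts show that `s'` is again an arrangement; the position of `t` relative to the
image of `x` then determines which one. For `xxy` and `yxx` the letter `x` goes to `y h`, for `xyx`
to `z κ`. -/
theorem arrangement_isoterm {s s' : List Letter} (hs : s ∈ arrangements)
    (hs' : ∀ c ∈ s', c = x ∨ c = y 0) (h : identityRel V s s') : s' = s := by
  have hx : Outer x := Or.inl rfl
  have hxy : x ≠ y 0 := by simp
  have hY := isY_y G.h_ne
  have hyw := G.yh_mem_word x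
  let τ : List Letter → List Letter → Letter → List Letter := fun X Y c =>
    if c = x then X else if c = y 0 then Y else []
  have hτx : ∀ {X Y : List Letter} {d : Letter}, d ∈ X → d ∉ Y → ∀ e, d ∈ τ X Y e ↔ e = x := by
    intro X Y d h1 h2 e
    simp only [τ]
    split_ifs with h3 h4
    · simp [h3, h1]
    · simp [h2, h3]
    · simp [h3]
  have hτy : ∀ {X Y : List Letter} {d : Letter}, d ∉ X → d ∈ Y → ∀ e, d ∈ τ X Y e ↔ e = y 0 := by
    intro X Y d h1 h2 e
    simp only [τ]
    split_ifs with h3 h4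
    · subst h3
      simp [h1]
    · simp [h2, h4]
    · simp [h4]
  -- `d` marks the image of `x` and the linear letter `e` that of `y 0`; their preserved
  -- multiplicities give those of `x` and `y 0` in `s'`.
  have main : ∀ {X Y p q : List Letter} {d e : Letter}, p ++ wsub (τ X Y) s ++ q = G.word x →
      d ∈ X → d ∉ Y → e ∉ X → e ∈ Y → X.count d = 1 → (G.word x).count d = 2 →
      (G.word x).count e = 1 →
      s' ∈ arrangements ∧ Pat (G.word x) IsY (p ++ wsub (τ X Y) s' ++ q) ∧
        d ∉ p ∧ d ∉ q ∧ e ∉ p ∧ e ∉ q := by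
    intro X Y p q d e h0 hdX hdY heX heY hdX1 hd2 he1
    obtain ⟨hp, hc⟩ := G.evaluate hw hV h h0
    have hcX : (τ X Y x).count d = 1 := by simp [τ, hdX1]
    have hcY : (τ X Y (y 0)).count e = Y.count e := by simp [τ]
    have kd : ∀ u, (wsub (τ X Y) u).count d = u.count x := fun u => by
      rw [count_wsub hcX (fun f hf h => hf ((hτx hdX hdY f).1 h)), one_mul]
    have ke : ∀ u, (wsub (τ X Y) u).count e = Y.count e * u.count (y 0) := fun u =>
      count_wsub hcY (fun f hf h => hf ((hτy heX heY f).1 h)) u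
    have hsx : s.count x = 2 ∧ s.count (y 0) = 1 := by
      simp only [arrangements, List.mem_cons, List.not_mem_nil, or_false] at hs
      rcases hs with rfl | rfl | rfl <;> simp
    have hd' := hc d
    have he' := hc e
    rw [hd2] at hd'
    rw [he1] at he'
    rw [← h0] at hd2 he1
    have hYe := List.count_pos_iff.2 heY
    simp only [List.count_append, kd, ke, hsx.1, hsx.2, mul_one] at hd2 he1 hd' he'
    have hY1 : Y.count e = 1 := by omega
    rw [hY1] at he1 he'
    refine ⟨mem_arrangements hs' (by omega) (by omega), hp, ?_, ?_, ?_, ?_⟩ <;>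
      rw [← List.count_eq_zero] <;> omega
  have hyc : (G.word x).count (y G.h) = 2 := by
    simp [word, core, List.count_eq_zero_of_not_mem (G.y_not_mem_pre _),
      List.count_eq_zero_of_not_mem (G.y_not_mem_suf _),
      List.count_eq_zero_of_not_mem G.yh_not_mem_CF,
      List.count_eq_zero_of_not_mem G.yh_not_mem_CL]
  have hs0 := hs
  simp only [arrangements, List.mem_cons, List.not_mem_nil, or_false] at hs
  rcases hs with rfl | rfl | rfl
  · have ht := G.count_t_word hx (Or.inr G.κ_mem)
    have htw := G.t_mem_word (ξ := x) (Or.inr G.κ_mem)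
    have hyE : y G.h ∉ G.CL ++ [x] ++ G.suf := by
      simp [G.yh_not_mem_CL, G.y_not_mem_suf]
    have htE : t G.κ ∈ G.CL ++ [x] ++ G.suf := by
      simp [G.t_mem_suf, G.κ_mem]
    obtain ⟨ha, hp, h1, h2, h3, h4⟩ := main (X := [y G.h]) (Y := G.CL ++ [x] ++ G.suf)
      (p := G.pre ++ [x] ++ G.CF) (q := []) (d := y G.h) (e := t G.κ)
      (by simp [τ, word, core]) (by simp) hyE (by simp) htE (by simp) hyc ht
    have hL := lastLT_middle (hp.last _ hyw _ htw (by simp) (fun h => not_isY_t _ h.2)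
      (G.last_y_t hY G.κ_mem)) h3 h4
    rw [lastLT_wsub hxy (hτx (by simp) hyE) (hτy (by simp) htE)] at hL
    simp only [arrangements, List.mem_cons, List.not_mem_nil, or_false] at ha
    rcases ha with rfl | rfl | rfl
    · rfl
    · simp [lastLT_cons] at hL
    · simp [lastLT_cons] at hL
  · have ht := G.count_t_word hx (Or.inr G.κ_mem)
    have htw := G.t_mem_word (ξ := x) (Or.inr G.κ_mem)
    have hz := G.count_z_word hx (Or.inr G.κ_mem)
    have hzw := G.z_mem_word (ξ := x) (Or.inr G.κ_mem)
    obtain ⟨p, Rr, q, htR, hdec⟩ := G.word_decomposition x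
    have hzE : z G.κ ∉ List.replicate 2 (y G.h) ++ Rr := by
      have hz' := hz
      rw [hdec] at hz'
      simp at hz'
      simp only [List.mem_append, List.mem_replicate, reduceCtorEq, and_false, false_or]
      rw [← List.count_eq_zero]
      omega
    have htE : t G.κ ∈ List.replicate 2 (y G.h) ++ Rr := by simp [htR]
    obtain ⟨ha, hp, h1, h2, h3, h4⟩ := main (X := [z G.κ]) (Y := List.replicate 2 (y G.h) ++ Rr)
      (p := p) (q := q) (d := z G.κ) (e := t G.κ) (by simp [τ, hdec]) (by simp) hzE (by simp) htE
      (by simp) hz ht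
    have hF := firstLT_middle (hp.first _ hzw _ htw (by simp) (fun h => not_isY_t _ h.2)
      (G.first_z_t hx G.κ_mem)) h1 h2
    have hL := lastLT_middle (hp.last _ htw _ hzw (by simp) (fun h => not_isY_t _ h.1)
      (G.last_t_z G.κ_mem)) h1 h2
    rw [firstLT_wsub hxy (hτx (by simp) hzE) (hτy (by simp) htE)] at hF
    rw [lastLT_wsub hxy.symm (hτy (by simp) htE) (hτx (by simp) hzE)] at hL
    simp only [arrangements, List.mem_cons, List.not_mem_nil, or_false] at ha
    rcases ha with rfl | rfl | rfl
    · simp [lastLT_cons] at hL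
    · rfl
    · simp [firstLT_cons] at hF
  · have ht := G.count_t_word hx (Or.inl G.ζ_mem)
    have htw := G.t_mem_word (ξ := x) (Or.inl G.ζ_mem)
    have hyE : y G.h ∉ G.pre ++ [x] ++ G.CF := by
      simp [G.yh_not_mem_CF, G.y_not_mem_pre]
    have htE : t G.ζ ∈ G.pre ++ [x] ++ G.CF := by
      simp [G.t_mem_pre, G.ζ_mem]
    obtain ⟨ha, hp, h1, h2, h3, h4⟩ := main (X := [y G.h]) (Y := G.pre ++ [x] ++ G.CF)
      (p := []) (q := G.CL ++ [x] ++ G.suf) (d := y G.h) (e := t G.ζ)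
      (by simp [τ, word, core]) (by simp) hyE (by simp) htE (by simp) hyc ht
    have hF := firstLT_middle (hp.first _ htw _ hyw (by simp) (fun h => not_isY_t _ h.1)
      (G.first_t_y hY G.ζ_mem)) h3 h4
    rw [firstLT_wsub hxy.symm (hτy (by simp) htE) (hτx (by simp) hyE)] at hF
    simp only [arrangements, List.mem_cons, List.not_mem_nil, or_false] at ha
    rcases ha with rfl | rfl | rfl
    · simp [firstLT_cons] at hF
    · simp [firstLT_cons] at hF
    · rfl

theorem saturated_arrangement {S : Set (List Letter)} (hS : ∀ s ∈ S, s ∈ arrangements) :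
    Saturated V fun w => wsub keep (toList w) ∈ S := by
  refine saturated_of_preserves (C := fun u => wsub keep u ∈ S) fun u v huv hu => ?_
  have := G.arrangement_isoterm hw hV (hS _ hu) (fun c hc => mem_keep hc)
    ((identityRel_closed V).subst keep _ _ huv)
  change wsub keep v ∈ S
  rwa [this]

theorem not_isDistributive_alphaOne : ¬ V.IsDistributive := by
  have m1 : [x, x, y 0] ∈ arrangements := by simp [arrangements]
  have m2 : [x, y 0, x] ∈ arrangements := by simp [arrangements]
  have m3 : [y 0, x, x] ∈ arrangements := by simp [arrangements]
  -- The intersection with `S2` is `{yxx}`. It is stable under `e0`, which relates the two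
  -- arrangements outside it, and separates the sides of `u ≈ v`.
  let S1 : Set (List Letter) := {[x, y 0, x], [y 0, x, x]}
  let S2 : Set (List Letter) := {[x, x, y 0], [y 0, x, x]}
  have hS1 : ∀ s ∈ S1, s ∈ arrangements := by
    rintro s (rfl | rfl)
    · exact m2
    · exact m3
  have hS2 : ∀ s ∈ S2, s ∈ arrangements := by
    rintro s (rfl | rfl)
    · exact m1
    · exact m3
  have k : ∀ s ∈ arrangements, wsub keep s = s := by
    intro s hs
    simp only [arrangements, List.mem_cons, List.not_mem_nil, or_false] at hs
    rcases hs with rfl | rfl | rfl <;> simp [keep]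
  refine not_isDistributive_of_saturated
    (e0 := (ofList [x, x, y 0], ofList [x, y 0, x]))
    (e1 := (ofList [x, y 0, x], ofList [y 0, x, x]))
    (e2 := (ofList [x, x, y 0], ofList [y 0, x, x]))
    (u := ofList [y 0, x, x]) (v := ofList [x, x, y 0])
    (G.saturated_arrangement hw hV hS1) (G.saturated_arrangement hw hV hS2)
    (stable_arrangement hS1 m2 m3 (by simp [S1])) (stable_arrangement hS2 m1 m3 (by simp [S2]))
    (stable_arrangement (S := S1 ∩ S2) (fun s hs => hS1 s hs.1) m1 m2 (by simp [S1, S2]))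
    ?_ ?_ ?_ ?_ ?_
  · rw [toList_ofList, k _ m3]
    simp [S1]
  · rw [toList_ofList, k _ m3]
    simp [S2]
  · rw [toList_ofList, k _ m1]
    simp [S1]
  · intro M h0 h1
    exact (h0.trans h1).symm
  · intro M _ h2
    exact h2.symm

end Guard

end Balanced

theorem mainTheorem8 (k : ℕ) (hk : 1 ≤ k) (π : Equiv.Perm (Fin (k + k))) (hπ : π ∈ sharpPerm k) :
    ¬ (aVariety alphaOne k π).IsDistributive ∧
      ¬ (aVariety alphaOneAperiodic k π).IsDistributive := by
  obtain ⟨k, rfl⟩ := Nat.exists_eq_add_of_le' hk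
  exact ⟨(permGuard hπ).not_isDistributive_alphaOne (toList_aWord hπ) rfl,
    not_isDistributive_aVariety_aperiodic hπ⟩
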